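/- **Theorem 4.1.** Let $d\ge 2$, $0<T<\infty$, $Q_T=(0,T)\times\mathbb R^d$, $B_1=\{x\in\mathbb R^d: |x|\le 1\}$, $B_1^c=\mathbb R^d\setminus B_1$, and write $a^-=\max(-a,0)$. Let $\beta,b:\mathbb R\to\mathbb R$ and $D,K:\mathbb R^d\to\mathbb R^d$ satisfy (i) $\beta\in C^1(\mathbb R)$, $\beta(0)=0$, and $\beta'(r)\ge\alpha$ for all $r\in\mathbb R$, for some constant $\alpha>0$; (ii) $D\in L^\infty(\mathbb R^d;\mathbb R^d)\cap L^2(\mathbb R^d;\mathbb R^d)$ and $(\operatorname{div}D)^-=0$, i.e. $\operatorname{div}D$ is a nonnegative distribution; (iii) $b\in C^1(\mathbb R)$ and $b(r)\ge 0$ for all $r\in\mathbb R$; (iv) $K\in C^1(\mathbb R^d\setminus\{0\};\mathbb R^d)\cap L^1(B_1;\mathbb R^d)\cap L^p(B_1^c;\mathbb R^d)$ for some $1\le p\le 2$, $(\operatorname{div}K)^-\in L^\infty(\mathbb R^d)$ (where $\operatorname{div}K$ is the pointwise divergence on $\mathbb R^d\setminus\{0\}$), and $(K(x)\cdot x)^-|x|^{-1}\in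 L^\infty(B_1)$; (v) $K\in L^\infty(B_1^c;\mathbb R^d)$. For $u_0\in L^1_{\rm loc}(\mathbb R^d)$, a function $u\in L^1_{\rm loc}([0,T)\times\mathbb R^d)$ is called a distributional solution on $Q_T$, with initial datum $u_0$, of the nonlinear Fokker–Planck equation $$\partial_t u-\Delta\beta(u)+\operatorname{div}\big((D\,b(u)+K*u)\,u\big)=0,\qquad u(0,\cdot)=u_0,$$ where $(K*u)(t,x)=\int_{\mathbb R^d}K(x-y)\,u(t,y)\,dy$, if $\beta(u)\in L^1_{\rm loc}(Q_T)$, $(D\,b(u)+K*u)u\in L^1_{\rm loc}(Q_T;\mathbb R^d)$ and, for every $\varphi\in C_0^\infty([0,T)\times\mathbb R^d)$, $$\int_{Q_T}\Big(u\,\partial_t\varphi+\beta(u)\,\Delta\varphi+u\,\big(D\,b(u)+K*u\big)\cdot\nabla\varphi\Big)\,dt\,dx+\int_{\mathbb R^d}u_0(x)\,\varphi(0,x)\,dx=0 .$$ Let $u_1,u_2\in L^1(Q_T)\cap L^\infty(Q_T)$ be two distributional solutions on $Q_T$, with (possibly different) initial data $u_{0,1},u_{0,2}\in L^1_{\rm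 loc}(\mathbb R^d)$, such that $$\lim_{\delta\downarrow0}\ \operatorname*{ess\,sup}_{0<t<\delta}\int_{\mathbb R^d}\big(u_1(t,x)-u_2(t,x)\big)\,\psi(x)\,dx=0\qquad\text{for all }\psi\in C_0^\infty(\mathbb R^d).$$ Then $u_1=u_2$ almost everywhere on $Q_T$. -/

import Mathlib

open MeasureTheory Set Filter
open scoped Topology ENNReal ContDiff

noncomputable section

namespace NFPE

/-- The Euclidean space of dimension `d`. -/
abbrev Space (d : ℕ) : Type := EuclideanSpace ℝ (Fin d)

/-- The open space-time cylinder `(0, T) × ℝ^d`. -/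
def cylinder (d : ℕ) (T : ℝ) : Set (ℝ × Space d) := Ioo 0 T ×ˢ univ

/-- The closed unit ball `{x : |x| ≤ 1}`. -/
def unitBall (d : ℕ) : Set (Space d) := Metric.closedBall 0 1

/-- The pointwise divergence of a vector field, `∑ i, ∂ᵢ Kᵢ`. -/
def divergence {d : ℕ} (K : Space d → Space d) (x : Space d) : ℝ :=
  ∑ i : Fin d, (fderiv ℝ K x (EuclideanSpace.single i 1)) i

/-- Smooth compactly supported functions on `ℝ^d`. -/
def IsTestFunction {d : ℕ} (ψ : Space d → ℝ) : Prop :=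
  ContDiff ℝ ∞ ψ ∧ HasCompactSupport ψ

/-- `(div D)⁻ = 0` in the sense of distributions: the distribution `div D` is nonnegative, that is
`⟨div D, ψ⟩ = -∫ D · ∇ψ dx ≥ 0` for every nonnegative test function `ψ`. -/
def DivergenceNonneg {d : ℕ} (D : Space d → Space d) : Prop :=
  ∀ ψ : Space d → ℝ, IsTestFunction ψ → (∀ x, 0 ≤ ψ x) →
    0 ≤ -∫ x, inner ℝ (D x) (gradient ψ x)

/-- Test functions of class `C_0^∞([0, T) × ℝ^d)`: (restrictions to `t ≥ 0` of) smooth functions on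
`ℝ × ℝ^d` with compact support contained in `(-∞, T) × ℝ^d`. They need not vanish at `t = 0`. -/
def IsSpaceTimeTestFunction {d : ℕ} (T : ℝ) (φ : ℝ × Space d → ℝ) : Prop :=
  ContDiff ℝ ∞ φ ∧ HasCompactSupport φ ∧ tsupport φ ⊆ Iio T ×ˢ univ

/-- The spatial convolution `(K * u(t, ·))(x) = ∫ u(t, y) K(x - y) dy`. -/
def interaction {d : ℕ} (K : Space d → Space d) (u : ℝ × Space d → ℝ) (q : ℝ × Space d) :
    Space d :=
  convolution (fun y => u (q.1, y)) K (ContinuousLinearMap.lsmul ℝ ℝ) volume q.2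

/-- The flux `(D(x) b(u(t, x)) + (K * u(t, ·))(x)) u(t, x)`. -/
def flux {d : ℕ} (b : ℝ → ℝ) (D K : Space d → Space d) (u : ℝ × Space d → ℝ)
    (q : ℝ × Space d) : Space d :=
  u q • (b (u q) • D q.2 + interaction K u q)

/-- `u` is a distributional solution on `(0, T) × ℝ^d` of
`∂ₜ u - Δ β(u) + div ((D b(u) + K * u) u) = 0`, `u(0, ·) = u₀`. -/
structure IsDistributionalSolution {d : ℕ} (β b : ℝ → ℝ) (D K : Space d → Space d) (T : ℝ)
    (u₀ : Space d → ℝ) (u : ℝ × Space d → ℝ) : Prop where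
  locallyIntegrable_initial : LocallyIntegrable u₀
  locallyIntegrable : LocallyIntegrableOn u (Ico 0 T ×ˢ univ)
  locallyIntegrable_diffusion : LocallyIntegrableOn (fun q => β (u q)) (cylinder d T)
  locallyIntegrable_flux : LocallyIntegrableOn (flux b D K u) (cylinder d T)
  weak_form : ∀ φ : ℝ × Space d → ℝ, IsSpaceTimeTestFunction T φ →
    (∫ q in cylinder d T,
        (u q * deriv (fun s => φ (s, q.2)) q.1
          + β (u q) * Laplacian.laplacian (fun y => φ (q.1, y)) q.2
          + inner ℝ (flux b D K u q) (gradient (fun y => φ (q.1, y)) q.2)))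
      + ∫ x, u₀ x * φ (0, x) = 0

end NFPE

end

/-! The difference `z = u₁ - u₂` solves the linear equation `∂ₜz = Δw - div F`, where `w = β(u₁) -
β(u₂)` and `F` is the difference of the fluxes. Uniqueness is an energy estimate for `z` in `H⁻¹`.
Let `m(ξ) = (1 + 4π²|ξ|²)⁻¹` be the symbol of `(1 - Δ)⁻¹`. Because `4π²|ξ|² m = 1 - m ≤ 1`, the time
derivative of `∫ m|ẑ|²` is `-2∫ zw` plus terms that Young's inequality bounds by `(c₁ + c₂) ∫ m|ẑ|²
+ ‖w‖₂²/c₁ + ‖F‖₂²/c₂` (`resolventSymbol_mul_re_le`). The lower bound on `β'` gives `zw ≥ αz²`,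
boundedness of the solutions gives `|w| ≤ L|z|`, and the flux satisfies `‖F(t)‖₂² ≤ a(t)‖z(t)‖₂²`.
With `c₁ = L²/α` and `c₂ = a/α` the terms in `‖z‖₂²` cancel exactly (`ae_energyDeriv_le`), and
Grönwall's inequality yields `z = 0`.

The flux bound (`lintegral_sq_sliceFlux_sub_le`) splits `K` into its restriction to the unit ball,
in `L¹`, and the rest, in `Lᵖ ∩ L^∞ ⊆ L²`. Its coefficient contains `‖uᵢ(t)‖₂² ≤ M‖uᵢ(t)‖₁`, which
is integrable in time but not known to be bounded. Hence Grönwall's inequality is needed with an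
integrable coefficient, and `F` is controlled only in `L¹(0,T; L²)`.

The energy identity is justified frequency by frequency: for almost every `ξ`, the function `ẑ(·,
ξ)` is a primitive of the transformed right-hand side (`ae_hat_eq_primitive`). As that side grows
with `|ξ|`, the energy is truncated to `|ξ| < R`; the price is a tail `∫_{|ξ| ≥ R} |ẑ||ŵ|`, which
vanishes as `R → ∞`. The initial data play no role beyond their difference, which the weak limit at
`t = 0` forces to vanish as a distribution (`ae_integral_sub_eq`). -/

/-! ### Absolutely continuous functions and a Grönwall estimate -/

noncomputable section

namespace NFPE

/-- Post-composition with a function that is Lipschitz on the range preserves absolute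
continuity. -/
theorem absolutelyContinuousOnInterval_comp_of_dist_le {f g : ℝ → ℝ} {a b : ℝ}
    (hf : AbsolutelyContinuousOnInterval f a b)
    (h : ∀ x ∈ uIcc a b, ∀ y ∈ uIcc a b, dist (g x) (g y) ≤ dist (f x) (f y)) :
    AbsolutelyContinuousOnInterval g a b := by
  refine squeeze_zero' (Eventually.of_forall fun I => Finset.sum_nonneg fun _ _ => dist_nonneg) ?_ hf
  have : ∀ᶠ I in 𝓟 (AbsolutelyContinuousOnInterval.disjWithin a b),
      I ∈ AbsolutelyContinuousOnInterval.disjWithin a b := mem_principal_self _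
  refine Eventually.filter_mono inf_le_right ?_
  filter_upwards [this] with I hI
  refine Finset.sum_le_sum fun i hi => ?_
  have := hI.1 i hi
  exact h _ this.1 _ this.2

/-- Grönwall's inequality for absolutely continuous functions with an integrable coefficient. -/
theorem le_exp_mul_integral_of_deriv_le {T : ℝ} (hT : 0 < T) {ψ a e : ℝ → ℝ}
    (hψ : IntervalIntegrable ψ volume 0 T) (ha : IntervalIntegrable a volume 0 T)
    (he : IntervalIntegrable e volume 0 T) (ha0 : ∀ t, 0 ≤ a t) (he0 : ∀ t, 0 ≤ e t)
    (h : ∀ᵐ t ∂(volume.restrict (Ioo 0 T)), ψ t ≤ e t + a t * ∫ s in 0..t, ψ s) :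
    ∀ t ∈ Icc 0 T, ∫ s in 0..t, ψ s ≤ Real.exp (∫ s in 0..T, a s) * ∫ s in 0..T, e s := by
  intro t ht
  set H : ℝ → ℝ := fun t => ∫ s in 0..t, ψ s with hH
  set A : ℝ → ℝ := fun t => ∫ s in 0..t, a s with hA
  have hsub : uIcc 0 t ⊆ uIcc 0 T := by
    rw [uIcc_of_le ht.1, uIcc_of_le hT.le]; exact Icc_subset_Icc_right ht.2
  have hψt := hψ.mono_set hsub
  have hat := ha.mono_set hsub
  have het := he.mono_set hsub
  have hHac : AbsolutelyContinuousOnInterval H 0 t :=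
    hψt.absolutelyContinuousOnInterval_intervalIntegral (by simp)
  have hAac : AbsolutelyContinuousOnInterval A 0 t :=
    hat.absolutelyContinuousOnInterval_intervalIntegral (by simp)
  have hA0 : ∀ s, 0 ≤ s → 0 ≤ A s := fun s hs =>
    intervalIntegral.integral_nonneg hs fun _ _ => ha0 _
  -- The map `x ↦ exp(-x)` is 1-Lipschitz on `[0, ∞)`, and `A ≥ 0`, so the integrating factor
  -- inherits absolute continuity from `A`.
  have hEac : AbsolutelyContinuousOnInterval (fun s => Real.exp (-A s)) 0 t := by
    refine absolutelyContinuousOnInterval_comp_of_dist_le hAac fun x hx y hy => ?_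
    rw [uIcc_of_le ht.1] at hx hy
    have key : ∀ u v : ℝ, 0 ≤ u → u ≤ v → |Real.exp (-u) - Real.exp (-v)| ≤ |u - v| := by
      intro u v hu huv
      have h1 : Real.exp (-v) ≤ Real.exp (-u) := Real.exp_le_exp.2 (by linarith)
      rw [abs_of_nonneg (by linarith), abs_of_nonpos (by linarith)]
      have h2 := Real.add_one_le_exp (-(v - u))
      have h3 : Real.exp (-v) = Real.exp (-u) * Real.exp (-(v - u)) := by
        rw [← Real.exp_add]; congr 1; ring
      have h4 : Real.exp (-u) ≤ 1 := Real.exp_le_one_iff.2 (by linarith)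
      have h5 := Real.exp_pos (-u)
      rw [h3]
      nlinarith [mul_nonneg h5.le (sub_nonneg.2 huv)]
    rw [Real.dist_eq, Real.dist_eq]
    rcases le_total (A x) (A y) with hxy | hxy
    · exact key _ _ (hA0 _ hx.1) hxy
    · rw [abs_sub_comm, abs_sub_comm (A x)]; exact key _ _ (hA0 _ hy.1) hxy
  have hHd := hψt.ae_hasDerivAt_integral
  have hAd := hat.ae_hasDerivAt_integral
  have hint := hHac.integral_deriv_mul_eq_sub hEac
  -- Almost everywhere `(H exp(-A))' = (ψ - aH) exp(-A) ≤ e`, since `exp(-A) ≤ 1` and `e ≥ 0`.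
  have hE : H t * Real.exp (-A t) ≤ ∫ s in 0..t, e s := by
    have h0 : H 0 = 0 := by simp [hH]
    rw [h0, zero_mul, sub_zero] at hint
    rw [← hint]
    have hi : IntervalIntegrable (fun x => deriv H x * Real.exp (-A x) +
        H x * deriv (fun s => Real.exp (-A s)) x) volume 0 t := by
      exact (hHac.intervalIntegrable_deriv.mul_continuousOn hEac.continuousOn).add
        (hEac.intervalIntegrable_deriv.continuousOn_mul hHac.continuousOn)
    rw [intervalIntegral.integral_of_le ht.1, intervalIntegral.integral_of_le ht.1,
      integral_Ioc_eq_integral_Ioo, integral_Ioc_eq_integral_Ioo]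
    have hIoo : Ioo 0 t ⊆ Ioo 0 T := Ioo_subset_Ioo_right ht.2
    refine integral_mono_ae ?_ ?_ ?_
    · exact ((intervalIntegrable_iff_integrableOn_Ioo_of_le ht.1).1 hi)
    · exact ((intervalIntegrable_iff_integrableOn_Ioo_of_le ht.1).1 het)
    filter_upwards [ae_restrict_of_ae_restrict_of_subset hIoo h, ae_restrict_of_ae hHd,
      ae_restrict_of_ae hAd, ae_restrict_mem measurableSet_Ioo] with s hs1 hs2 hs3 hs4
    have hs5 : s ∈ uIcc 0 t := by rw [uIcc_of_le ht.1]; exact Ioo_subset_Icc_self hs4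
    have d1 := hs2 hs5 0 (by simp)
    have d2 := hs3 hs5 0 (by simp)
    have d3 : HasDerivAt (fun s => Real.exp (-A s)) (Real.exp (-A s) * (-a s)) s := (d2.neg).exp
    rw [d3.deriv, show deriv H s = ψ s from d1.deriv]
    have h6 : Real.exp (-A s) ≤ 1 := Real.exp_le_one_iff.2 (by linarith [hA0 s hs4.1.le])
    have h7 := Real.exp_pos (-A s)
    have : ψ s * Real.exp (-A s) + H s * (Real.exp (-A s) * -a s)
        = (ψ s - a s * H s) * Real.exp (-A s) := by ring
    rw [this]
    have h8 : ψ s - a s * H s ≤ e s := by linarith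
    nlinarith [he0 s, mul_le_mul_of_nonneg_right h8 h7.le]
  have hAT : A t ≤ A T := by
    refine intervalIntegral.integral_mono_interval le_rfl ht.1 ht.2
      (Eventually.of_forall fun _ => ha0 _) ha
  have heT : ∫ s in 0..t, e s ≤ ∫ s in 0..T, e s :=
    intervalIntegral.integral_mono_interval le_rfl ht.1 ht.2
      (Eventually.of_forall fun _ => he0 _) he
  have he0' : 0 ≤ ∫ s in 0..t, e s := intervalIntegral.integral_nonneg ht.1 fun _ _ => he0 _
  calc H t = Real.exp (A t) * (H t * Real.exp (-A t)) := by
        rw [mul_comm (H t), ← mul_assoc, ← Real.exp_add]; simp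
    _ ≤ Real.exp (A t) * ∫ s in 0..t, e s := by gcongr
    _ ≤ Real.exp (A T) * ∫ s in 0..T, e s := by gcongr

/-- The square of a primitive is the integral of twice its product with the integrand. -/
theorem sq_integral_eq {q : ℝ → ℝ} {t : ℝ} (hq : IntervalIntegrable q volume 0 t) :
    (∫ s in 0..t, q s) ^ 2 = ∫ s in 0..t, 2 * ((∫ r in 0..s, q r) * q s) := by
  have hac : AbsolutelyContinuousOnInterval (fun t => ∫ s in 0..t, q s) 0 t :=
    hq.absolutelyContinuousOnInterval_intervalIntegral (by simp)
  have h := hac.integral_deriv_mul_eq_sub hac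
  simp only [intervalIntegral.integral_same, mul_zero, sub_zero] at h
  rw [sq, ← h]
  refine intervalIntegral.integral_congr_ae ?_
  filter_upwards [hq.ae_hasDerivAt_integral] with s hs hs'
  rw [(hs (uIoc_subset_uIcc hs') 0 (by simp)).deriv]
  ring

/-- Real and imaginary parts reduce this to the real case. It is applied to `ẑ(·, ξ)` at fixed
frequency, where it provides the energy identity. -/
theorem normSq_integral_eq {q : ℝ → ℂ} {t : ℝ} (hq : IntervalIntegrable q volume 0 t) :
    ‖∫ s in 0..t, q s‖ ^ 2
      = ∫ s in 0..t, 2 * ((starRingEnd ℂ) (∫ r in 0..s, q r) * q s).re := by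
  have hre : IntervalIntegrable (fun s => (q s).re) volume 0 t := ⟨hq.1.re, hq.2.re⟩
  have him : IntervalIntegrable (fun s => (q s).im) volume 0 t := ⟨hq.1.im, hq.2.im⟩
  have hmono : ∀ s ∈ uIcc 0 t, uIcc 0 s ⊆ uIcc 0 t := fun s hs => uIcc_subset_uIcc (by simp) hs
  have r1 : ∀ s ∈ uIcc 0 t, (∫ r in 0..s, q r).re = ∫ r in 0..s, (q r).re := fun s hs => by
    have := Complex.reCLM.intervalIntegral_comp_comm (hq.mono_set (hmono s hs))
    simpa using this.symm
  have r2 : ∀ s ∈ uIcc 0 t, (∫ r in 0..s, q r).im = ∫ r in 0..s, (q r).im := fun s hs => by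
    have := Complex.imCLM.intervalIntegral_comp_comm (hq.mono_set (hmono s hs))
    simpa using this.symm
  have hc : ∀ {p : ℝ → ℝ}, IntervalIntegrable p volume 0 t →
      IntervalIntegrable (fun s => 2 * ((∫ r in 0..s, p r) * p s)) volume 0 t := fun {p} hp => by
    have hac : AbsolutelyContinuousOnInterval (fun t => ∫ s in 0..t, p s) 0 t :=
      hp.absolutelyContinuousOnInterval_intervalIntegral (by simp)
    exact (hp.continuousOn_mul hac.continuousOn).const_mul 2
  rw [← Complex.normSq_eq_norm_sq, Complex.normSq_apply, r1 t (by simp), r2 t (by simp), ← sq, ← sq,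
    sq_integral_eq hre, sq_integral_eq him, ← intervalIntegral.integral_add (hc hre) (hc him)]
  refine intervalIntegral.integral_congr fun s hs => ?_
  simp only [Complex.mul_re, Complex.conj_re, Complex.conj_im, r1 s hs, r2 s hs]
  ring

/-- A function on `(0, T)` whose primitive vanishes at all rational points vanishes a.e. -/
theorem ae_eq_zero_of_primitive_eq_zero {T : ℝ} (hT : 0 < T) {q : ℝ → ℂ}
    (hq : IntegrableOn q (Ioo 0 T))
    (h : ∀ r : ℚ, (r : ℝ) ∈ Ioo 0 T → ∫ s in Ioo 0 (r : ℝ), q s = 0) :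
    ∀ᵐ t ∂(volume.restrict (Ioo 0 T)), q t = 0 := by
  have hq' : IntervalIntegrable q volume 0 T :=
    (intervalIntegrable_iff_integrableOn_Ioo_of_le hT.le).2 hq
  have hcont : ContinuousOn (fun t => ∫ s in 0..t, q s) (Icc 0 T) :=
    intervalIntegral.continuousOn_primitive_interval' (by simpa [uIcc_of_le hT.le] using hq')
      (by simp [hT.le]) |>.mono (by rw [uIcc_of_le hT.le])
  have hz : ∀ t ∈ Ioo 0 T, ∫ s in 0..t, q s = 0 := by
    intro t ht
    by_contra hne
    have ho : IsOpen (Ioo 0 T ∩ (fun t => ∫ s in 0..t, q s) ⁻¹' {0}ᶜ) :=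
      (hcont.mono Ioo_subset_Icc_self).isOpen_inter_preimage isOpen_Ioo isOpen_compl_singleton
    obtain ⟨r, hr⟩ := Rat.isDenseEmbedding_coe_real.dense.exists_mem_open ho ⟨t, ht, hne⟩
    refine hr.2 ?_
    have := h r hr.1
    rwa [← integral_Ioc_eq_integral_Ioo, ← intervalIntegral.integral_of_le hr.1.1.le] at this
  rw [ae_restrict_iff' measurableSet_Ioo]
  filter_upwards [hq'.ae_hasDerivAt_integral] with t ht htT
  have d := ht (by rw [uIcc_of_le hT.le]; exact Ioo_subset_Icc_self htT) 0 (by simp)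
  have d0 : HasDerivAt (fun t => ∫ s in 0..t, q s) 0 t := by
    refine (hasDerivAt_const t (0 : ℂ)).congr_of_eventuallyEq ?_
    filter_upwards [isOpen_Ioo.mem_nhds htT] with s hs using hz s hs
  exact d.unique d0

/-- Minkowski's integral inequality in `L²`. -/
theorem lintegral_sq_lintegral_le {X Y : Type*} [MeasurableSpace X] [MeasurableSpace Y]
    {μ : Measure X} {ν : Measure Y} [SFinite μ] [SFinite ν] {f : X × Y → ℝ≥0∞}
    (hf : Measurable f) :
    ∫⁻ y, (∫⁻ x, f (x, y) ∂μ) ^ 2 ∂ν ≤ (∫⁻ x, (∫⁻ y, f (x, y) ^ 2 ∂ν) ^ (1 / 2 : ℝ) ∂μ) ^ 2 := by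
  have hm : Measurable fun x => (∫⁻ y, f (x, y) ^ 2 ∂ν) ^ (1 / 2 : ℝ) :=
    ((hf.pow_const 2).lintegral_prod_right').pow_const _
  -- The square is written as a double integral over `(x, x')`, so that after Tonelli the
  -- Cauchy–Schwarz inequality in `y` separates the two variables.
  calc ∫⁻ y, (∫⁻ x, f (x, y) ∂μ) ^ 2 ∂ν
      = ∫⁻ y, ∫⁻ x, ∫⁻ x', f (x, y) * f (x', y) ∂μ ∂μ ∂ν := by
        refine lintegral_congr fun y => ?_
        have h1 : Measurable fun x => f (x, y) := hf.comp (by fun_prop)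
        rw [sq, ← lintegral_mul_const _ h1]
        refine lintegral_congr fun x => ?_
        rw [lintegral_const_mul _ h1]
    _ = ∫⁻ x, ∫⁻ x', ∫⁻ y, f (x, y) * f (x', y) ∂ν ∂μ ∂μ := by
        rw [lintegral_lintegral_swap]
        · refine lintegral_congr fun x => ?_
          rw [lintegral_lintegral_swap]
          exact ((hf.comp (by fun_prop)).mul (hf.comp (by fun_prop))).aemeasurable
        · refine Measurable.aemeasurable ?_
          refine Measurable.lintegral_prod_right' (f := fun p : (Y × X) × X =>
            f (p.1.2, p.1.1) * f (p.2, p.1.1)) ?_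
          exact (hf.comp (by fun_prop)).mul (hf.comp (by fun_prop))
    _ ≤ ∫⁻ x, ∫⁻ x', (∫⁻ y, f (x, y) ^ 2 ∂ν) ^ (1 / 2 : ℝ)
          * (∫⁻ y, f (x', y) ^ 2 ∂ν) ^ (1 / 2 : ℝ) ∂μ ∂μ := by
        refine lintegral_mono fun x => lintegral_mono fun x' => ?_
        have h2 : ∀ x, AEMeasurable (fun y => f (x, y)) ν := fun x =>
          (hf.comp (by fun_prop)).aemeasurable
        have := ENNReal.lintegral_mul_le_Lp_mul_Lq ν Real.HolderConjugate.two_two (h2 x) (h2 x')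
        simpa using this
    _ = _ := by
        rw [sq, ← lintegral_mul_const _ hm]
        refine lintegral_congr fun x => ?_
        rw [lintegral_const_mul _ hm]

end NFPE
end

/-! ### Plancherel's theorem for integrable functions in `L²` -/

noncomputable section

namespace NFPE

open FourierTransform SchwartzMap LineDeriv Laplacian

section Plancherel

variable {E : Type*} [NormedAddCommGroup E] [InnerProductSpace ℝ E] [FiniteDimensional ℝ E]
  [MeasurableSpace E] [BorelSpace E]

/-- By Fubini, since the Fourier kernel is symmetric. This formula moves every transform below from
a test function onto the solution. -/
theorem integral_mul_fourier_schwartz {f : E → ℂ} (hf : Integrable f) (η : 𝓢(E, ℂ)) :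
    ∫ x, f x * 𝓕 η x = ∫ ξ, 𝓕 f ξ * η ξ := by
  have := VectorFourier.integral_fourierIntegral_smul_eq_flip (L := innerₗ E)
    (μ := volume) (ν := volume) (f := f) (g := η) Real.continuous_fourierChar
    (by exact continuous_inner) hf η.integrable
  simp only [smul_eq_mul, flip_innerₗ] at this
  exact this.symm

/-- On `L¹ ∩ L²` the Fourier integral represents the `L²` Fourier transform. -/
theorem fourier_ae_eq_fourier_toLp {f : E → ℂ} (h1 : Integrable f) (h2 : MemLp f 2) :
    𝓕 f =ᵐ[volume] (𝓕 (h2.toLp f) : Lp ℂ 2 (volume : Measure E)) := by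
  have hc : Continuous (𝓕 f) := VectorFourier.fourierIntegral_continuous Real.continuous_fourierChar
    (by exact continuous_inner) h1
  -- Both sides are locally integrable, so it suffices to compare them as distributions; the `L²`
  -- transform is compatible with the distributional one, and the multiplication formula treats the
  -- integral.
  refine ae_eq_of_integral_contDiff_smul_eq hc.locallyIntegrable
    ((Lp.memLp _).locallyIntegrable (by norm_num)) fun g hg hgc => ?_
  have hgc' : HasCompactSupport (fun x => (g x : ℂ)) := hgc.comp_left (g := fun r : ℝ => (r : ℂ)) (by simp)
  have hg' : ContDiff ℝ ∞ (fun x => (g x : ℂ)) := Complex.ofRealCLM.contDiff.comp hg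
  set G : 𝓢(E, ℂ) := hgc'.toSchwartzMap hg' with hG
  have e1 := integral_mul_fourier_schwartz h1 G
  have e2 := congrArg (fun u => u G) (Lp.fourier_toTemperedDistribution_eq (h2.toLp f))
  simp only [TemperedDistribution.fourier_apply, Lp.toTemperedDistribution_apply] at e2
  have hGx : ∀ x, G x = (g x : ℂ) := fun x => rfl
  simp only [hGx, smul_eq_mul] at e1 e2
  have e3 : ∫ x, 𝓕 G x * h2.toLp f x = ∫ x, f x * 𝓕 G x := by
    refine integral_congr_ae ?_
    filter_upwards [h2.coeFn_toLp] with x hx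
    rw [hx, mul_comm]
  rw [e3, e1] at e2
  simp only [Complex.real_smul]
  rw [← e2]
  exact integral_congr_ae (Eventually.of_forall fun x => mul_comm _ _)

theorem memLp_fourier {f : E → ℂ} (h1 : Integrable f) (h2 : MemLp f 2) : MemLp (𝓕 f) 2 :=
  (memLp_congr_ae (fourier_ae_eq_fourier_toLp h1 h2)).2 (Lp.memLp _)

/-- Plancherel's theorem on `L¹ ∩ L²`. -/
theorem integral_conj_fourier_mul_fourier {f g : E → ℂ} (hf1 : Integrable f) (hf2 : MemLp f 2)
    (hg1 : Integrable g) (hg2 : MemLp g 2) :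
    ∫ ξ, (starRingEnd ℂ) (𝓕 f ξ) * 𝓕 g ξ = ∫ x, (starRingEnd ℂ) (f x) * g x := by
  have := Lp.inner_fourier_eq (hf2.toLp f) (hg2.toLp g)
  simp only [L2.inner_def] at this
  have e1 : ∫ ξ, (starRingEnd ℂ) (𝓕 f ξ) * 𝓕 g ξ = ∫ ξ, inner ℂ ((𝓕 (hf2.toLp f) : Lp ℂ 2 volume) ξ)
      ((𝓕 (hg2.toLp g) : Lp ℂ 2 volume) ξ) := by
    refine integral_congr_ae ?_
    filter_upwards [fourier_ae_eq_fourier_toLp hf1 hf2, fourier_ae_eq_fourier_toLp hg1 hg2]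
      with x h1 h2
    rw [h1, h2, RCLike.inner_apply, mul_comm]
  have e2 : ∫ x, (starRingEnd ℂ) (f x) * g x = ∫ x, inner ℂ (hf2.toLp f x) (hg2.toLp g x) := by
    refine integral_congr_ae ?_
    filter_upwards [hf2.coeFn_toLp, hg2.coeFn_toLp] with x h1 h2
    rw [h1, h2, RCLike.inner_apply, mul_comm]
  rw [e1, e2]
  exact this

theorem integral_norm_sq_fourier_eq {f : E → ℂ} (h1 : Integrable f) (h2 : MemLp f 2) :
    ∫ ξ, ‖𝓕 f ξ‖ ^ 2 = ∫ x, ‖f x‖ ^ 2 := by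
  have h := integral_conj_fourier_mul_fourier h1 h2 h1 h2
  simp only [← Complex.normSq_eq_conj_mul_self, Complex.normSq_eq_norm_sq] at h
  rw [integral_complex_ofReal, integral_complex_ofReal] at h
  exact_mod_cast h

theorem integral_re_conj_fourier_mul_fourier {f g : E → ℝ} (hf1 : Integrable f) (hf2 : MemLp f 2)
    (hg1 : Integrable g) (hg2 : MemLp g 2) :
    ∫ ξ, ((starRingEnd ℂ) (𝓕 (fun x => (f x : ℂ)) ξ) * 𝓕 (fun x => (g x : ℂ)) ξ).re
      = ∫ x, f x * g x := by
  have h := integral_conj_fourier_mul_fourier (hf1.ofReal (𝕜 := ℂ)) hf2.ofReal (hg1.ofReal (𝕜 := ℂ)) hg2.ofReal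
  have hi : Integrable fun ξ => (starRingEnd ℂ) (𝓕 (fun x => (f x : ℂ)) ξ)
      * 𝓕 (fun x => (g x : ℂ)) ξ :=
    (memLp_fourier hf1.ofReal hf2.ofReal).star.integrable_mul (memLp_fourier hg1.ofReal hg2.ofReal)
  have h3 := integral_re hi
  simp only [RCLike.re_to_complex] at h3
  rw [h3]
  have h4 : (∫ ξ, (starRingEnd ℂ) (𝓕 (fun x => (f x : ℂ)) ξ) * 𝓕 (fun x => (g x : ℂ)) ξ)
    = ((∫ x, f x * g x : ℝ) : ℂ) := by
    rw [← integral_complex_ofReal]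
    refine h.trans ?_
    simp
  rw [h4, Complex.ofReal_re]

end Plancherel

/-! ### Derivatives of Fourier transforms as multipliers. -/

section Multipliers

variable {d : ℕ}

/-- The coordinates of a vector field, as complex functions. -/
def coord (F : Space d → Space d) (j : Fin d) (x : Space d) : ℂ := ((F x j : ℝ) : ℂ)

/-- The Fourier transform of `Δ w - div F`. -/
def rhsFourier (w : Space d → ℝ) (F : Space d → Space d) (ξ : Space d) : ℂ :=
  -((4 * Real.pi ^ 2 * ‖ξ‖ ^ 2 : ℝ) : ℂ) * 𝓕 (fun x => (w x : ℂ)) ξ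
    - 2 * Real.pi * Complex.I * ∑ j, ((ξ j : ℝ) : ℂ) * 𝓕 (coord F j) ξ

theorem hasTemperateGrowth_inner_right (m : Space d) :
    (inner ℝ · m : Space d → ℝ).HasTemperateGrowth :=
  ((innerSL ℝ).flip m).hasTemperateGrowth

/-- Differentiation after `𝓕` is multiplication by `-2πi ξⱼ` before it. The product is packaged as a
Schwartz function so that the multiplication formula applies to it again. -/
theorem fderiv_fourier_apply_single (η : 𝓢(Space d, ℂ)) (j : Fin d) :
    ∃ θ : 𝓢(Space d, ℂ), (∀ ξ, θ ξ = -(2 * Real.pi * Complex.I) * (ξ j : ℝ) * η ξ) ∧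
      ∀ x, fderiv ℝ ⇑(𝓕 η : 𝓢(Space d, ℂ)) x (EuclideanSpace.single j 1) = (𝓕 θ : 𝓢(Space d, ℂ)) x := by
  refine ⟨-(2 * Real.pi * Complex.I) • smulLeftCLM ℂ (inner ℝ · (EuclideanSpace.single j 1)) η,
    fun ξ => ?_, fun x => ?_⟩
  · rw [_root_.smul_apply, smulLeftCLM_apply_apply (hasTemperateGrowth_inner_right _)]
    simp [EuclideanSpace.inner_single_right, mul_assoc]
  · rw [← lineDerivOp_fourier_eq]
    rfl

/-- The first-order rule used twice in each direction, with `(-2πi)² = -4π²`. -/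
theorem laplacian_fourier (η : 𝓢(Space d, ℂ)) :
    ∃ θ : 𝓢(Space d, ℂ), (∀ ξ, θ ξ = -((4 * Real.pi ^ 2 * ‖ξ‖ ^ 2 : ℝ) : ℂ) * η ξ) ∧
      ∀ x, (Δ ⇑(𝓕 η : 𝓢(Space d, ℂ))) x = (𝓕 θ : 𝓢(Space d, ℂ)) x := by
  refine ⟨∑ j, (-(2 * Real.pi * Complex.I)) • smulLeftCLM ℂ (inner ℝ · (EuclideanSpace.single j 1))
    ((-(2 * Real.pi * Complex.I)) • smulLeftCLM ℂ (inner ℝ · (EuclideanSpace.single j 1)) η),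
    fun ξ => ?_, fun x => ?_⟩
  · simp only [_root_.sum_apply, _root_.smul_apply,
      smulLeftCLM_apply_apply (hasTemperateGrowth_inner_right _)]
    simp only [EuclideanSpace.inner_single_right, EuclideanSpace.norm_sq_eq, Real.norm_eq_abs,
      sq_abs, Complex.real_smul, smul_eq_mul]
    push_cast
    rw [Finset.mul_sum, ← Finset.sum_neg_distrib, Finset.sum_mul]
    refine Finset.sum_congr rfl fun j _ => ?_
    simp
    ring_nf
    simp
  · rw [← SchwartzMap.laplacian_apply,
      SchwartzMap.laplacian_eq_sum (EuclideanSpace.basisFun (Fin d) ℝ)]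
    congr 1
    rw [FourierTransform.fourier_sum]
    refine Finset.sum_congr rfl fun j _ => ?_
    rw [EuclideanSpace.basisFun_apply, lineDerivOp_fourier_eq, lineDerivOp_fourier_eq]

theorem fderiv_apply_eq_sum {f : Space d → ℂ} (x v : Space d) :
    fderiv ℝ f x v = ∑ j, ((v j : ℝ) : ℂ) * fderiv ℝ f x (EuclideanSpace.single j 1) := by
  conv_lhs => rw [← (EuclideanSpace.basisFun (Fin d) ℝ).sum_repr v]
  simp [map_sum]

/-- Testing `Δ w - div F` against the Fourier transform of a Schwartz function. -/
theorem integral_laplacian_fourier_add_fderiv_fourier {w : Space d → ℝ} {F : Space d → Space d}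
    (hw : Integrable w) (hF : Integrable F) (η : 𝓢(Space d, ℂ)) :
    ∫ x, ((w x : ℂ) * (Δ ⇑(𝓕 η : 𝓢(Space d, ℂ))) x + fderiv ℝ ⇑(𝓕 η : 𝓢(Space d, ℂ)) x (F x))
      = ∫ ξ, rhsFourier w F ξ * η ξ := by
  obtain ⟨θ, hθ, hθ'⟩ := laplacian_fourier η
  choose κ hκ hκ' using fderiv_fourier_apply_single η
  have hFj : ∀ j, Integrable (coord F j) := fun j =>
    ((EuclideanSpace.proj j : Space d →L[ℝ] ℝ).integrable_comp hF).ofReal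
  have hb : ∀ {f : Space d → ℂ} (_ : Integrable f) (κ : 𝓢(Space d, ℂ)),
      Integrable fun x => f x * κ x := fun hf κ =>
    hf.mul_bdd (c := (SchwartzMap.seminorm ℝ 0 0) κ) κ.continuous.aestronglyMeasurable
      (Eventually.of_forall fun x => SchwartzMap.norm_le_seminorm ℝ κ x)
  have hb' : ∀ {f : Space d → ℂ} (_ : Integrable f) (κ : 𝓢(Space d, ℂ)),
      Integrable fun ξ => 𝓕 f ξ * κ ξ := fun {f} hf κ =>
    κ.integrable.bdd_mul (c := ∫ x, ‖f x‖)
      (VectorFourier.fourierIntegral_continuous Real.continuous_fourierChar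
        (by exact continuous_inner) hf).aestronglyMeasurable
      (Eventually.of_forall fun ξ => VectorFourier.norm_fourierIntegral_le_integral_norm _ _ _ _ _)
  have e1 : ∀ x, (w x : ℂ) * (Δ ⇑(𝓕 η : 𝓢(Space d, ℂ))) x + fderiv ℝ ⇑(𝓕 η : 𝓢(Space d, ℂ)) x (F x)
      = (w x : ℂ) * 𝓕 θ x + ∑ j, coord F j x * 𝓕 (κ j) x := fun x => by
    rw [hθ', fderiv_apply_eq_sum]
    simp only [coord, hκ']
  have e2 : ∀ ξ, rhsFourier w F ξ * η ξ
      = 𝓕 (fun x => (w x : ℂ)) ξ * θ ξ + ∑ j, 𝓕 (coord F j) ξ * κ j ξ := fun ξ => by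
    simp only [hθ, hκ, rhsFourier]
    rw [sub_mul, Finset.mul_sum, Finset.sum_mul, sub_eq_add_neg, ← Finset.sum_neg_distrib]
    congr 1
    · ring
    · exact Finset.sum_congr rfl fun j _ => by ring
  simp only [e1, e2]
  have hwC : Integrable fun x => (w x : ℂ) := hw.ofReal
  have i1 : Integrable fun x => ∑ j, coord F j x * (𝓕 (κ j) : 𝓢(Space d, ℂ)) x :=
    integrable_finsetSum _ fun j _ => hb (hFj j) (𝓕 (κ j))
  have i2 : Integrable fun ξ => ∑ j, 𝓕 (coord F j) ξ * κ j ξ :=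
    integrable_finsetSum _ fun j _ => hb' (hFj j) (κ j)
  rw [integral_add (hb hwC (𝓕 θ)) i1, integral_add (hb' hwC θ) i2,
    integral_finsetSum _ fun j _ => hb (hFj j) (𝓕 (κ j)),
    integral_finsetSum _ fun j _ => hb' (hFj j) (κ j)]
  congr 1
  · exact integral_mul_fourier_schwartz hwC θ
  · exact Finset.sum_congr rfl fun j _ => integral_mul_fourier_schwartz (hFj j) (κ j)

end Multipliers

end NFPE
end

/-! ### Linear weak solutions -/

noncomputable section

namespace NFPE

open FourierTransform SchwartzMap LineDeriv Laplacian

variable {d : ℕ}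

/-- Lebesgue measure on `(0, t) × ℝ^d`. -/
abbrev slab (d : ℕ) (t : ℝ) : Measure (ℝ × Space d) :=
  (volume.restrict (Ioo 0 t)).prod volume

theorem two_le_infty : (2 : WithTop ℕ∞) ≤ (∞ : WithTop ℕ∞) := by
  exact WithTop.coe_le_coe.2 (le_top : (2 : ℕ∞) ≤ ⊤)

theorem slab_mono {t T : ℝ} (h : t ≤ T) : slab d t ≤ slab d T :=
  Measure.prod_mono (Measure.restrict_mono (Ioo_subset_Ioo_right h) le_rfl) le_rfl

/-- A weak solution of `∂ₜ z = Δ w - div F` on `(0, T) × ℝ^d` with zero initial value, in the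
integrability class needed for the energy method in `H⁻¹`. -/
structure IsLinearWeakSolution (T : ℝ) (z w : ℝ × Space d → ℝ) (F : ℝ × Space d → Space d) :
    Prop where
  measurable_z : Measurable z
  measurable_w : Measurable w
  measurable_F : Measurable F
  integrable_z : Integrable z (slab d T)
  integrable_w : Integrable w (slab d T)
  memLp_z : MemLp z 2 (slab d T)
  memLp_w : MemLp w 2 (slab d T)
  integrable_F : ∀ᵐ t ∂(volume.restrict (Ioo 0 T)), Integrable fun x => F (t, x)
  lintegral_F : ∫⁻ t in Ioo 0 T, (∫⁻ x, ‖F (t, x)‖ₑ ^ 2) ^ (1 / 2 : ℝ) < ⊤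
  weak : ∀ ψ : Space d → ℝ, IsTestFunction ψ → ∀ᵐ t ∂(volume.restrict (Ioo 0 T)),
    ∫ x, z (t, x) * ψ x = ∫ q, (w q * Δ ψ q.2 + fderiv ℝ ψ q.2 (F q)) ∂(slab d t)

/-- Dilates `f(x/(n+1))` of one bump function: the dilation factor is at most one, so derivatives do
not grow. Being equal to one on a neighbourhood of each point, eventually in `n`, makes the
derivatives of `χₙψ` converge pointwise as well. -/
theorem exists_cutoff (d : ℕ) : ∃ (χ : ℕ → Space d → ℝ) (C : ℝ), (∀ n, IsTestFunction (χ n)) ∧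
    (∀ x, ∀ᶠ n in atTop, ∀ᶠ y in 𝓝 x, χ n y = 1) ∧
    ∀ n, ∀ k ≤ 2, ∀ x, ‖iteratedFDeriv ℝ k (χ n) x‖ ≤ C := by
  let f : ContDiffBump (0 : Space d) := ⟨1, 2, one_pos, one_lt_two⟩
  have hf : ContDiff ℝ ∞ f := f.contDiff
  have hb : ∀ k : ℕ, ∃ C, ∀ x, ‖iteratedFDeriv ℝ k f x‖ ≤ C := fun k =>
    (f.hasCompactSupport.iteratedFDeriv k).exists_bound_of_continuous
      (hf.continuous_iteratedFDeriv (mod_cast le_top))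
  choose B hB using hb
  have hB0 : ∀ k, 0 ≤ B k := fun k => (norm_nonneg _).trans (hB k 0)
  have ha : ∀ n : ℕ, 0 < ((n : ℝ) + 1)⁻¹ := fun n => by positivity
  refine ⟨fun n x => f (((n : ℝ) + 1)⁻¹ • x), B 0 + B 1 + B 2, fun n => ⟨?_, ?_⟩, fun x => ?_,
    fun n k hk x => ?_⟩
  · exact hf.comp (contDiff_const_smul _)
  · exact f.hasCompactSupport.comp_smul (ha n).ne'
  · filter_upwards [eventually_gt_atTop ⌈‖x‖⌉₊] with n hn
    have hx : ‖x‖ < n := (Nat.le_ceil _).trans_lt (by exact_mod_cast hn)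
    filter_upwards [(continuous_norm.tendsto x).eventually (gt_mem_nhds hx)] with y hy
    refine f.one_of_mem_closedBall ?_
    rw [mem_closedBall_zero_iff, norm_smul, norm_inv, Real.norm_of_nonneg (by positivity),
      inv_mul_le_iff₀ (by positivity)]
    change ‖y‖ ≤ ((n : ℝ) + 1) * 1
    linarith
  · rw [iteratedFDeriv_comp_const_smul _ (hf.of_le (mod_cast le_top)), norm_smul, norm_pow]
    have h1 : ‖((n : ℝ) + 1)⁻¹‖ ^ k ≤ 1 := by
      refine pow_le_one₀ (norm_nonneg _) ?_
      rw [Real.norm_of_nonneg (ha n).le]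
      exact inv_le_one_of_one_le₀ (by linarith [n.cast_nonneg (α := ℝ)])
    calc _ ≤ 1 * B k := mul_le_mul h1 (hB k _) (norm_nonneg _) zero_le_one
      _ ≤ _ := by
        have := hB0 0; have := hB0 1; have := hB0 2
        interval_cases k <;> linarith

theorem norm_laplacian_le {V : Type*} [NormedAddCommGroup V] [NormedSpace ℝ V] (f : Space d → V)
    (x : Space d) : ‖Δ f x‖ ≤ d * ‖iteratedFDeriv ℝ 2 f x‖ := by
  rw [InnerProductSpace.laplacian_eq_iteratedFDeriv_orthonormalBasis f
    (EuclideanSpace.basisFun (Fin d) ℝ)]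
  refine (norm_sum_le _ _).trans ?_
  calc _ ≤ ∑ _i : Fin d, ‖iteratedFDeriv ℝ 2 f x‖ := by
        refine Finset.sum_le_sum fun i _ => ?_
        refine (ContinuousMultilinearMap.le_opNorm _ _).trans ?_
        simp [Fin.prod_univ_two]
    _ = _ := by simp

/-- Cauchy–Schwarz in space leaves `‖F(t)‖₂ ‖Φ‖₂`, for which integrability in time is enough. Thus
`F ∈ L¹(0,T; L²)` can be tested against any spatial `L²` function. -/
theorem integrable_norm_mul_of_lintegral_sq {T : ℝ} {F : ℝ × Space d → Space d}
    (hF : AEStronglyMeasurable F (slab d T))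
    (hFL : ∫⁻ t in Ioo 0 T, (∫⁻ x, ‖F (t, x)‖ₑ ^ 2) ^ (1 / 2 : ℝ) < ⊤) {Φ : Space d → ℝ}
    (hΦ : MemLp Φ 2) : Integrable (fun q => ‖F q‖ * Φ q.2) (slab d T) := by
  have hm : AEStronglyMeasurable (fun q => ‖F q‖ * Φ q.2) (slab d T) := hF.norm.mul hΦ.1.comp_snd
  refine ⟨hm, ?_⟩
  rw [hasFiniteIntegral_iff_enorm, lintegral_prod _ hm.enorm]
  have hΦ2 : (∫⁻ x, ‖Φ x‖ₑ ^ 2) ^ (1 / 2 : ℝ) < ⊤ := by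
    have := hΦ.2
    rw [eLpNorm_eq_lintegral_rpow_enorm_toReal (by norm_num) (by norm_num)] at this
    simpa using this
  calc ∫⁻ t in Ioo 0 T, ∫⁻ x, ‖‖F (t, x)‖ * Φ x‖ₑ
      ≤ ∫⁻ t in Ioo 0 T, (∫⁻ x, ‖F (t, x)‖ₑ ^ 2) ^ (1 / 2 : ℝ) * (∫⁻ x, ‖Φ x‖ₑ ^ 2) ^ (1 / 2 : ℝ) := by
        refine lintegral_mono_ae ?_
        filter_upwards [hF.prodMk_left] with t ht
        have := ENNReal.lintegral_mul_le_Lp_mul_Lq (volume : Measure (Space d))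
          Real.HolderConjugate.two_two ht.enorm hΦ.1.enorm
        simpa [enorm_mul] using this
    _ < ⊤ := by
        rw [lintegral_mul_const' _ _ hΦ2.ne]
        exact ENNReal.mul_lt_top hFL hΦ2

namespace IsLinearWeakSolution

variable {T : ℝ} {z w : ℝ × Space d → ℝ} {F : ℝ × Space d → Space d}

theorem integrable_norm_F_mul (h : IsLinearWeakSolution T z w F) {Φ : Space d → ℝ}
    (hΦ : MemLp Φ 2) : Integrable (fun q => ‖F q‖ * Φ q.2) (slab d T) :=
  integrable_norm_mul_of_lintegral_sq h.measurable_F.aestronglyMeasurable h.lintegral_F hΦ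

theorem integrable_integrand (h : IsLinearWeakSolution T z w F) {V : Type*} [NormedAddCommGroup V]
    [NormedSpace ℝ V] {a : Space d → V} {L : Space d → Space d →L[ℝ] V}
    (ha : Continuous a) (hL : Continuous L) {C : ℝ} (haC : ∀ x, ‖a x‖ ≤ C) {Φ : Space d → ℝ}
    (hΦ : MemLp Φ 2) (hLΦ : ∀ x, ‖L x‖ ≤ Φ x) :
    Integrable (fun q => w q • a q.2 + L q.2 (F q)) (slab d T) := by
  refine Integrable.add ?_ ?_
  · exact h.integrable_w.smul_bdd C (ha.comp continuous_snd).aestronglyMeasurable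
      (Eventually.of_forall fun q => haC _)
  · refine (h.integrable_norm_F_mul hΦ).mono ?_ (Eventually.of_forall fun q => ?_)
    · have : Continuous fun p : (Space d →L[ℝ] V) × Space d => p.1 p.2 := by fun_prop
      exact this.comp_aestronglyMeasurable
        ((hL.comp continuous_snd).aestronglyMeasurable.prodMk
          h.measurable_F.aestronglyMeasurable)
    · have h0 : 0 ≤ Φ q.2 := (norm_nonneg _).trans (hLΦ _)
      rw [norm_mul, norm_norm, Real.norm_of_nonneg h0, mul_comm]
      exact (ContinuousLinearMap.le_opNorm _ _).trans
        (mul_le_mul_of_nonneg_right (hLΦ _) (norm_nonneg _))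

theorem continuous_laplacian {V : Type*} [NormedAddCommGroup V] [NormedSpace ℝ V] {φ : Space d → V}
    (hφ : ContDiff ℝ ∞ φ) : Continuous (Δ φ) := by
  rw [InnerProductSpace.laplacian_eq_iteratedFDeriv_orthonormalBasis φ
    (EuclideanSpace.basisFun (Fin d) ℝ)]
  have hc := hφ.continuous_iteratedFDeriv (m := 2) two_le_infty
  refine continuous_finsetSum _ fun i _ => ?_
  exact (ContinuousMultilinearMap.apply ℝ (fun _ : Fin 2 => Space d) V
    ![EuclideanSpace.basisFun (Fin d) ℝ i, EuclideanSpace.basisFun (Fin d) ℝ i]).continuous.comp hc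

/-- The real and imaginary parts of `φ` are admissible test functions. Complex ones are needed
because test functions will be Fourier transforms. -/
theorem weak_complex (h : IsLinearWeakSolution T z w F) {φ : Space d → ℂ} (hφ : ContDiff ℝ ∞ φ)
    (hc : HasCompactSupport φ) : ∀ᵐ t ∂(volume.restrict (Ioo 0 T)),
    ∫ x, z (t, x) • φ x = ∫ q, (w q • Δ φ q.2 + fderiv ℝ φ q.2 (F q)) ∂(slab d t) := by
  have hre : IsTestFunction fun x => (φ x).re :=
    ⟨Complex.reCLM.contDiff.comp hφ, hc.comp_left (g := Complex.re) (by simp)⟩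
  have him : IsTestFunction fun x => (φ x).im :=
    ⟨Complex.imCLM.contDiff.comp hφ, hc.comp_left (g := Complex.im) (by simp)⟩
  have hd : Differentiable ℝ φ := hφ.differentiable (by simp)
  have hdc : Continuous (fderiv ℝ φ) := hφ.continuous_fderiv (by simp)
  obtain ⟨C, hC⟩ := hc.exists_bound_of_continuous hφ.continuous
  obtain ⟨C2, hC2⟩ := (hc.iteratedFDeriv 2).exists_bound_of_continuous
    (hφ.continuous_iteratedFDeriv (m := 2) two_le_infty)
  have hi := h.integrable_integrand (a := Δ φ) (L := fderiv ℝ φ) (C := d * C2)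
    (continuous_laplacian hφ) hdc (fun x => (norm_laplacian_le φ x).trans (by gcongr; exact hC2 x))
    (Φ := fun x => ‖fderiv ℝ φ x‖)
    ((hdc.memLp_of_hasCompactSupport (hc.fderiv ℝ)).norm) (fun x => le_rfl)
  filter_upwards [h.weak _ hre, h.weak _ him, h.integrable_z.prod_right_ae,
    ae_restrict_mem measurableSet_Ioo] with t h1 h2 hz ht
  have hit := hi.mono_measure (slab_mono ht.2.le)
  have hzφ : Integrable fun x => z (t, x) • φ x :=
    hz.smul_bdd C hφ.continuous.aestronglyMeasurable (Eventually.of_forall hC)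
  have lr : ∀ x, Δ (fun x => (φ x).re) x = (Δ φ x).re := fun x =>
    (hφ.contDiffAt.of_le two_le_infty).laplacian_CLM_comp_left (l := Complex.reCLM)
  have li : ∀ x, Δ (fun x => (φ x).im) x = (Δ φ x).im := fun x =>
    (hφ.contDiffAt.of_le two_le_infty).laplacian_CLM_comp_left (l := Complex.imCLM)
  have fr : ∀ x v, fderiv ℝ (fun x => (φ x).re) x v = (fderiv ℝ φ x v).re := fun x v => by
    have := (Complex.reCLM.hasFDerivAt.comp x (hd x).hasFDerivAt).fderiv
    exact congrArg (fun l => l v) this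
  have fi : ∀ x v, fderiv ℝ (fun x => (φ x).im) x v = (fderiv ℝ φ x v).im := fun x v => by
    have := (Complex.imCLM.hasFDerivAt.comp x (hd x).hasFDerivAt).fderiv
    exact congrArg (fun l => l v) this
  refine Complex.ext ?_ ?_
  · have e1 := Complex.reCLM.integral_comp_comm hzφ
    have e2 := Complex.reCLM.integral_comp_comm hit
    simp only [Complex.reCLM_apply, Complex.add_re, Complex.smul_re, smul_eq_mul] at e1 e2
    rw [← e1, ← e2, h1]
    simp only [lr, fr]
  · have e1 := Complex.imCLM.integral_comp_comm hzφ
    have e2 := Complex.imCLM.integral_comp_comm hit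
    simp only [Complex.imCLM_apply, Complex.add_im, Complex.smul_im, smul_eq_mul] at e1 e2
    rw [← e1, ← e2, h2]
    simp only [li, fi]

/-- The Fourier transform of a compactly supported function is Schwartz but in general not compactly
supported. The cutoffs `χₙψ` are admissible and dominated convergence removes them: `z` and `w` are
integrable and meet uniformly bounded factors, while `F` meets gradients bounded by a fixed `L²`
function. -/
theorem weak_schwartz (h : IsLinearWeakSolution T z w F) (ψ : 𝓢(Space d, ℂ)) :
    ∀ᵐ t ∂(volume.restrict (Ioo 0 T)),
    ∫ x, z (t, x) • ψ x = ∫ q, (w q • (Δ ⇑ψ) q.2 + fderiv ℝ ψ q.2 (F q)) ∂(slab d t) := by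
  obtain ⟨χ, C, hχ, hχ1, hχC⟩ := exists_cutoff d
  have hψ : ContDiff ℝ ∞ ψ := ψ.smooth ⊤
  have hs : ∀ n, ContDiff ℝ ∞ fun x => χ n x • ψ x := fun n => (hχ n).1.smul hψ
  have hcs : ∀ n, HasCompactSupport fun x => χ n x • ψ x := fun n => (hχ n).2.smul_right
  have hC0 : 0 ≤ C := (norm_nonneg _).trans (hχC 0 0 (by norm_num) 0)
  have hbd : ∀ k : ℕ, ∀ x, ‖iteratedFDeriv ℝ k ψ x‖ ≤ SchwartzMap.seminorm ℝ 0 k ψ := fun k x => by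
    simpa using SchwartzMap.le_seminorm ℝ 0 k ψ x
  set M : ℝ := SchwartzMap.seminorm ℝ 0 0 ψ + SchwartzMap.seminorm ℝ 0 1 ψ
    + SchwartzMap.seminorm ℝ 0 2 ψ with hM
  have hs0 : ∀ k, 0 ≤ SchwartzMap.seminorm ℝ 0 k ψ := fun k => apply_nonneg _ _
  have hb0 : ∀ n x, ‖χ n x • ψ x‖ ≤ C * SchwartzMap.seminorm ℝ 0 0 ψ := fun n x => by
    rw [norm_smul]
    have h1 := hχC n 0 (by norm_num) x
    have h2 := hbd 0 x
    rw [norm_iteratedFDeriv_zero] at h1 h2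
    gcongr
  have hb1 : ∀ n x, ‖fderiv ℝ (fun x => χ n x • ψ x) x‖ ≤ C * (‖ψ x‖ + ‖fderiv ℝ ψ x‖) := fun n x => by
    have := norm_iteratedFDeriv_smul_le (hχ n).1 hψ x (n := 1) (mod_cast le_top)
    rw [norm_iteratedFDeriv_one] at this
    refine this.trans ?_
    rw [Finset.sum_range_succ, Finset.sum_range_one]
    simp only [Nat.choose_zero_right, Nat.choose_self, Nat.cast_one, one_mul, Nat.sub_zero]
    have h1 := hχC n 0 (by norm_num) x
    have h2 := hχC n 1 (by norm_num) x
    rw [norm_iteratedFDeriv_one (f := ψ), norm_iteratedFDeriv_zero (f := ψ)]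
    nlinarith [norm_nonneg (ψ x), norm_nonneg (fderiv ℝ ψ x), mul_le_mul_of_nonneg_right h1
      (norm_nonneg (fderiv ℝ ψ x)), mul_le_mul_of_nonneg_right h2 (norm_nonneg (ψ x))]
  have hb2 : ∀ n x, ‖Δ (fun x => χ n x • ψ x) x‖ ≤ d * (4 * C * M) := fun n x => by
    refine (norm_laplacian_le _ x).trans ?_
    gcongr
    refine (norm_iteratedFDeriv_smul_le (hχ n).1 hψ x (n := 2) two_le_infty).trans ?_
    have h0 : ∀ k ≤ 2, ∀ l ≤ 2, ‖iteratedFDeriv ℝ k (χ n) x‖ * ‖iteratedFDeriv ℝ l ψ x‖ ≤ C * M := by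
      intro k hk l hl
      refine mul_le_mul (hχC n k hk x) ((hbd l x).trans ?_) (norm_nonneg _) hC0
      have := hs0 0; have := hs0 1; have := hs0 2
      interval_cases l <;> simp only [hM] <;> linarith
    rw [Finset.sum_range_succ, Finset.sum_range_succ, Finset.sum_range_one]
    simp only [Nat.choose_zero_right, Nat.choose_self, Nat.cast_one, one_mul,
      Nat.choose_one_right, mul_assoc]
    have := h0 0 (by norm_num) 2 le_rfl
    have := h0 1 (by norm_num) 1 (by norm_num)
    have := h0 2 (by norm_num) 0 (by norm_num)
    simp only [Nat.sub_zero, Nat.add_one_sub_one]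
    push_cast
    linarith
  have hev : ∀ x, ∀ᶠ n in atTop, (fun x => χ n x • ψ x) =ᶠ[𝓝 x] ψ := fun x => by
    filter_upwards [hχ1 x] with n hn
    filter_upwards [hn] with y hy
    rw [hy, one_smul]
  -- The bound on the gradients of `χₙψ` must be square integrable, not merely bounded, because `F`
  -- is controlled in `L²` in space.
  have hΦ : MemLp (fun x => C * (‖ψ x‖ + ‖fderiv ℝ ψ x‖)) 2 :=
    ((ψ.memLp 2).norm.add ((fderivCLM ℝ (Space d) ℂ ψ).memLp 2).norm).const_mul C
  have hdom := h.integrable_norm_F_mul hΦ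
  filter_upwards [ae_all_iff.2 fun n => h.weak_complex (hs n) (hcs n), h.integrable_z.prod_right_ae,
    ae_restrict_mem measurableSet_Ioo] with t h1 hz ht
  have hle := slab_mono (d := d) ht.2.le
  refine tendsto_nhds_unique (f := fun n => ∫ x, z (t, x) • (χ n x • ψ x)) (l := atTop) ?_ ?_
  · refine tendsto_integral_of_dominated_convergence
      (fun x => ‖z (t, x)‖ * (C * SchwartzMap.seminorm ℝ 0 0 ψ)) (fun n => ?_) (hz.norm.mul_const _)
      (fun n => Eventually.of_forall fun x => ?_) (Eventually.of_forall fun x => ?_)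
    · exact hz.aestronglyMeasurable.smul (hs n).continuous.aestronglyMeasurable
    · rw [norm_smul]
      gcongr
      exact hb0 n x
    · refine tendsto_const_nhds.congr' ?_
      filter_upwards [hev x] with n hn
      rw [hn.eq_of_nhds]
  · simp only [h1]
    refine tendsto_integral_of_dominated_convergence
      (fun q => ‖w q‖ * (d * (4 * C * M)) + ‖F q‖ * (C * (‖ψ q.2‖ + ‖fderiv ℝ ψ q.2‖)))
      (fun n => ?_) ?_
      (fun n => Eventually.of_forall fun q => ?_) (Eventually.of_forall fun q => ?_)
    · exact ((h.integrable_integrand (continuous_laplacian (hs n))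
        ((hs n).continuous_fderiv (by simp)) (hb2 n) hΦ (hb1 n)).mono_measure hle).aestronglyMeasurable
    · exact ((h.integrable_w.norm.mul_const _).add hdom).mono_measure hle
    · refine (norm_add_le _ _).trans ?_
      rw [norm_smul]
      gcongr
      · exact hb2 n q.2
      · refine (ContinuousLinearMap.le_opNorm _ _).trans ?_
        rw [mul_comm]
        gcongr
        exact hb1 n q.2
    · refine tendsto_const_nhds.congr' ?_
      filter_upwards [hev q.2] with n hn
      rw [hn.fderiv_eq, (InnerProductSpace.laplacian_congr_nhds hn).eq_of_nhds]

end IsLinearWeakSolution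

end NFPE
end

/-! ### Fourier transform in space -/

noncomputable section

namespace NFPE

open FourierTransform SchwartzMap LineDeriv Laplacian

variable {d : ℕ}

/-- The spatial Fourier transform of a function of time and space. -/
def sliceFourier (g : ℝ × Space d → ℂ) (q : ℝ × Space d) : ℂ := 𝓕 (fun x => g (q.1, x)) q.2

theorem measurable_sliceFourier {g : ℝ × Space d → ℂ} (hg : Measurable g) :
    Measurable (sliceFourier g) := by
  have : sliceFourier g = fun q => ∫ x, (Real.fourierChar (-inner ℝ x q.2)) • g (q.1, x) := by
    ext q
    exact Real.fourier_eq _ _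
  rw [this]
  refine StronglyMeasurable.measurable (StronglyMeasurable.integral_prod_right'
    (f := fun p : (ℝ × Space d) × Space d =>
      (Real.fourierChar (-inner ℝ p.2 p.1.2)) • g (p.1.1, p.2)) ?_)
  refine Measurable.stronglyMeasurable ?_
  have h1 : Measurable fun p : (ℝ × Space d) × Space d =>
      ((Real.fourierChar (-inner ℝ p.2 p.1.2) : Circle) : ℂ) := by
    refine Continuous.measurable ?_
    exact continuous_subtype_val.comp (Real.continuous_fourierChar.comp (by fun_prop))
  exact h1.mul (hg.comp (by fun_prop))

theorem norm_sliceFourier_le (g : ℝ × Space d → ℂ) (q : ℝ × Space d) :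
    ‖sliceFourier g q‖ ≤ ∫ x, ‖g (q.1, x)‖ :=
  VectorFourier.norm_fourierIntegral_le_integral_norm _ _ _ _ _

theorem lintegral_enorm_sq_eq {X V : Type*} [MeasurableSpace X] {μ : Measure X}
    [NormedAddCommGroup V] (f : X → V) : ∫⁻ x, ‖f x‖ₑ ^ 2 ∂μ = eLpNorm f 2 μ ^ 2 := by
  rw [eLpNorm_eq_lintegral_rpow_enorm_toReal (by norm_num) (by norm_num)]
  simp only [ENNReal.toReal_ofNat, ENNReal.rpow_ofNat]
  rw [← ENNReal.rpow_natCast, ← ENNReal.rpow_mul]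
  norm_num

theorem memLp_two_of_lintegral_lt_top {X V : Type*} [MeasurableSpace X] {μ : Measure X}
    [NormedAddCommGroup V] {f : X → V} (hf : AEStronglyMeasurable f μ)
    (h : ∫⁻ x, ‖f x‖ₑ ^ 2 ∂μ < ⊤) : MemLp f 2 μ := by
  refine ⟨hf, ?_⟩
  rw [lintegral_enorm_sq_eq] at h
  by_contra hne
  rw [not_lt_top_iff] at hne
  rw [hne] at h
  simp at h

theorem lintegral_enorm_sq_fourier_eq {f : Space d → ℂ} (h1 : Integrable f) (h2 : MemLp f 2) :
    ∫⁻ ξ, ‖𝓕 f ξ‖ₑ ^ 2 = ∫⁻ x, ‖f x‖ₑ ^ 2 := by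
  rw [lintegral_enorm_sq_eq, lintegral_enorm_sq_eq,
    eLpNorm_congr_ae (fourier_ae_eq_fourier_toLp h1 h2), ← eLpNorm_congr_ae h2.coeFn_toLp,
    ← Lp.enorm_def, ← Lp.enorm_def, ← ofReal_norm, ← ofReal_norm, Lp.norm_fourier_eq]

theorem norm_sum_mul_fourier_le (F : Space d → Space d) (ξ : Space d) :
    ‖∑ j, ((ξ j : ℝ) : ℂ) * 𝓕 (coord F j) ξ‖ ≤ ‖ξ‖ * √(∑ j, ‖𝓕 (coord F j) ξ‖ ^ 2) := by
  refine (norm_sum_le _ _).trans ?_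
  simp only [norm_mul, Complex.norm_real]
  rw [EuclideanSpace.norm_eq]
  exact Real.sum_mul_le_sqrt_mul_sqrt _ _ _

/-- On a ball of frequencies the symbols `4π²|ξ|²` and `2πξ` are bounded, so the right-hand side is
controlled there by `ŵ` and `F̂` alone. -/
theorem norm_sq_rhsFourier_le (w : Space d → ℝ) (F : Space d → Space d) {R : ℝ} {ξ : Space d}
    (hξ : ‖ξ‖ ≤ R) : ‖rhsFourier w F ξ‖ ^ 2 ≤ 2 * (4 * Real.pi ^ 2 * R ^ 2) ^ 2 *
      ‖𝓕 (fun x => (w x : ℂ)) ξ‖ ^ 2 + 2 * (2 * Real.pi * R) ^ 2 * ∑ j, ‖𝓕 (coord F j) ξ‖ ^ 2 := by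
  have hR : 0 ≤ R := (norm_nonneg _).trans hξ
  have hpi := Real.pi_pos
  set S := ∑ j, ‖𝓕 (coord F j) ξ‖ ^ 2 with hS
  have hS0 : 0 ≤ S := Finset.sum_nonneg fun _ _ => sq_nonneg _
  have h1 : ‖rhsFourier w F ξ‖ ≤ (4 * Real.pi ^ 2 * R ^ 2) * ‖𝓕 (fun x => (w x : ℂ)) ξ‖
      + (2 * Real.pi * R) * √S := by
    unfold rhsFourier
    refine (norm_sub_le _ _).trans (add_le_add ?_ ?_)
    · rw [norm_mul, norm_neg, Complex.norm_real, Real.norm_of_nonneg (by positivity)]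
      gcongr
    · rw [norm_mul]
      have : ‖(2 * Real.pi * Complex.I : ℂ)‖ = 2 * Real.pi := by
        simp [abs_of_pos hpi]
      rw [this, mul_assoc _ R]
      exact mul_le_mul_of_nonneg_left ((norm_sum_mul_fourier_le F ξ).trans (by gcongr))
        (by positivity)
  calc ‖rhsFourier w F ξ‖ ^ 2 ≤ ((4 * Real.pi ^ 2 * R ^ 2) * ‖𝓕 (fun x => (w x : ℂ)) ξ‖
      + (2 * Real.pi * R) * √S) ^ 2 := by gcongr
    _ ≤ 2 * (((4 * Real.pi ^ 2 * R ^ 2) * ‖𝓕 (fun x => (w x : ℂ)) ξ‖) ^ 2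
      + ((2 * Real.pi * R) * √S) ^ 2) := add_sq_le
    _ = _ := by rw [mul_pow _ ‖𝓕 (fun x => (w x : ℂ)) ξ‖, mul_pow _ √S, Real.sq_sqrt hS0]; ring

theorem sum_enorm_sq_coord (F : Space d → Space d) (x : Space d) :
    ∑ j, ‖coord F j x‖ₑ ^ 2 = ‖F x‖ₑ ^ 2 := by
  have h1 : ∀ j, ‖coord F j x‖ₑ ^ 2 = ENNReal.ofReal ((F x j) ^ 2) := fun j => by
    rw [← ofReal_norm, ← ENNReal.ofReal_pow (norm_nonneg _)]
    simp [coord]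
  simp only [h1]
  rw [← ENNReal.ofReal_sum_of_nonneg fun _ _ => sq_nonneg _, ← ofReal_norm,
    ← ENNReal.ofReal_pow (norm_nonneg _), EuclideanSpace.norm_sq_eq]
  simp

theorem integrable_coord {F : Space d → Space d} (hF : Integrable F) (j : Fin d) :
    Integrable (coord F j) :=
  ((EuclideanSpace.proj j : Space d →L[ℝ] ℝ).integrable_comp hF).ofReal

theorem memLp_coord {F : Space d → Space d} (hF : MemLp F 2) (j : Fin d) :
    MemLp (coord F j) 2 :=
  ((EuclideanSpace.proj j : Space d →L[ℝ] ℝ).comp_memLp' hF).ofReal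

theorem measurable_fourier_slice_coord {F : ℝ × Space d → Space d} (hF : Measurable F) (j : Fin d) :
    Measurable fun q : ℝ × Space d => 𝓕 (coord (fun x => F (q.1, x)) j) q.2 := by
  refine measurable_sliceFourier (g := fun q => ((F q j : ℝ) : ℂ)) ?_
  exact Complex.measurable_ofReal.comp
    ((EuclideanSpace.proj j : Space d →L[ℝ] ℝ).continuous.measurable.comp hF)

/-- The right-hand side of the equation on the Fourier side. -/
def rhsSlice (w : ℝ × Space d → ℝ) (F : ℝ × Space d → Space d) (q : ℝ × Space d) : ℂ :=
  rhsFourier (fun x => w (q.1, x)) (fun x => F (q.1, x)) q.2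

/-- The Fourier transform of a real function of time and space. -/
def hat (z : ℝ × Space d → ℝ) : ℝ × Space d → ℂ := sliceFourier fun q => (z q : ℂ)

theorem measurable_hat {z : ℝ × Space d → ℝ} (hz : Measurable z) : Measurable (hat z) :=
  measurable_sliceFourier (Complex.measurable_ofReal.comp hz)

theorem measurable_rhsSlice {w : ℝ × Space d → ℝ} {F : ℝ × Space d → Space d} (hw : Measurable w)
    (hF : Measurable F) : Measurable (rhsSlice w F) := by
  have h1 := measurable_hat hw
  have h2 := fun j => measurable_fourier_slice_coord hF j
  unfold rhsSlice rhsFourier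
  refine Measurable.sub (Measurable.mul ?_ h1) (Measurable.mul (by fun_prop) ?_)
  · refine (Complex.measurable_ofReal.comp ?_).neg
    fun_prop
  · refine Finset.measurable_sum _ fun j _ => Measurable.mul ?_ (h2 j)
    exact Complex.measurable_ofReal.comp
      ((EuclideanSpace.proj j : Space d →L[ℝ] ℝ).continuous.measurable.comp measurable_snd)

namespace IsLinearWeakSolution

variable {T : ℝ} {z w : ℝ × Space d → ℝ} {F : ℝ × Space d → Space d}

theorem ae_memLp_slice {f : ℝ × Space d → ℝ} (hf : Measurable f) (h : MemLp f 2 (slab d T)) :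
    ∀ᵐ t ∂(volume.restrict (Ioo 0 T)), MemLp (fun x => f (t, x)) 2 := by
  have h1 : ∫⁻ q, ‖f q‖ₑ ^ 2 ∂(slab d T) < ⊤ := by
    rw [lintegral_enorm_sq_eq]
    exact ENNReal.pow_lt_top h.2
  rw [lintegral_prod _ (hf.enorm.pow_const 2).aemeasurable] at h1
  filter_upwards [ae_lt_top (hf.enorm.pow_const 2).lintegral_prod_right' h1.ne] with t ht
  exact memLp_two_of_lintegral_lt_top (hf.comp (by fun_prop)).aestronglyMeasurable ht

theorem ae_memLp_F (h : IsLinearWeakSolution T z w F) :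
    ∀ᵐ t ∂(volume.restrict (Ioo 0 T)), MemLp (fun x => F (t, x)) 2 := by
  have hm : Measurable fun t => (∫⁻ x, ‖F (t, x)‖ₑ ^ 2) ^ (1 / 2 : ℝ) :=
    ((h.measurable_F.enorm.pow_const 2).lintegral_prod_right').pow_const _
  filter_upwards [ae_lt_top hm h.lintegral_F.ne] with t ht
  refine memLp_two_of_lintegral_lt_top (h.measurable_F.comp (by fun_prop)).aestronglyMeasurable ?_
  by_contra hne
  rw [not_lt_top_iff] at hne
  rw [hne, ENNReal.top_rpow_of_pos (by norm_num)] at ht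
  exact lt_irrefl _ ht

/-- Minkowski's inequality bounds this `L²_ξ L¹_t` norm by the `L¹_t L²_ξ` norm, and Plancherel at
each time bounds the latter through `‖w(t)‖₂` and `‖F(t)‖₂`. It is the basic bound behind all
exchanges of integrals on the Fourier side. -/
theorem lintegral_sq_rhs_lt_top (h : IsLinearWeakSolution T z w F) (R : ℝ) :
    ∫⁻ ξ in Metric.ball 0 R, (∫⁻ s in Ioo 0 T, ‖rhsSlice w F (s, ξ)‖ₑ) ^ 2 < ⊤ := by
  have hrm : Measurable fun q => ‖rhsSlice w F q‖ₑ :=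
    (measurable_rhsSlice h.measurable_w h.measurable_F).enorm
  refine (lintegral_sq_lintegral_le hrm).trans_lt (ENNReal.pow_lt_top ?_)
  set A : ℝ≥0∞ := ENNReal.ofReal (2 * (4 * Real.pi ^ 2 * R ^ 2) ^ 2) with hA
  set B : ℝ≥0∞ := ENNReal.ofReal (2 * (2 * Real.pi * R) ^ 2) with hB
  have hmw : Measurable fun s => ∫⁻ x, ‖w (s, x)‖ₑ ^ 2 :=
    (h.measurable_w.enorm.pow_const 2).lintegral_prod_right'
  have hmF : Measurable fun s => (∫⁻ x, ‖F (s, x)‖ₑ ^ 2) ^ (1 / 2 : ℝ) :=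
    ((h.measurable_F.enorm.pow_const 2).lintegral_prod_right').pow_const _
  have hw2 : ∫⁻ s in Ioo 0 T, ∫⁻ x, ‖w (s, x)‖ₑ ^ 2 < ⊤ := by
    rw [← lintegral_prod (f := fun q : ℝ × Space d => ‖w q‖ₑ ^ 2)
      (h.measurable_w.enorm.pow_const 2).aemeasurable, lintegral_enorm_sq_eq]
    exact ENNReal.pow_lt_top h.memLp_w.2
  have key : ∀ᵐ s ∂(volume.restrict (Ioo 0 T)),
      (∫⁻ ξ in Metric.ball 0 R, ‖rhsSlice w F (s, ξ)‖ₑ ^ 2) ^ (1 / 2 : ℝ)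
        ≤ (1 + A * ∫⁻ x, ‖w (s, x)‖ₑ ^ 2)
          + B ^ (1 / 2 : ℝ) * (∫⁻ x, ‖F (s, x)‖ₑ ^ 2) ^ (1 / 2 : ℝ) := by
    filter_upwards [h.integrable_w.prod_right_ae, ae_memLp_slice h.measurable_w h.memLp_w,
      h.integrable_F, h.ae_memLp_F] with s hw1 hw2 hF1 hF2
    have e1 : ∫⁻ ξ in Metric.ball 0 R, ‖rhsSlice w F (s, ξ)‖ₑ ^ 2
        ≤ A * (∫⁻ x, ‖w (s, x)‖ₑ ^ 2) + B * ∫⁻ x, ‖F (s, x)‖ₑ ^ 2 := by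
      have p1 : ∫⁻ x, ‖w (s, x)‖ₑ ^ 2 = ∫⁻ ξ, ‖𝓕 (fun x => (w (s, x) : ℂ)) ξ‖ₑ ^ 2 := by
        rw [lintegral_enorm_sq_fourier_eq (f := fun x => (w (s, x) : ℂ)) hw1.ofReal hw2.ofReal]
        refine lintegral_congr fun x => ?_
        rw [← ofReal_norm, ← ofReal_norm, Complex.norm_real]
      have p2 : ∫⁻ x, ‖F (s, x)‖ₑ ^ 2
          = ∫⁻ ξ, ∑ j, ‖𝓕 (coord (fun x => F (s, x)) j) ξ‖ₑ ^ 2 := by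
        rw [lintegral_finsetSum']
        · simp_rw [lintegral_enorm_sq_fourier_eq (integrable_coord hF1 _) (memLp_coord hF2 _)]
          rw [← lintegral_finsetSum']
          · simp only [sum_enorm_sq_coord]
          · exact fun j _ => ((memLp_coord hF2 j).1.enorm.pow_const 2)
        · exact fun j _ => (memLp_fourier (integrable_coord hF1 j) (memLp_coord hF2 j)).1.enorm.pow_const 2
      have m1 : AEMeasurable (fun ξ => ‖𝓕 (fun x => (w (s, x) : ℂ)) ξ‖ₑ ^ 2) volume :=
        (memLp_fourier hw1.ofReal hw2.ofReal).1.enorm.pow_const 2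
      rw [p1, p2, ← lintegral_const_mul'' _ m1, ← lintegral_const_mul' _ _ ENNReal.ofReal_ne_top,
        ← lintegral_add_left' (m1.const_mul _)]
      refine (lintegral_mono_ae ?_).trans (setLIntegral_le_lintegral (Metric.ball 0 R) _)
      filter_upwards [ae_restrict_mem measurableSet_ball] with ξ hξ
      have hξ' : ‖ξ‖ ≤ R := (mem_ball_zero_iff.1 hξ).le
      have := ENNReal.ofReal_le_ofReal
        (norm_sq_rhsFourier_le (fun x => w (s, x)) (fun x => F (s, x)) hξ')
      rw [ENNReal.ofReal_add (by positivity) (by positivity),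
        ENNReal.ofReal_mul (p := 2 * (4 * Real.pi ^ 2 * R ^ 2) ^ 2) (by positivity),
        ENNReal.ofReal_mul (p := 2 * (2 * Real.pi * R) ^ 2) (by positivity), ENNReal.ofReal_sum_of_nonneg (fun _ _ => sq_nonneg _)] at this
      simp only [ENNReal.ofReal_pow (norm_nonneg _), ofReal_norm] at this
      exact this
    calc _ ≤ (A * (∫⁻ x, ‖w (s, x)‖ₑ ^ 2) + B * ∫⁻ x, ‖F (s, x)‖ₑ ^ 2) ^ (1 / 2 : ℝ) := by gcongr
      _ ≤ (A * (∫⁻ x, ‖w (s, x)‖ₑ ^ 2)) ^ (1 / 2 : ℝ) + (B * ∫⁻ x, ‖F (s, x)‖ₑ ^ 2) ^ (1 / 2 : ℝ) :=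
        ENNReal.rpow_add_le_add_rpow _ _ (by norm_num) (by norm_num)
      _ ≤ _ := by
        rw [ENNReal.mul_rpow_of_nonneg B _ (by norm_num : (0 : ℝ) ≤ 1 / 2)]
        gcongr
        -- Since `(0, T)` has finite measure, `√y ≤ 1 + y` reduces integrability in time to that of
        -- `‖w(t)‖₂²`.
        set y := A * (∫⁻ x, ‖w (s, x)‖ₑ ^ 2)
        rcases le_total y 1 with hy | hy
        · exact (ENNReal.rpow_le_one hy (by norm_num)).trans le_self_add
        · refine le_trans ?_ le_add_self
          calc y ^ (1 / 2 : ℝ) ≤ y ^ (1 : ℝ) := ENNReal.rpow_le_rpow_of_exponent_le hy (by norm_num)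
            _ = y := ENNReal.rpow_one y
  refine (lintegral_mono_ae key).trans_lt ?_
  have hm1 : Measurable fun s => 1 + A * ∫⁻ x, ‖w (s, x)‖ₑ ^ 2 :=
    measurable_const.add (hmw.const_mul _)
  rw [lintegral_add_left hm1,
    lintegral_add_left measurable_const, lintegral_const_mul _ hmw, lintegral_const_mul _ hmF]
  refine ENNReal.add_lt_top.2 ⟨ENNReal.add_lt_top.2 ⟨?_, ?_⟩, ?_⟩
  · simp
  · exact ENNReal.mul_lt_top ENNReal.ofReal_lt_top hw2
  · exact ENNReal.mul_lt_top (ENNReal.rpow_lt_top_of_nonneg (by norm_num) ENNReal.ofReal_ne_top)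
      h.lintegral_F

end IsLinearWeakSolution

end NFPE
end

/-! ### The equation on the Fourier side -/

noncomputable section

namespace NFPE

open FourierTransform SchwartzMap LineDeriv Laplacian

variable {d : ℕ}

/-- Lebesgue measure on `(0, t) × B_R`. -/
abbrev cyl (d : ℕ) (t R : ℝ) : Measure (ℝ × Space d) :=
  (volume.restrict (Ioo 0 t)).prod (volume.restrict (Metric.ball 0 R))

theorem cyl_eq_restrict (t R : ℝ) :
    cyl d t R = (slab d t).restrict (univ ×ˢ Metric.ball 0 R) := by
  rw [cyl, slab, ← Measure.prod_restrict, Measure.restrict_univ]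

theorem cyl_mono {t T : ℝ} (h : t ≤ T) (R : ℝ) : cyl d t R ≤ cyl d T R :=
  Measure.prod_mono (Measure.restrict_mono (Ioo_subset_Ioo_right h) le_rfl) le_rfl

theorem integrable_mul_of_hasCompactSupport {T : ℝ} {f : ℝ × Space d → ℂ}
    (hf : ∀ R, Integrable f (cyl d T R)) {g : Space d → ℂ} (hg : Continuous g)
    (hc : HasCompactSupport g) : Integrable (fun q => f q * g q.2) (slab d T) := by
  obtain ⟨C, hC⟩ := hc.exists_bound_of_continuous hg
  obtain ⟨R, hR⟩ := hc.isBounded.subset_ball 0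
  have h1 : Integrable (fun q => f q * g q.2) (cyl d T R) :=
    (hf R).mul_bdd (c := C) (hg.comp continuous_snd).aestronglyMeasurable
      (Eventually.of_forall fun q => hC _)
  rw [cyl_eq_restrict] at h1
  refine (integrableOn_iff_integrable_of_support_subset ?_).1 h1
  intro q hq
  refine ⟨mem_univ _, hR (subset_tsupport g ?_)⟩
  exact right_ne_zero_of_mul hq

/-- The Fourier symbol of `(1 - Δ)⁻¹`. -/
def resolventSymbol (ξ : Space d) : ℝ := (1 + 4 * Real.pi ^ 2 * ‖ξ‖ ^ 2)⁻¹

theorem resolventSymbol_pos (ξ : Space d) : 0 < resolventSymbol ξ := by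
  unfold resolventSymbol; positivity

theorem resolventSymbol_le_one (ξ : Space d) : resolventSymbol ξ ≤ 1 :=
  inv_le_one_of_one_le₀ (by have : 0 ≤ 4 * Real.pi ^ 2 * ‖ξ‖ ^ 2 := by positivity
                            linarith)

theorem continuous_resolventSymbol : Continuous (resolventSymbol (d := d)) := by
  unfold resolventSymbol
  refine Continuous.inv₀ (by fun_prop) fun ξ => ?_
  positivity

namespace IsLinearWeakSolution

variable {T : ℝ} {z w : ℝ × Space d → ℝ} {F : ℝ × Space d → Space d}

/-- The time primitive of the right-hand side on the Fourier side. -/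
def primitive (w : ℝ × Space d → ℝ) (F : ℝ × Space d → Space d) (q : ℝ × Space d) : ℂ :=
  ∫ s in Ioo 0 q.1, rhsSlice w F (s, q.2)

theorem measurable_primitive (h : IsLinearWeakSolution T z w F) :
    Measurable (primitive w F) := by
  have hr := measurable_rhsSlice h.measurable_w h.measurable_F
  have : primitive w F = fun q => ∫ s, {p : (ℝ × Space d) × ℝ | 0 < p.2 ∧ p.2 < p.1.1}.indicator
      (fun p => rhsSlice w F (p.2, p.1.2)) (q, s) := by
    ext q
    unfold primitive
    rw [← integral_indicator measurableSet_Ioo]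
    rfl
  rw [this]
  refine StronglyMeasurable.measurable (StronglyMeasurable.integral_prod_right' ?_)
  refine (Measurable.indicator (hr.comp (by fun_prop)) ?_).stronglyMeasurable
  exact (measurableSet_lt measurable_const measurable_snd).inter
    (measurableSet_lt measurable_snd (measurable_fst.comp measurable_fst))

/-- The inequality `a ≤ 1 + a²` passes from the mixed `L²` bound to `L¹`, the ball having finite
measure. -/
theorem integrable_rhs (h : IsLinearWeakSolution T z w F) (R : ℝ) :
    Integrable (rhsSlice w F) (cyl d T R) := by
  have hr := measurable_rhsSlice h.measurable_w h.measurable_F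
  refine ⟨hr.aestronglyMeasurable, ?_⟩
  rw [hasFiniteIntegral_iff_enorm, lintegral_prod_symm' _ hr.enorm]
  have hle : ∀ a : ℝ≥0∞, a ≤ 1 + a ^ 2 := fun a => by
    rcases le_total a 1 with ha | ha
    · exact ha.trans le_self_add
    · exact (le_self_pow₀ ha two_ne_zero).trans le_add_self
  refine (lintegral_mono fun ξ => hle _).trans_lt ?_
  rw [lintegral_add_left measurable_const]
  refine ENNReal.add_lt_top.2 ⟨?_, h.lintegral_sq_rhs_lt_top R⟩
  simp [measure_ball_lt_top]

theorem ae_integrableOn_rhs (h : IsLinearWeakSolution T z w F) :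
    ∀ᵐ ξ, IntegrableOn (fun s => rhsSlice w F (s, ξ)) (Ioo 0 T) := by
  have h1 : ∀ᵐ ξ, ∀ n : ℕ, ξ ∈ Metric.ball (0 : Space d) n →
      IntegrableOn (fun s => rhsSlice w F (s, ξ)) (Ioo 0 T) := by
    rw [ae_all_iff]
    intro n
    exact (ae_restrict_iff' measurableSet_ball).1 (h.integrable_rhs n).prod_left_ae
  filter_upwards [h1] with ξ hξ
  obtain ⟨n, hn⟩ := exists_nat_gt ‖ξ‖
  exact hξ n (mem_ball_zero_iff.2 hn)

/-- The transform is bounded by `‖z(t)‖₁` uniformly in `ξ`; this is integrable in time, and the ball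
of frequencies has finite measure. -/
theorem integrable_hat (h : IsLinearWeakSolution T z w F) (R : ℝ) :
    Integrable (hat z) (cyl d T R) := by
  refine Integrable.mono' (g := fun q : ℝ × Space d => (∫ x, ‖z (q.1, x)‖) * 1) ?_
    (measurable_hat h.measurable_z).aestronglyMeasurable (Eventually.of_forall fun q => ?_)
  · have : IsFiniteMeasure (volume.restrict (Metric.ball (0 : Space d) R)) :=
      ⟨by simp [measure_ball_lt_top]⟩
    exact h.integrable_z.integral_norm_prod_left.mul_prod (integrable_const (1 : ℝ))
  · rw [mul_one]
    refine (norm_sliceFourier_le _ q).trans (le_of_eq ?_)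
    simp

theorem norm_primitive_le {q : ℝ × Space d}
    (hq : q.1 ∈ Ioo 0 T) (hi : IntegrableOn (fun s => rhsSlice w F (s, q.2)) (Ioo 0 T)) :
    ‖primitive w F q‖ ≤ ∫ s in Ioo 0 T, ‖rhsSlice w F (s, q.2)‖ := by
  refine (norm_integral_le_integral_norm _).trans ?_
  exact setIntegral_mono_set hi.norm (Eventually.of_forall fun _ => norm_nonneg _)
    (Ioo_subset_Ioo_right hq.2.le).eventuallyLE

theorem integrable_primitive (h : IsLinearWeakSolution T z w F) (R : ℝ) :
    Integrable (primitive w F) (cyl d T R) := by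
  have h1 : Integrable (fun q : ℝ × Space d => 1 * ∫ s in Ioo 0 T, ‖rhsSlice w F (s, q.2)‖)
      (cyl d T R) := by
    have : IsFiniteMeasure (volume.restrict (Ioo (0 : ℝ) T)) := ⟨by simp⟩
    exact (integrable_const (1 : ℝ)).mul_prod (h.integrable_rhs R).integral_norm_prod_right
  refine h1.mono' h.measurable_primitive.aestronglyMeasurable ?_
  have h2 : ∀ᵐ q ∂(cyl d T R), IntegrableOn (fun s => rhsSlice w F (s, q.2)) (Ioo 0 T) :=
    Measure.quasiMeasurePreserving_snd.ae (ae_restrict_of_ae h.ae_integrableOn_rhs)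
  have h3 : ∀ᵐ q ∂(cyl d T R), q.1 ∈ Ioo 0 T :=
    Measure.quasiMeasurePreserving_fst.ae (ae_restrict_mem measurableSet_Ioo)
  filter_upwards [h2, h3] with q hq1 hq2
  rw [one_mul]
  exact norm_primitive_le hq2 hq1

/-- The weak formulation is tested with `ψ = 𝓕 g`; the multiplication formula then transfers `𝓕` to
the solution. The exceptional null set of times depends on `g`. -/
theorem ae_integral_hat_mul_eq (h : IsLinearWeakSolution T z w F) {g : Space d → ℂ}
    (hg : ContDiff ℝ ∞ g) (hc : HasCompactSupport g) :
    ∀ᵐ t ∂(volume.restrict (Ioo 0 T)),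
      ∫ ξ, hat z (t, ξ) * g ξ = ∫ ξ, primitive w F (t, ξ) * g ξ := by
  set G : 𝓢(Space d, ℂ) := hc.toSchwartzMap hg with hG
  have hGg : ∀ ξ, G ξ = g ξ := fun ξ => rfl
  have hiG := integrable_mul_of_hasCompactSupport h.integrable_rhs hg.continuous hc
  set ψ : 𝓢(Space d, ℂ) := 𝓕 G with hψ
  have hψs : ContDiff ℝ ∞ ψ := ψ.smooth ⊤
  have hint := h.integrable_integrand (a := Δ ⇑ψ) (L := fderiv ℝ ψ)
    (C := d * SchwartzMap.seminorm ℝ 0 2 ψ)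
    (continuous_laplacian hψs) (hψs.continuous_fderiv (by simp))
    (fun x => (norm_laplacian_le ψ x).trans (by
      gcongr
      simpa using SchwartzMap.le_seminorm ℝ 0 2 ψ x))
    (Φ := fun x => ‖fderiv ℝ ψ x‖) ((fderivCLM ℝ (Space d) ℂ ψ).memLp 2 volume).norm (fun x => le_rfl)
  filter_upwards [h.weak_schwartz ψ, h.integrable_z.prod_right_ae,
    ae_restrict_mem measurableSet_Ioo] with t h1 hz ht
  have hsub : Ioo 0 t ⊆ Ioo 0 T := Ioo_subset_Ioo_right ht.2.le
  have e1 : ∫ x, z (t, x) • ψ x = ∫ ξ, hat z (t, ξ) * g ξ := by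
    have := integral_mul_fourier_schwartz (f := fun x => (z (t, x) : ℂ)) hz.ofReal G
    simp only [Complex.real_smul]
    exact this
  rw [← e1, h1, integral_prod _ (hint.mono_measure (slab_mono ht.2.le))]
  have e2 : ∫ s in Ioo 0 t, ∫ x, (w (s, x) • Δ (⇑ψ) x + fderiv ℝ ψ x (F (s, x)))
      = ∫ s in Ioo 0 t, ∫ ξ, rhsSlice w F (s, ξ) * g ξ := by
    refine integral_congr_ae ?_
    filter_upwards [ae_restrict_of_ae_restrict_of_subset hsub h.integrable_w.prod_right_ae,
      ae_restrict_of_ae_restrict_of_subset hsub h.integrable_F] with s hw hF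
    have := integral_laplacian_fourier_add_fderiv_fourier hw hF G
    simp only [Complex.real_smul]
    exact this
  rw [e2, integral_integral_swap (hiG.mono_measure (slab_mono ht.2.le))]
  refine integral_congr_ae (Eventually.of_forall fun ξ => ?_)
  simp only [primitive]
  rw [integral_mul_const]

/-- The equation holds pointwise on the Fourier side. -/
theorem ae_hat_eq_primitive (hT : 0 < T) (h : IsLinearWeakSolution T z w F) :
    ∀ᵐ ξ, ∀ᵐ t ∂(volume.restrict (Ioo 0 T)), hat z (t, ξ) = primitive w F (t, ξ) := by
  set Z : ℝ × Space d → ℂ := fun q => hat z q - primitive w F q with hZ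
  have hZi : ∀ R, Integrable Z (cyl d T R) := fun R =>
    (h.integrable_hat R).sub (h.integrable_primitive R)
  -- Testing in `ξ` determines the time integral of `Z` over `(0, r)` off a null set of frequencies
  -- depending on `r`. Rational `r` keep the union of these sets null and still determine a
  -- continuous primitive.
  have h1 : ∀ r : ℚ, ∀ᵐ ξ, (r : ℝ) ∈ Ioo 0 T → ∫ s in Ioo 0 (r : ℝ), Z (s, ξ) = 0 := by
    intro r
    by_cases hr : (r : ℝ) ∈ Ioo 0 T
    swap
    · exact Eventually.of_forall fun ξ hr' => absurd hr' hr
    have hZr : ∀ R, Integrable Z (cyl d r R) := fun R => (hZi R).mono_measure (cyl_mono hr.2.le R)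
    have hloc : LocallyIntegrable fun ξ => ∫ s in Ioo 0 (r : ℝ), Z (s, ξ) := by
      intro ξ
      refine ⟨Metric.ball 0 (‖ξ‖ + 1), Metric.isOpen_ball.mem_nhds (by simp), ?_⟩
      exact (hZr _).integral_prod_right
    have := ae_eq_zero_of_integral_contDiff_smul_eq_zero hloc fun g hg hgc => ?_
    · filter_upwards [this] with ξ hξ _ using hξ
    have hgc' : HasCompactSupport (fun x => (g x : ℂ)) :=
      hgc.comp_left (g := fun r : ℝ => (r : ℂ)) (by simp)
    have hg' : ContDiff ℝ ∞ (fun x => (g x : ℂ)) := Complex.ofRealCLM.contDiff.comp hg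
    have hi := integrable_mul_of_hasCompactSupport hZr hg'.continuous hgc'
    calc ∫ ξ, g ξ • ∫ s in Ioo 0 (r : ℝ), Z (s, ξ)
        = ∫ ξ, ∫ s in Ioo 0 (r : ℝ), Z (s, ξ) * (g ξ : ℂ) := by
          refine integral_congr_ae (Eventually.of_forall fun ξ => ?_)
          simp only [Complex.real_smul]
          rw [integral_mul_const, mul_comm]
      _ = ∫ s in Ioo 0 (r : ℝ), ∫ ξ, Z (s, ξ) * (g ξ : ℂ) := (integral_integral_swap hi).symm
      _ = ∫ s in Ioo 0 (r : ℝ), 0 := by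
          refine integral_congr_ae ?_
          have hsub : Ioo 0 (r : ℝ) ⊆ Ioo 0 T := Ioo_subset_Ioo_right hr.2.le
          have i1 := integrable_mul_of_hasCompactSupport h.integrable_hat hg'.continuous hgc'
          have i2 := integrable_mul_of_hasCompactSupport h.integrable_primitive hg'.continuous hgc'
          filter_upwards [ae_restrict_of_ae_restrict_of_subset hsub
            (h.ae_integral_hat_mul_eq hg' hgc'),
            ae_restrict_of_ae_restrict_of_subset hsub i1.prod_right_ae,
            ae_restrict_of_ae_restrict_of_subset hsub i2.prod_right_ae] with s hs j1 j2
          simp only [hZ, sub_mul]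
          rw [integral_sub j1 j2, hs, sub_self]
      _ = 0 := by simp
  have h2 : ∀ᵐ ξ, IntegrableOn (fun s => Z (s, ξ)) (Ioo 0 T) := by
    have h1 : ∀ᵐ ξ, ∀ n : ℕ, ξ ∈ Metric.ball (0 : Space d) n →
        IntegrableOn (fun s => Z (s, ξ)) (Ioo 0 T) := by
      rw [ae_all_iff]
      intro n
      exact (ae_restrict_iff' measurableSet_ball).1 (hZi n).prod_left_ae
    filter_upwards [h1] with ξ hξ
    obtain ⟨n, hn⟩ := exists_nat_gt ‖ξ‖
    exact hξ n (mem_ball_zero_iff.2 hn)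
  filter_upwards [ae_all_iff.2 h1, h2] with ξ e1 e2
  filter_upwards [ae_eq_zero_of_primitive_eq_zero hT e2 e1] with t ht
  exact sub_eq_zero.1 ht

/-- The density of the energy identity. -/
def energyDensity (z w : ℝ × Space d → ℝ) (F : ℝ × Space d → Space d) (q : ℝ × Space d) : ℝ :=
  2 * ((starRingEnd ℂ) (hat z q) * rhsSlice w F q).re

theorem measurable_energyDensity (h : IsLinearWeakSolution T z w F) :
    Measurable (energyDensity z w F) :=
  (Complex.measurable_re.comp ((Complex.continuous_conj.measurable.comp
    (measurable_hat h.measurable_z)).mul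
      (measurable_rhsSlice h.measurable_w h.measurable_F))).const_mul 2

/-- As a primitive, `ẑ(·, ξ)` is bounded in time by `∫|rhs|`. The density is therefore bounded in
`L¹_t` by `2(∫|rhs|)²`, which is integrable over the ball by the Minkowski estimate. -/
theorem integrable_energyDensity (hT : 0 < T) (h : IsLinearWeakSolution T z w F) (R : ℝ) :
    Integrable (energyDensity z w F) (cyl d T R) := by
  have hr := measurable_rhsSlice h.measurable_w h.measurable_F
  refine ⟨h.measurable_energyDensity.aestronglyMeasurable, ?_⟩
  rw [hasFiniteIntegral_iff_enorm, lintegral_prod_symm' _ h.measurable_energyDensity.enorm]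
  have key : ∀ᵐ ξ ∂(volume.restrict (Metric.ball (0 : Space d) R)),
      ∫⁻ s in Ioo 0 T, ‖energyDensity z w F (s, ξ)‖ₑ
        ≤ 2 * (∫⁻ s in Ioo 0 T, ‖rhsSlice w F (s, ξ)‖ₑ) ^ 2 := by
    filter_upwards [ae_restrict_of_ae h.ae_integrableOn_rhs,
      ae_restrict_of_ae (h.ae_hat_eq_primitive hT)] with ξ h1 h2
    have hrξ : Measurable fun s => ‖rhsSlice w F (s, ξ)‖ₑ := (hr.comp (by fun_prop)).enorm
    rw [sq, ← mul_assoc, ← lintegral_const_mul _ hrξ]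
    refine lintegral_mono_ae ?_
    filter_upwards [h2, ae_restrict_mem measurableSet_Ioo] with s hs hs'
    have hb : ‖hat z (s, ξ)‖ₑ ≤ ∫⁻ s in Ioo 0 T, ‖rhsSlice w F (s, ξ)‖ₑ := by
      rw [hs, ← ofReal_integral_norm_eq_lintegral_enorm h1, ← ofReal_norm]
      exact ENNReal.ofReal_le_ofReal (norm_primitive_le hs' h1)
    calc ‖energyDensity z w F (s, ξ)‖ₑ ≤ ‖(2 : ℝ)‖ₑ * (‖hat z (s, ξ)‖ₑ * ‖rhsSlice w F (s, ξ)‖ₑ) := by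
          rw [energyDensity, enorm_mul]
          gcongr
          rw [← ofReal_norm, ← ofReal_norm (hat z (s, ξ)), ← ofReal_norm (rhsSlice w F (s, ξ)),
            ← ENNReal.ofReal_mul (norm_nonneg _)]
          refine ENNReal.ofReal_le_ofReal ((Complex.abs_re_le_norm _).trans ?_)
          rw [norm_mul, RCLike.norm_conj]
      _ ≤ 2 * (∫⁻ s in Ioo 0 T, ‖rhsSlice w F (s, ξ)‖ₑ) * ‖rhsSlice w F (s, ξ)‖ₑ := by
          rw [← mul_assoc]
          gcongr
          simp [← ofReal_norm]
  refine (lintegral_mono_ae key).trans_lt ?_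
  rw [lintegral_const_mul' _ _ (by simp)]
  exact ENNReal.mul_lt_top (by simp) (h.lintegral_sq_rhs_lt_top R)

/-- The truncated `H⁻¹` energy. -/
def energy (z : ℝ × Space d → ℝ) (R t : ℝ) : ℝ :=
  ∫ ξ in Metric.ball 0 R, resolventSymbol ξ * ‖hat z (t, ξ)‖ ^ 2

/-- The time derivative of the truncated `H⁻¹` energy. -/
def energyDeriv (z w : ℝ × Space d → ℝ) (F : ℝ × Space d → Space d) (R s : ℝ) : ℝ :=
  ∫ ξ in Metric.ball 0 R, resolventSymbol ξ * energyDensity z w F (s, ξ)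

theorem integrable_resolventSymbol_mul {f : ℝ × Space d → ℝ} {t R : ℝ}
    (hf : Integrable f (cyl d t R)) :
    Integrable (fun q => resolventSymbol q.2 * f q) (cyl d t R) :=
  hf.bdd_mul (c := 1) (continuous_resolventSymbol.comp continuous_snd).aestronglyMeasurable
    (Eventually.of_forall fun q => by
      rw [Real.norm_of_nonneg (resolventSymbol_pos _).le]; exact resolventSymbol_le_one _)

/-- At fixed `ξ` this is the formula for the squared modulus of a primitive; integrating in `ξ` and
exchanging the integrals gives the claim. -/
theorem ae_energy_eq (hT : 0 < T) (h : IsLinearWeakSolution T z w F) (R : ℝ) :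
    ∀ᵐ t ∂(volume.restrict (Ioo 0 T)), energy z R t = ∫ s in 0..t, energyDeriv z w F R s := by
  have hms : MeasurableSet {q | hat z q = primitive w F q} :=
    measurableSet_eq_fun (measurable_hat h.measurable_z) h.measurable_primitive
  -- The energy is an integral over `ξ` at fixed time, so the identity known for a.e. `ξ` and then
  -- a.e. `t` is needed with the quantifiers exchanged; joint measurability permits this.
  have h1 : ∀ᵐ t ∂(volume.restrict (Ioo 0 T)), ∀ᵐ ξ, hat z (t, ξ) = primitive w F (t, ξ) := by
    rw [Measure.ae_ae_comm hms]
    exact h.ae_hat_eq_primitive hT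
  filter_upwards [h1, ae_restrict_mem measurableSet_Ioo] with t ht htT
  have hsub : Ioo 0 t ⊆ Ioo 0 T := Ioo_subset_Ioo_right htT.2.le
  have hi := integrable_resolventSymbol_mul
    ((h.integrable_energyDensity hT R).mono_measure (cyl_mono htT.2.le R))
  rw [intervalIntegral.integral_of_le htT.1.le, integral_Ioc_eq_integral_Ioo]
  unfold energyDeriv energy
  rw [integral_integral_swap hi]
  refine integral_congr_ae ?_
  filter_upwards [ae_restrict_of_ae ht, ae_restrict_of_ae h.ae_integrableOn_rhs,
    ae_restrict_of_ae (h.ae_hat_eq_primitive hT)] with ξ e1 e2 e3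
  rw [integral_const_mul, e1]
  congr 1
  have hii : IntervalIntegrable (fun s => rhsSlice w F (s, ξ)) volume 0 t :=
    (intervalIntegrable_iff_integrableOn_Ioo_of_le htT.1.le).2 (e2.mono_set hsub)
  have hp : ∀ s, 0 ≤ s → primitive w F (s, ξ) = ∫ r in 0..s, rhsSlice w F (r, ξ) := fun s hs => by
    rw [intervalIntegral.integral_of_le hs, integral_Ioc_eq_integral_Ioo, primitive]
  rw [hp t htT.1.le, normSq_integral_eq hii, intervalIntegral.integral_of_le htT.1.le,
    integral_Ioc_eq_integral_Ioo]
  refine integral_congr_ae ?_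
  filter_upwards [ae_restrict_of_ae_restrict_of_subset hsub e3, ae_restrict_mem measurableSet_Ioo]
    with s hs hs'
  rw [energyDensity, hs, hp s hs'.1.le]

end IsLinearWeakSolution

end NFPE
end

/-! ### The energy estimate in `H⁻¹` -/

noncomputable section

namespace NFPE

open FourierTransform SchwartzMap LineDeriv Laplacian

variable {d : ℕ}

theorem resolventSymbol_mul (ξ : Space d) :
    resolventSymbol ξ * (4 * Real.pi ^ 2 * ‖ξ‖ ^ 2) = 1 - resolventSymbol ξ := by
  unfold resolventSymbol
  have : (1 + 4 * Real.pi ^ 2 * ‖ξ‖ ^ 2) ≠ 0 := by positivity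
  field_simp
  ring

/-- The pointwise core of the `H⁻¹` estimate. The factor `m · 4π²|ξ|² = 1 - m` turns the diffusion
into `-2 Re(ζ̄ŵ)` and a remainder with weight `m`. In the drift term `m` absorbs the square of the
symbol `2πξ`, so no derivative falls on `F`. -/
theorem resolventSymbol_mul_re_le (w : Space d → ℝ) (F : Space d → Space d) (ζ : ℂ) (ξ : Space d)
    {c₁ c₂ : ℝ} (hc₁ : 0 < c₁) (hc₂ : 0 < c₂) :
    resolventSymbol ξ * (2 * ((starRingEnd ℂ) ζ * rhsFourier w F ξ).re)
      ≤ -2 * ((starRingEnd ℂ) ζ * 𝓕 (fun x => (w x : ℂ)) ξ).re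
        + (c₁ + c₂) * (resolventSymbol ξ * ‖ζ‖ ^ 2) + ‖𝓕 (fun x => (w x : ℂ)) ξ‖ ^ 2 / c₁
        + (∑ j, ‖𝓕 (coord F j) ξ‖ ^ 2) / c₂ := by
  set m := resolventSymbol ξ with hm
  set S := ∑ j, ‖𝓕 (coord F j) ξ‖ ^ 2 with hS
  set wh := 𝓕 (fun x => (w x : ℂ)) ξ with hwh
  set σ := ∑ j, ((ξ j : ℝ) : ℂ) * 𝓕 (coord F j) ξ with hσ
  have hS0 : 0 ≤ S := Finset.sum_nonneg fun _ _ => sq_nonneg _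
  have hm0 : 0 < m := resolventSymbol_pos ξ
  have hm1 : m ≤ 1 := resolventSymbol_le_one ξ
  have hmm : m * (4 * Real.pi ^ 2 * ‖ξ‖ ^ 2) = 1 - m := resolventSymbol_mul ξ
  have hpi := Real.pi_pos
  have hσS : ‖σ‖ ≤ ‖ξ‖ * √S := norm_sum_mul_fourier_le F ξ
  have e1 : ((starRingEnd ℂ) ζ * rhsFourier w F ξ).re
      = -(4 * Real.pi ^ 2 * ‖ξ‖ ^ 2) * ((starRingEnd ℂ) ζ * wh).re
        - ((starRingEnd ℂ) ζ * (2 * Real.pi * Complex.I * σ)).re := by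
    unfold rhsFourier
    rw [mul_sub, Complex.sub_re, ← Complex.re_ofReal_mul, ← hwh, ← hσ]
    congr 2
    push_cast
    ring
  have b1 : ((starRingEnd ℂ) ζ * wh).re ≤ ‖ζ‖ * ‖wh‖ := by
    refine (Complex.re_le_norm _).trans (le_of_eq ?_)
    rw [norm_mul, RCLike.norm_conj]
  have b2 : -((starRingEnd ℂ) ζ * (2 * Real.pi * Complex.I * σ)).re
      ≤ ‖ζ‖ * (2 * Real.pi * (‖ξ‖ * √S)) := by
    refine (neg_le_abs _).trans ((Complex.abs_re_le_norm _).trans ?_)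
    rw [norm_mul, RCLike.norm_conj]
    gcongr
    rw [norm_mul]
    have : ‖(2 * Real.pi * Complex.I : ℂ)‖ = 2 * Real.pi := by simp [abs_of_pos hpi]
    rw [this]
    gcongr
  have young : ∀ {x y c : ℝ}, 0 < c → 2 * (x * y) ≤ c * x ^ 2 + y ^ 2 / c := by
    intro x y c hc
    have : 0 ≤ (c * x - y) ^ 2 / c := by positivity
    have h2 : (c * x - y) ^ 2 / c = c * x ^ 2 + y ^ 2 / c - 2 * (x * y) := by
      field_simp
      ring
    linarith
  have y1 : 2 * (m * (‖ζ‖ * ‖wh‖)) ≤ c₁ * (m * ‖ζ‖ ^ 2) + ‖wh‖ ^ 2 / c₁ := by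
    have h1 := mul_le_mul_of_nonneg_left (young (x := ‖ζ‖) (y := ‖wh‖) hc₁) hm0.le
    have h2 : m * (‖wh‖ ^ 2 / c₁) ≤ 1 * (‖wh‖ ^ 2 / c₁) := by gcongr
    nlinarith
  -- Young's inequality is applied before `m` is distributed, so that `m` meets `(2π|ξ|)²` and
  -- produces `1 - m ≤ 1`.
  have y2 : 2 * (m * (‖ζ‖ * (2 * Real.pi * (‖ξ‖ * √S)))) ≤ c₂ * (m * ‖ζ‖ ^ 2) + S / c₂ := by
    have h1 := mul_le_mul_of_nonneg_left
      (young (x := ‖ζ‖) (y := 2 * Real.pi * (‖ξ‖ * √S)) hc₂) hm0.le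
    have h2 : m * ((2 * Real.pi * (‖ξ‖ * √S)) ^ 2 / c₂) = (1 - m) * (S / c₂) := by
      rw [mul_pow, mul_pow, mul_pow, Real.sq_sqrt hS0, ← hmm]
      ring
    have h3 : (1 - m) * (S / c₂) ≤ 1 * (S / c₂) := by gcongr; linarith
    nlinarith
  rw [e1]
  have e2 : m * (2 * (-(4 * Real.pi ^ 2 * ‖ξ‖ ^ 2) * ((starRingEnd ℂ) ζ * wh).re
        - ((starRingEnd ℂ) ζ * (2 * Real.pi * Complex.I * σ)).re))
      = -2 * (1 - m) * ((starRingEnd ℂ) ζ * wh).re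
        + 2 * (m * (-((starRingEnd ℂ) ζ * (2 * Real.pi * Complex.I * σ)).re)) := by
    rw [← hmm]; ring
  rw [e2]
  have b1' := mul_le_mul_of_nonneg_left b1 hm0.le
  have b2' := mul_le_mul_of_nonneg_left b2 hm0.le
  nlinarith

namespace IsLinearWeakSolution

variable {T : ℝ} {z w : ℝ × Space d → ℝ} {F : ℝ × Space d → Space d}

/-- Plancherel on almost every time slice, integrated in time. -/
theorem memLp_hat {f : ℝ × Space d → ℝ} (hf : Measurable f) (h1 : Integrable f (slab d T))
    (h2 : MemLp f 2 (slab d T)) : MemLp (hat f) 2 (slab d T) := by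
  refine memLp_two_of_lintegral_lt_top (measurable_hat hf).aestronglyMeasurable ?_
  have h3 : ∫⁻ q, ‖f q‖ₑ ^ 2 ∂(slab d T) < ⊤ := by
    rw [lintegral_enorm_sq_eq]
    exact ENNReal.pow_lt_top h2.2
  rw [lintegral_prod _ (hf.enorm.pow_const 2).aemeasurable] at h3
  rw [lintegral_prod _ ((measurable_hat hf).enorm.pow_const 2).aemeasurable]
  refine lt_of_le_of_lt (le_of_eq (lintegral_congr_ae ?_)) h3
  filter_upwards [h1.prod_right_ae, ae_memLp_slice hf h2] with s hs1 hs2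
  refine (lintegral_enorm_sq_fourier_eq (f := fun x => (f (s, x) : ℂ)) hs1.ofReal
    hs2.ofReal).trans ?_
  refine lintegral_congr fun x => ?_
  rw [← ofReal_norm, ← ofReal_norm, Complex.norm_real]

/-- The high-frequency error term. -/
def tail (z w : ℝ × Space d → ℝ) (R s : ℝ) : ℝ :=
  ∫ ξ in (Metric.ball 0 R)ᶜ, ‖hat z (s, ξ)‖ * ‖hat w (s, ξ)‖

theorem integrable_hat_mul_hat (h : IsLinearWeakSolution T z w F) :
    Integrable (fun q => ‖hat z q‖ * ‖hat w q‖) (slab d T) :=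
  (memLp_hat h.measurable_z h.integrable_z h.memLp_z).norm.integrable_mul
    (memLp_hat h.measurable_w h.integrable_w h.memLp_w).norm

theorem slab_restrict_compl (R : ℝ) :
    (slab d T).restrict (univ ×ˢ (Metric.ball 0 R)ᶜ)
      = (volume.restrict (Ioo 0 T)).prod (volume.restrict (Metric.ball 0 R)ᶜ) := by
  rw [slab, ← Measure.prod_restrict, Measure.restrict_univ]

theorem integrable_tail (h : IsLinearWeakSolution T z w F) (R : ℝ) :
    IntegrableOn (tail z w R) (Ioo 0 T) := by
  have := h.integrable_hat_mul_hat.integrableOn (s := univ ×ˢ (Metric.ball 0 R)ᶜ)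
  rw [IntegrableOn, slab_restrict_compl] at this
  exact this.integral_prod_left

theorem tendsto_integral_tail (h : IsLinearWeakSolution T z w F) :
    Tendsto (fun n : ℕ => ∫ s in Ioo 0 T, tail z w n s) atTop (𝓝 0) := by
  have e : ∀ n : ℕ, ∫ s in Ioo 0 T, tail z w n s
      = ∫ q in univ ×ˢ (Metric.ball 0 (n : ℝ))ᶜ, ‖hat z q‖ * ‖hat w q‖ ∂(slab d T) := fun n => by
    have := h.integrable_hat_mul_hat.integrableOn (s := univ ×ˢ (Metric.ball 0 (n : ℝ))ᶜ)
    rw [IntegrableOn, slab_restrict_compl] at this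
    rw [slab_restrict_compl, integral_prod _ this]
    rfl
  simp only [e]
  have h1 := tendsto_setIntegral_of_antitone (μ := slab d T)
    (s := fun n : ℕ => (univ : Set ℝ) ×ˢ (Metric.ball (0 : Space d) (n : ℝ))ᶜ)
    (f := fun q => ‖hat z q‖ * ‖hat w q‖)
    (fun n => MeasurableSet.univ.prod measurableSet_ball.compl) ?_
    ⟨0, h.integrable_hat_mul_hat.integrableOn⟩
  · have h2 : ⋂ n : ℕ, (univ : Set ℝ) ×ˢ (Metric.ball (0 : Space d) (n : ℝ))ᶜ = ∅ := by
      refine eq_empty_of_forall_notMem fun q hq => ?_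
      obtain ⟨n, hn⟩ := exists_nat_gt ‖q.2‖
      exact (mem_iInter.1 hq n).2 (mem_ball_zero_iff.2 hn)
    rw [h2] at h1
    simpa using h1
  · intro m n hmn
    refine prod_mono le_rfl (compl_subset_compl.2 (Metric.ball_subset_ball ?_))
    exact_mod_cast hmn

/-- The pointwise inequality is integrated over the ball. Plancherel converts its terms to physical
space, where `-2α‖z‖₂²` from the diffusion exactly cancels `α‖z‖₂² + α‖z‖₂²` from `w` and `F`. -/
theorem ae_energyDeriv_le (hT : 0 < T) (h : IsLinearWeakSolution T z w F) {α L : ℝ} (hα : 0 < α)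
    (hL : 0 < L) {a : ℝ → ℝ} (ha : ∀ t, 1 ≤ a t)
    (hzw : ∀ᵐ q ∂(slab d T), α * z q ^ 2 ≤ z q * w q) (hw : ∀ᵐ q ∂(slab d T), |w q| ≤ L * |z q|)
    (hF : ∀ᵐ t ∂(volume.restrict (Ioo 0 T)),
      ∫ x, ‖F (t, x)‖ ^ 2 ≤ a t * ∫ x, z (t, x) ^ 2) (R : ℝ) :
    ∀ᵐ t ∂(volume.restrict (Ioo 0 T)),
      energyDeriv z w F R t ≤ 2 * tail z w R t + (L ^ 2 + a t) / α * energy z R t := by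
  filter_upwards [h.integrable_z.prod_right_ae, ae_memLp_slice h.measurable_z h.memLp_z,
    h.integrable_w.prod_right_ae, ae_memLp_slice h.measurable_w h.memLp_w, h.integrable_F,
    h.ae_memLp_F, Measure.ae_ae_of_ae_prod hzw, Measure.ae_ae_of_ae_prod hw, hF,
    (h.integrable_energyDensity hT R).prod_right_ae] with s hz1 hz2 hw1 hw2 hF1 hF2 hzw hw hF hE
  -- These weights make each of `L²‖z‖₂²/c₁` and `a‖z‖₂²/c₂` equal to `α‖z‖₂²`.
  set c₁ : ℝ := L ^ 2 / α
  set c₂ : ℝ := a s / α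
  have hc₁ : 0 < c₁ := by positivity
  have has : 0 < a s := one_pos.trans_le (ha s)
  have hc₂ : 0 < c₂ := by positivity
  have hzh : MemLp (fun ξ => hat z (s, ξ)) 2 := memLp_fourier hz1.ofReal hz2.ofReal
  have hwh : MemLp (fun ξ => hat w (s, ξ)) 2 := memLp_fourier hw1.ofReal hw2.ofReal
  have hFh : ∀ j, MemLp (𝓕 (coord (fun x => F (s, x)) j)) 2 := fun j =>
    memLp_fourier (integrable_coord hF1 j) (memLp_coord hF2 j)
  have iz : Integrable fun ξ => ‖hat z (s, ξ)‖ ^ 2 := hzh.norm.integrable_sq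
  have iw : Integrable fun ξ => ‖hat w (s, ξ)‖ ^ 2 := hwh.norm.integrable_sq
  have iF : Integrable fun ξ => ∑ j, ‖𝓕 (coord (fun x => F (s, x)) j) ξ‖ ^ 2 :=
    integrable_finsetSum _ fun j _ => (hFh j).norm.integrable_sq
  have izw : Integrable fun ξ => ((starRingEnd ℂ) (hat z (s, ξ)) * hat w (s, ξ)).re :=
    (hzh.star.integrable_mul hwh).re
  have izwn : Integrable fun ξ => ‖hat z (s, ξ)‖ * ‖hat w (s, ξ)‖ :=
    hzh.norm.integrable_mul hwh.norm
  have imz : Integrable fun ξ => resolventSymbol ξ * ‖hat z (s, ξ)‖ ^ 2 :=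
    iz.bdd_mul (c := 1) continuous_resolventSymbol.aestronglyMeasurable
      (Eventually.of_forall fun q => by
        rw [Real.norm_of_nonneg (resolventSymbol_pos _).le]; exact resolventSymbol_le_one _)
  have imE : IntegrableOn (fun ξ => resolventSymbol ξ * energyDensity z w F (s, ξ))
      (Metric.ball 0 R) :=
    hE.bdd_mul (c := 1) continuous_resolventSymbol.aestronglyMeasurable
      (Eventually.of_forall fun q => by
        rw [Real.norm_of_nonneg (resolventSymbol_pos _).le]; exact resolventSymbol_le_one _)
  -- Plancherel
  have pw : ∫ ξ, ‖hat w (s, ξ)‖ ^ 2 = ∫ x, w (s, x) ^ 2 := by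
    refine (integral_norm_sq_fourier_eq (f := fun x => (w (s, x) : ℂ)) hw1.ofReal
      hw2.ofReal).trans ?_
    simp
  have pzw : ∫ ξ, ((starRingEnd ℂ) (hat z (s, ξ)) * hat w (s, ξ)).re = ∫ x, z (s, x) * w (s, x) :=
    integral_re_conj_fourier_mul_fourier hz1 hz2 hw1 hw2
  have pF : ∫ ξ, ∑ j, ‖𝓕 (coord (fun x => F (s, x)) j) ξ‖ ^ 2 = ∫ x, ‖F (s, x)‖ ^ 2 := by
    rw [integral_finsetSum _ fun j _ => (hFh j).norm.integrable_sq]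
    simp_rw [integral_norm_sq_fourier_eq (integrable_coord hF1 _) (memLp_coord hF2 _)]
    rw [← integral_finsetSum _ fun j _ => (memLp_coord hF2 j).norm.integrable_sq]
    refine integral_congr_ae (Eventually.of_forall fun x => ?_)
    simp [coord, EuclideanSpace.norm_sq_eq]
  have jz : Integrable fun x => z (s, x) ^ 2 := hz2.integrable_sq
  have lzw : α * ∫ x, z (s, x) ^ 2 ≤ ∫ x, z (s, x) * w (s, x) := by
    rw [← integral_const_mul]
    exact integral_mono_ae (jz.const_mul α) (hz2.integrable_mul hw2) hzw
  have lw : ∫ x, w (s, x) ^ 2 ≤ L ^ 2 * ∫ x, z (s, x) ^ 2 := by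
    rw [← integral_const_mul]
    refine integral_mono_ae hw2.integrable_sq (jz.const_mul _) ?_
    filter_upwards [hw] with x hx
    rw [← sq_abs, ← sq_abs (z (s, x)), ← mul_pow]
    gcongr
  -- integration of the pointwise inequality
  have step : energyDeriv z w F R s ≤
      -2 * (∫ ξ in Metric.ball 0 R, ((starRingEnd ℂ) (hat z (s, ξ)) * hat w (s, ξ)).re)
        + (c₁ + c₂) * energy z R s + (∫ ξ in Metric.ball 0 R, ‖hat w (s, ξ)‖ ^ 2) / c₁
        + (∫ ξ in Metric.ball 0 R, ∑ j, ‖𝓕 (coord (fun x => F (s, x)) j) ξ‖ ^ 2) / c₂ := by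
    have k1 : IntegrableOn (fun ξ => -2 * ((starRingEnd ℂ) (hat z (s, ξ)) * hat w (s, ξ)).re
        + (c₁ + c₂) * (resolventSymbol ξ * ‖hat z (s, ξ)‖ ^ 2)) (Metric.ball 0 R) :=
      (izw.integrableOn.const_mul _).add (imz.integrableOn.const_mul _)
    have k2 : IntegrableOn (fun ξ => -2 * ((starRingEnd ℂ) (hat z (s, ξ)) * hat w (s, ξ)).re
        + (c₁ + c₂) * (resolventSymbol ξ * ‖hat z (s, ξ)‖ ^ 2) + ‖hat w (s, ξ)‖ ^ 2 / c₁)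
        (Metric.ball 0 R) := k1.add (iw.integrableOn.div_const _)
    unfold energyDeriv energy
    rw [← integral_const_mul, ← integral_const_mul, ← integral_div, ← integral_div,
      ← integral_add (izw.integrableOn.const_mul _) (imz.integrableOn.const_mul _),
      ← integral_add k1 (iw.integrableOn.div_const _), ← integral_add k2 (iF.integrableOn.div_const _)]
    refine integral_mono imE (k2.add (iF.integrableOn.div_const _)) fun ξ => ?_
    exact resolventSymbol_mul_re_le (fun x => w (s, x)) (fun x => F (s, x)) (hat z (s, ξ)) ξ hc₁ hc₂
  have s1 : ∫ ξ in Metric.ball 0 R, ‖hat w (s, ξ)‖ ^ 2 ≤ L ^ 2 * ∫ x, z (s, x) ^ 2 :=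
    (setIntegral_le_integral iw (Eventually.of_forall fun _ => sq_nonneg _)).trans (pw ▸ lw)
  have s2 : ∫ ξ in Metric.ball 0 R, ∑ j, ‖𝓕 (coord (fun x => F (s, x)) j) ξ‖ ^ 2
      ≤ a s * ∫ x, z (s, x) ^ 2 :=
    (setIntegral_le_integral iF (Eventually.of_forall fun _ =>
      Finset.sum_nonneg fun _ _ => sq_nonneg _)).trans (pF ▸ hF)
  -- Monotonicity of `β` gives a sign only to the integral over all frequencies; completing the
  -- truncated integral costs the tail.
  have s3 : -(∫ ξ in Metric.ball 0 R, ((starRingEnd ℂ) (hat z (s, ξ)) * hat w (s, ξ)).re)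
      ≤ -(∫ x, z (s, x) * w (s, x)) + tail z w R s := by
    rw [← pzw, ← integral_add_compl (measurableSet_ball (x := (0 : Space d)) (ε := R)) izw]
    have : ∫ ξ in (Metric.ball 0 R)ᶜ, ((starRingEnd ℂ) (hat z (s, ξ)) * hat w (s, ξ)).re
        ≤ tail z w R s := by
      refine integral_mono izw.integrableOn izwn.integrableOn fun ξ => ?_
      refine (Complex.re_le_norm _).trans (le_of_eq ?_)
      rw [norm_mul, RCLike.norm_conj]
    linarith
  have t1 : (∫ ξ in Metric.ball 0 R, ‖hat w (s, ξ)‖ ^ 2) / c₁ ≤ α * ∫ x, z (s, x) ^ 2 := by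
    rw [div_le_iff₀ hc₁]
    refine s1.trans (le_of_eq ?_)
    simp only [c₁]
    field_simp
  have t2 : (∫ ξ in Metric.ball 0 R, ∑ j, ‖𝓕 (coord (fun x => F (s, x)) j) ξ‖ ^ 2) / c₂
      ≤ α * ∫ x, z (s, x) ^ 2 := by
    rw [div_le_iff₀ hc₂]
    refine s2.trans (le_of_eq ?_)
    simp only [c₂]
    field_simp
  have hcc : c₁ + c₂ = (L ^ 2 + a s) / α := by simp only [c₁, c₂]; ring
  rw [← hcc]
  linarith

/-- Uniqueness for the linearized equation. -/
theorem ae_eq_zero (hT : 0 < T) (h : IsLinearWeakSolution T z w F) {α L : ℝ} (hα : 0 < α)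
    (hL : 0 < L) {a : ℝ → ℝ} (ha : ∀ t, 1 ≤ a t) (hai : IntegrableOn a (Ioo 0 T))
    (hzw : ∀ᵐ q ∂(slab d T), α * z q ^ 2 ≤ z q * w q) (hw : ∀ᵐ q ∂(slab d T), |w q| ≤ L * |z q|)
    (hF : ∀ᵐ t ∂(volume.restrict (Ioo 0 T)),
      ∫ x, ‖F (t, x)‖ ^ 2 ≤ a t * ∫ x, z (t, x) ^ 2) :
    ∀ᵐ q ∂(slab d T), z q = 0 := by
  set A : ℝ → ℝ := fun t => (L ^ 2 + a t) / α with hA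
  have hA0 : ∀ t, 0 ≤ A t := fun t => by
    have := ha t
    simp only [hA]
    positivity
  have hAi : IntervalIntegrable A volume 0 T := by
    rw [intervalIntegrable_iff_integrableOn_Ioo_of_le hT.le]
    exact ((integrableOn_const (by simp)).add hai).div_const α
  have bound : ∀ n : ℕ, ∀ᵐ t ∂(volume.restrict (Ioo 0 T)), energy z n t
      ≤ Real.exp (∫ s in 0..T, A s) * (2 * ∫ s in Ioo 0 T, tail z w n s) := by
    intro n
    have hψ : IntervalIntegrable (energyDeriv z w F n) volume 0 T := by
      rw [intervalIntegrable_iff_integrableOn_Ioo_of_le hT.le]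
      exact (integrable_resolventSymbol_mul (h.integrable_energyDensity hT n)).integral_prod_left
    have he : IntervalIntegrable (fun s => 2 * tail z w n s) volume 0 T := by
      rw [intervalIntegrable_iff_integrableOn_Ioo_of_le hT.le]
      exact (h.integrable_tail n).const_mul 2
    have ht0 : ∀ t, 0 ≤ 2 * tail z w n t := fun t =>
      mul_nonneg zero_le_two (integral_nonneg fun ξ => by positivity)
    have hE := h.ae_energy_eq hT n
    have hg := le_exp_mul_integral_of_deriv_le hT hψ hAi he hA0 ht0 (by
      filter_upwards [h.ae_energyDeriv_le hT hα hL ha hzw hw hF n, hE] with t h1 h2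
      rwa [h2] at h1)
    filter_upwards [hE, ae_restrict_mem measurableSet_Ioo] with t h1 h2
    rw [h1]
    refine (hg t (Ioo_subset_Icc_self h2)).trans (le_of_eq ?_)
    rw [intervalIntegral.integral_const_mul, intervalIntegral.integral_of_le hT.le (f := tail z w n),
      integral_Ioc_eq_integral_Ioo]
  have hlim : Tendsto (fun n : ℕ => Real.exp (∫ s in 0..T, A s) *
      (2 * ∫ s in Ioo 0 T, tail z w n s)) atTop (𝓝 0) := by
    simpa using (h.tendsto_integral_tail.const_mul 2).const_mul (Real.exp (∫ s in 0..T, A s))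
  refine (Measure.ae_prod_iff_ae_ae (measurableSet_eq_fun h.measurable_z measurable_const)).2 ?_
  filter_upwards [ae_all_iff.2 bound, h.integrable_z.prod_right_ae,
    ae_memLp_slice h.measurable_z h.memLp_z] with t hb hz1 hz2
  have hzh : MemLp (fun ξ => hat z (t, ξ)) 2 := memLp_fourier hz1.ofReal hz2.ofReal
  have imz : Integrable fun ξ => resolventSymbol ξ * ‖hat z (t, ξ)‖ ^ 2 :=
    hzh.norm.integrable_sq.bdd_mul (c := 1) continuous_resolventSymbol.aestronglyMeasurable
      (Eventually.of_forall fun q => by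
        rw [Real.norm_of_nonneg (resolventSymbol_pos _).le]; exact resolventSymbol_le_one _)
  have hnn : ∀ ξ, 0 ≤ resolventSymbol ξ * ‖hat z (t, ξ)‖ ^ 2 := fun ξ =>
    mul_nonneg (resolventSymbol_pos ξ).le (sq_nonneg _)
  -- The truncated energies increase with the radius, so the one at `N` is below the Grönwall bound
  -- at every `n ≥ N`, and that bound tends to zero.
  have hzero : ∀ N : ℕ, energy z N t = 0 := fun N => by
    refine le_antisymm (ge_of_tendsto hlim ?_) (integral_nonneg hnn)
    filter_upwards [eventually_ge_atTop N] with n hn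
    refine le_trans ?_ (hb n)
    refine setIntegral_mono_set imz.integrableOn (Eventually.of_forall hnn)
      (Metric.ball_subset_ball ?_).eventuallyLE
    exact_mod_cast hn
  have hhat : ∀ᵐ ξ, hat z (t, ξ) = 0 := by
    have : ∀ᵐ ξ, ∀ N : ℕ, ξ ∈ Metric.ball (0 : Space d) N → hat z (t, ξ) = 0 := by
      rw [ae_all_iff]
      intro N
      have h0 := (setIntegral_eq_zero_iff_of_nonneg_ae (Eventually.of_forall hnn)
        imz.integrableOn).1 (hzero N)
      filter_upwards [(ae_restrict_iff' measurableSet_ball).1 h0] with ξ hξ hξ'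
      have := hξ hξ'
      simpa [(resolventSymbol_pos ξ).ne'] using this
    filter_upwards [this] with ξ hξ
    obtain ⟨n, hn⟩ := exists_nat_gt ‖ξ‖
    exact hξ n (mem_ball_zero_iff.2 hn)
  have hp := integral_norm_sq_fourier_eq (f := fun x => (z (t, x) : ℂ)) hz1.ofReal hz2.ofReal
  have hp0 : ∫ ξ, ‖𝓕 (fun x => (z (t, x) : ℂ)) ξ‖ ^ 2 = 0 := by
    rw [← integral_zero (Space d) ℝ]
    refine integral_congr_ae ?_
    filter_upwards [hhat] with ξ hξ
    have : 𝓕 (fun x => (z (t, x) : ℂ)) ξ = 0 := hξ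
    simp [this]
  rw [hp0] at hp
  have hz0 := (integral_eq_zero_iff_of_nonneg (fun x => sq_nonneg _)
    (hz2.ofReal (K := ℂ)).norm.integrable_sq).1 hp.symm
  filter_upwards [hz0] with x hx
  simpa using hx

end IsLinearWeakSolution

end NFPE
end

/-! ### Estimates of the flux at a fixed time -/

noncomputable section

namespace NFPE

variable {d : ℕ}

/-- Interpolation: `|f|² ≤ ‖f‖_∞^(2-p) |f|^p`. It serves both for the kernel away from the origin
and for the solutions. -/
theorem memLp_two_of_memLp_of_memLp_top {X V : Type*} [MeasurableSpace X] {μ : Measure X}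
    [NormedAddCommGroup V] {f : X → V} {p : ℝ≥0∞} (hp1 : 1 ≤ p) (hp2 : p ≤ 2) (h : MemLp f p μ)
    (h' : MemLp f ⊤ μ) : MemLp f 2 μ := by
  have hp0 : p ≠ 0 := (zero_lt_one.trans_le hp1).ne'
  have hpt : p ≠ (⊤ : ℝ≥0∞) := (hp2.trans_lt (by norm_num)).ne
  set r := p.toReal with hr
  have hr2 : r ≤ 2 := by simpa [hr] using ENNReal.toReal_mono (by norm_num) hp2
  have hr0 : 0 ≤ r := ENNReal.toReal_nonneg
  refine memLp_two_of_lintegral_lt_top h.1 ?_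
  have hfin : ∫⁻ x, ‖f x‖ₑ ^ r ∂μ < ⊤ :=
    lintegral_rpow_enorm_lt_top_of_eLpNorm_lt_top hp0 hpt h.2
  have hb : ∀ᵐ x ∂μ, ‖f x‖ₑ ≤ eLpNorm f ⊤ μ := by
    rw [eLpNorm_exponent_top]
    exact ae_le_eLpNormEssSup
  calc ∫⁻ x, ‖f x‖ₑ ^ 2 ∂μ ≤ ∫⁻ x, (eLpNorm f ⊤ μ) ^ (2 - r) * ‖f x‖ₑ ^ r ∂μ := by
        refine lintegral_mono_ae ?_
        filter_upwards [hb] with x hx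
        calc ‖f x‖ₑ ^ 2 = ‖f x‖ₑ ^ ((2 - r) + r) := by
              rw [sub_add_cancel]; exact (ENNReal.rpow_two _).symm
          _ = ‖f x‖ₑ ^ (2 - r) * ‖f x‖ₑ ^ r :=
              ENNReal.rpow_add_of_nonneg _ _ (by linarith) hr0
          _ ≤ _ := by
              gcongr
    _ < ⊤ := by
        rw [lintegral_const_mul' _ _ (ENNReal.rpow_lt_top_of_nonneg (by linarith) h'.2.ne).ne]
        exact ENNReal.mul_lt_top (ENNReal.rpow_lt_top_of_nonneg (by linarith) h'.2.ne) hfin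

theorem enn_add_add_sq_le (a b c : ℝ≥0∞) : (a + b + c) ^ 2 ≤ 3 * (a ^ 2 + b ^ 2 + c ^ 2) := by
  rcases eq_or_ne a ⊤ with rfl | ha
  · simp
  rcases eq_or_ne b ⊤ with rfl | hb
  · simp
  rcases eq_or_ne c ⊤ with rfl | hc
  · simp
  lift a to NNReal using ha
  lift b to NNReal using hb
  lift c to NNReal using hc
  norm_cast
  rw [← NNReal.coe_le_coe]
  push_cast
  nlinarith [sq_nonneg ((a : ℝ) - b), sq_nonneg ((b : ℝ) - c), sq_nonneg ((a : ℝ) - c)]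

theorem enn_add_sq_le (a b : ℝ≥0∞) : (a + b) ^ 2 ≤ 2 * (a ^ 2 + b ^ 2) := by
  rcases eq_or_ne a ⊤ with rfl | ha
  · simp
  rcases eq_or_ne b ⊤ with rfl | hb
  · simp
  lift a to NNReal using ha
  lift b to NNReal using hb
  norm_cast
  rw [← NNReal.coe_le_coe]
  push_cast
  nlinarith [sq_nonneg ((a : ℝ) - b)]

theorem exists_lipschitz_of_contDiff {f : ℝ → ℝ} (hf : ContDiff ℝ 1 f) (M : ℝ) :
    ∃ L : ℝ, 0 < L ∧ ∀ r s, |r| ≤ M → |s| ≤ M → |f r - f s| ≤ L * |r - s| := by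
  obtain ⟨L, hL⟩ := hf.locallyLipschitz.locallyLipschitzOn.exists_lipschitzOnWith_of_compact
    (isCompact_Icc (a := -M) (b := M))
  refine ⟨L + 1, by positivity, fun r s hr hs => ?_⟩
  have := hL.dist_le_mul r (abs_le.1 hr) s (abs_le.1 hs)
  rw [Real.dist_eq, Real.dist_eq] at this
  nlinarith [abs_nonneg (r - s)]

/-- The flux of a function of space only. -/
def sliceFlux (b : ℝ → ℝ) (D K : Space d → Space d) (v : Space d → ℝ) (x : Space d) : Space d :=
  v x • (b (v x) • D x + convolution v K (ContinuousLinearMap.lsmul ℝ ℝ) volume x)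

/-! ### Convolution with a kernel in `L¹ + L²`. -/

section Convolution

variable {K K₁ K₂ : Space d → Space d} {v : Space d → ℝ}

theorem aemeasurable_sub_left {V : Type*} [NormedAddCommGroup V] {f : Space d → V}
    (hf : AEStronglyMeasurable f) (x : Space d) :
    AEMeasurable (fun y => ‖f (x - y)‖ₑ) :=
  (hf.comp_quasiMeasurePreserving (quasiMeasurePreserving_sub_left volume x)).enorm

/-- Cauchy–Schwarz and translation invariance; the bound is uniform in `x`. -/
theorem lintegral_mul_sub_left_le (hv : AEStronglyMeasurable v) (hK₂ : MemLp K₂ 2) (x : Space d) :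
    (∫⁻ y, ‖v y‖ₑ * ‖K₂ (x - y)‖ₑ) ^ 2 ≤ (∫⁻ y, ‖v y‖ₑ ^ 2) * ∫⁻ y, ‖K₂ y‖ₑ ^ 2 := by
  have h := ENNReal.lintegral_mul_le_Lp_mul_Lq (volume : Measure (Space d))
    Real.HolderConjugate.two_two hv.enorm (aemeasurable_sub_left hK₂.1 x)
  have e : ∫⁻ y, ‖K₂ (x - y)‖ₑ ^ 2 = ∫⁻ y, ‖K₂ y‖ₑ ^ 2 :=
    lintegral_sub_left_eq_self (fun y => ‖K₂ y‖ₑ ^ 2) x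
  simp only [Pi.mul_apply, ENNReal.rpow_two] at h
  rw [e] at h
  refine (pow_le_pow_left' h 2).trans (le_of_eq ?_)
  rw [mul_pow, ← ENNReal.rpow_natCast, ← ENNReal.rpow_natCast, ← ENNReal.rpow_mul,
    ← ENNReal.rpow_mul]
  norm_num

theorem lintegral_mul_sub_left_le_of_bound (hK₁ : Integrable K₁)
    {M : ℝ≥0∞} (hM : ∀ᵐ y, ‖v y‖ₑ ≤ M) (x : Space d) :
    ∫⁻ y, ‖v y‖ₑ * ‖K₁ (x - y)‖ₑ ≤ M * ∫⁻ y, ‖K₁ y‖ₑ := by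
  have e : ∫⁻ y, ‖K₁ (x - y)‖ₑ = ∫⁻ y, ‖K₁ y‖ₑ :=
    lintegral_sub_left_eq_self (fun y => ‖K₁ y‖ₑ) x
  rw [← e, ← lintegral_const_mul'' _ (aemeasurable_sub_left hK₁.1 x)]
  refine lintegral_mono_ae ?_
  filter_upwards [hM] with y hy
  gcongr

theorem aemeasurable_convolution_integrand {V W : Type*} [NormedAddCommGroup V]
    [NormedAddCommGroup W] {f : Space d → V} {g : Space d → W} (hf : AEStronglyMeasurable f)
    (hg : AEStronglyMeasurable g) :
    AEMeasurable (fun p : Space d × Space d => ‖f p.2‖ₑ * ‖g (p.1 - p.2)‖ₑ)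
      ((volume : Measure (Space d)).prod volume) :=
  hf.comp_snd.enorm.mul
    (hg.comp_quasiMeasurePreserving
      (quasiMeasurePreserving_sub_of_right_invariant volume volume)).enorm

/-- Young's inequality `‖K * v‖₂ ≤ ‖K‖₁ ‖v‖₂`. -/
theorem lintegral_sq_convolution_le (hv : AEStronglyMeasurable v) (hK₁ : Integrable K₁) :
    ∫⁻ x, (∫⁻ y, ‖v y‖ₑ * ‖K₁ (x - y)‖ₑ) ^ 2 ≤ (∫⁻ y, ‖K₁ y‖ₑ) ^ 2 * ∫⁻ y, ‖v y‖ₑ ^ 2 := by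
  have hk : ∀ x, ∫⁻ y, ‖K₁ (x - y)‖ₑ = ∫⁻ y, ‖K₁ y‖ₑ := fun x =>
    lintegral_sub_left_eq_self (fun y => ‖K₁ y‖ₑ) x
  have hfin : ∫⁻ y, ‖K₁ y‖ₑ ≠ ⊤ := hK₁.2.ne
  have step : ∀ x, (∫⁻ y, ‖v y‖ₑ * ‖K₁ (x - y)‖ₑ) ^ 2
      ≤ (∫⁻ y, ‖K₁ y‖ₑ) * ∫⁻ y, ‖v y‖ₑ ^ 2 * ‖K₁ (x - y)‖ₑ := by
    intro x
    have hm := aemeasurable_sub_left hK₁.1 x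
    -- Cauchy–Schwarz for `|K₁|^(1/2)` against `|v||K₁|^(1/2)`, leaving one factor `|K₁|` with
    -- `|v|²` for Tonelli.
    have h := ENNReal.lintegral_mul_le_Lp_mul_Lq (volume : Measure (Space d))
      Real.HolderConjugate.two_two (hm.pow_const (1 / 2 : ℝ))
      (hv.enorm.mul (hm.pow_const (1 / 2 : ℝ)))
    have hsq : ∀ a : ℝ≥0∞, a ^ (1 / 2 : ℝ) * a ^ (1 / 2 : ℝ) = a := fun a => by
      rw [← ENNReal.rpow_add_of_nonneg _ _ (by norm_num) (by norm_num)]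
      norm_num
    have e1 : ∀ y, ((fun y => ‖K₁ (x - y)‖ₑ ^ (1 / 2 : ℝ)) *
        ((fun y => ‖v y‖ₑ) * fun y => ‖K₁ (x - y)‖ₑ ^ (1 / 2 : ℝ))) y
        = ‖v y‖ₑ * ‖K₁ (x - y)‖ₑ := fun y => by
      simp only [Pi.mul_apply]
      rw [mul_left_comm, hsq]
    have e2 : ∀ y, (‖K₁ (x - y)‖ₑ ^ (1 / 2 : ℝ)) ^ (2 : ℝ) = ‖K₁ (x - y)‖ₑ := fun y => by
      rw [ENNReal.rpow_two, sq, hsq]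
    have e3 : ∀ y, (((fun y => ‖v y‖ₑ) * fun y => ‖K₁ (x - y)‖ₑ ^ (1 / 2 : ℝ)) y) ^ (2 : ℝ)
        = ‖v y‖ₑ ^ 2 * ‖K₁ (x - y)‖ₑ := fun y => by
      rw [Pi.mul_apply, ENNReal.rpow_two, mul_pow, sq (‖K₁ (x - y)‖ₑ ^ (1 / 2 : ℝ)), hsq]
    simp only [e1, e2, e3, hk] at h
    refine (pow_le_pow_left' h 2).trans (le_of_eq ?_)
    rw [mul_pow, sq (_ ^ (1 / 2 : ℝ)), hsq, sq (_ ^ (1 / 2 : ℝ)), hsq]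
  refine (lintegral_mono step).trans ?_
  rw [lintegral_const_mul' _ _ hfin, lintegral_lintegral_swap]
  · have e4 : ∀ y, ∫⁻ x, ‖v y‖ₑ ^ 2 * ‖K₁ (x - y)‖ₑ = ‖v y‖ₑ ^ 2 * ∫⁻ y, ‖K₁ y‖ₑ := fun y => by
      rw [lintegral_const_mul' _ _ (by simp), lintegral_sub_right_eq_self (fun x => ‖K₁ x‖ₑ) y]
    simp only [e4]
    rw [lintegral_mul_const' _ _ hfin, sq, mul_assoc, mul_comm (∫⁻ y, ‖v y‖ₑ ^ 2)]
  · exact (hv.comp_snd.enorm.pow_const 2).mul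
      (hK₁.1.comp_quasiMeasurePreserving
        (quasiMeasurePreserving_sub_of_right_invariant volume volume)).enorm

theorem lintegral_convolution_integrand_le (hK : ∀ x, K x = K₁ x + K₂ x)
    (hv : AEStronglyMeasurable v) (hK₁ : Integrable K₁) (x : Space d) :
    ∫⁻ y, ‖v y • K (x - y)‖ₑ
      ≤ (∫⁻ y, ‖v y‖ₑ * ‖K₁ (x - y)‖ₑ) + ∫⁻ y, ‖v y‖ₑ * ‖K₂ (x - y)‖ₑ := by
  have m : AEMeasurable (fun y => ‖v y‖ₑ * ‖K₁ (x - y)‖ₑ) volume :=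
    hv.enorm.mul (aemeasurable_sub_left hK₁.1 x)
  rw [← lintegral_add_left' m]
  refine lintegral_mono fun y => ?_
  rw [enorm_smul, hK, ← mul_add]
  gcongr
  exact enorm_add_le _ _

/-- Convergence of the convolution integral at every point, which makes the convolution additive on
the functions in question. -/
theorem integrable_convolution_integrand (hK : ∀ x, K x = K₁ x + K₂ x)
    (hv : AEStronglyMeasurable v) (hK₁ : Integrable K₁) (hK₂ : MemLp K₂ 2) {M : ℝ≥0∞}
    (hMt : M ≠ ⊤) (hM : ∀ᵐ y, ‖v y‖ₑ ≤ M) (hv2 : ∫⁻ y, ‖v y‖ₑ ^ 2 < ⊤) (x : Space d) :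
    Integrable fun y => v y • K (x - y) := by
  have hKm : AEStronglyMeasurable K := by
    have : K = K₁ + K₂ := funext hK
    rw [this]
    exact hK₁.1.add hK₂.1
  refine ⟨hv.smul (hKm.comp_quasiMeasurePreserving (quasiMeasurePreserving_sub_left volume x)), ?_⟩
  refine (lintegral_convolution_integrand_le hK hv hK₁ x).trans_lt (ENNReal.add_lt_top.2 ⟨?_, ?_⟩)
  · exact (lintegral_mul_sub_left_le_of_bound hK₁ hM x).trans_lt
      (ENNReal.mul_lt_top hMt.lt_top hK₁.2)
  · have h := lintegral_mul_sub_left_le hv hK₂ x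
    by_contra hne
    rw [not_lt_top_iff] at hne
    rw [hne] at h
    have hk2 : ∫⁻ y, ‖K₂ y‖ₑ ^ 2 < ⊤ := by
      rw [lintegral_enorm_sq_eq]; exact ENNReal.pow_lt_top hK₂.2
    exact absurd (ENNReal.mul_lt_top hv2 hk2) (by simpa using h)

/-- The `L²` part of the kernel is estimated at once, uniformly in `x`. The `L¹` part stays a
function of `x`, since it is needed once in `L^∞` (for a bounded `v`) and once in `L²` (for the
difference). -/
theorem enorm_sq_convolution_le (hK : ∀ x, K x = K₁ x + K₂ x)
    (hv : AEStronglyMeasurable v) (hK₁ : Integrable K₁) (hK₂ : MemLp K₂ 2) (x : Space d) :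
    ‖convolution v K (ContinuousLinearMap.lsmul ℝ ℝ) volume x‖ₑ ^ 2
      ≤ 2 * ((∫⁻ y, ‖v y‖ₑ * ‖K₁ (x - y)‖ₑ) ^ 2
        + (∫⁻ y, ‖v y‖ₑ ^ 2) * ∫⁻ y, ‖K₂ y‖ₑ ^ 2) := by
  have h1 : ‖convolution v K (ContinuousLinearMap.lsmul ℝ ℝ) volume x‖ₑ
      ≤ (∫⁻ y, ‖v y‖ₑ * ‖K₁ (x - y)‖ₑ) + ∫⁻ y, ‖v y‖ₑ * ‖K₂ (x - y)‖ₑ :=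
    (enorm_integral_le_lintegral_enorm _).trans (lintegral_convolution_integrand_le hK hv hK₁ x)
  refine (pow_le_pow_left' h1 2).trans ?_
  refine (enn_add_sq_le _ _).trans ?_
  gcongr
  exact lintegral_mul_sub_left_le hv hK₂ x

end Convolution

/-! ### Lipschitz and integrability bounds for the flux at a fixed time. -/

section SliceFlux

variable {K K₁ K₂ D : Space d → Space d} {b : ℝ → ℝ} {v₁ v₂ : Space d → ℝ}

/-- The difference splits as `(b(v₁)v₁ - b(v₂)v₂) D + (v₁ - v₂)(K * v₁) + v₂ (K * (v₁ - v₂))`. In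
the first two terms the factor of the difference is bounded. In the third, the `K₁` part uses `|v₂|
≤ M` and Young's inequality, while the `K₂` part is bounded uniformly in `x` and `v₂` is taken in
`L²`. -/
theorem lintegral_sq_sliceFlux_sub_le (hK : ∀ x, K x = K₁ x + K₂ x)
    (hK₁ : Integrable K₁) (hK₂ : MemLp K₂ 2) {M B C : ℝ} (hB : 0 ≤ B)
    (hD : ∀ᵐ x, ‖D x‖ ≤ C)
    (hb : ∀ r s, |r| ≤ M → |s| ≤ M → |b r * r - b s * s| ≤ B * |r - s|)
    (hv₁ : AEStronglyMeasurable v₁) (hv₂ : AEStronglyMeasurable v₂)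
    (hM₁ : ∀ᵐ x, |v₁ x| ≤ M) (hM₂ : ∀ᵐ x, |v₂ x| ≤ M)
    (hn₁ : ∫⁻ y, ‖v₁ y‖ₑ ^ 2 < ⊤) (hn₂ : ∫⁻ y, ‖v₂ y‖ₑ ^ 2 < ⊤) :
    ∫⁻ x, ‖sliceFlux b D K v₁ x - sliceFlux b D K v₂ x‖ₑ ^ 2
      ≤ 3 * (ENNReal.ofReal (B * C) ^ 2 + 4 * (ENNReal.ofReal M * ∫⁻ y, ‖K₁ y‖ₑ) ^ 2
        + 2 * ((∫⁻ y, ‖v₁ y‖ₑ ^ 2) + ∫⁻ y, ‖v₂ y‖ₑ ^ 2) * ∫⁻ y, ‖K₂ y‖ₑ ^ 2)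
        * ∫⁻ x, ‖v₁ x - v₂ x‖ₑ ^ 2 := by
  set k₁ := ∫⁻ y, ‖K₁ y‖ₑ
  set k₂ := ∫⁻ y, ‖K₂ y‖ₑ ^ 2 with hk₂
  set N₁ := ∫⁻ y, ‖v₁ y‖ₑ ^ 2 with hN₁
  set N₂ := ∫⁻ y, ‖v₂ y‖ₑ ^ 2 with hN₂
  set N := ∫⁻ y, ‖v₁ y - v₂ y‖ₑ ^ 2 with hN
  set μM := ENNReal.ofReal M
  have hk₁t : k₁ ≠ ⊤ := hK₁.2.ne
  have hk₂t : k₂ ≠ ⊤ := by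
    rw [hk₂, lintegral_enorm_sq_eq]; exact (ENNReal.pow_lt_top hK₂.2).ne
  have hv : AEStronglyMeasurable (fun x => v₁ x - v₂ x) := hv₁.sub hv₂
  have eM : ∀ {v : Space d → ℝ}, (∀ᵐ x, |v x| ≤ M) → ∀ᵐ x, ‖v x‖ₑ ≤ μM := fun h => by
    filter_upwards [h] with x hx
    rw [← ofReal_norm]
    exact ENNReal.ofReal_le_ofReal hx
  set Y : Space d → ℝ≥0∞ := fun x => ∫⁻ y, ‖v₁ y - v₂ y‖ₑ * ‖K₁ (x - y)‖ₑ with hY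
  have hYm : AEMeasurable Y volume :=
    (aemeasurable_convolution_integrand hv hK₁.1).lintegral_prod_right'
  have hYY : ∫⁻ x, Y x ^ 2 ≤ k₁ ^ 2 * N := lintegral_sq_convolution_le hv hK₁
  -- the difference of the convolutions
  have hconv : ∀ x, convolution v₁ K (ContinuousLinearMap.lsmul ℝ ℝ) volume x
      - convolution v₂ K (ContinuousLinearMap.lsmul ℝ ℝ) volume x
      = convolution (fun x => v₁ x - v₂ x) K (ContinuousLinearMap.lsmul ℝ ℝ) volume x := fun x => by
    simp only [convolution_lsmul]
    rw [← integral_sub (integrable_convolution_integrand hK hv₁ hK₁ hK₂ ENNReal.ofReal_ne_top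
      (eM hM₁) hn₁ x) (integrable_convolution_integrand hK hv₂ hK₁ hK₂ ENNReal.ofReal_ne_top
      (eM hM₂) hn₂ x)]
    simp only [sub_smul]
  have point : ∀ᵐ x, ‖sliceFlux b D K v₁ x - sliceFlux b D K v₂ x‖ₑ ^ 2
      ≤ 3 * ((ENNReal.ofReal (B * C) ^ 2 + 2 * ((μM * k₁) ^ 2 + N₁ * k₂)) * ‖v₁ x - v₂ x‖ₑ ^ 2
        + 2 * (μM ^ 2 * Y x ^ 2) + 2 * (N * k₂) * ‖v₂ x‖ₑ ^ 2) := by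
    filter_upwards [hD, hM₁, hM₂, eM hM₂] with x hDx h1 h2 h2e
    have hC : 0 ≤ C := (norm_nonneg _).trans hDx
    set c₁ := convolution v₁ K (ContinuousLinearMap.lsmul ℝ ℝ) volume x with hc₁
    set c₂ := convolution v₂ K (ContinuousLinearMap.lsmul ℝ ℝ) volume x with hc₂
    have e : sliceFlux b D K v₁ x - sliceFlux b D K v₂ x
        = (b (v₁ x) * v₁ x - b (v₂ x) * v₂ x) • D x + (v₁ x - v₂ x) • c₁ + v₂ x • (c₁ - c₂) := by
      simp only [sliceFlux, ← hc₁, ← hc₂]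
      module
    have a1 : ‖(b (v₁ x) * v₁ x - b (v₂ x) * v₂ x) • D x‖ₑ ^ 2
        ≤ ENNReal.ofReal (B * C) ^ 2 * ‖v₁ x - v₂ x‖ₑ ^ 2 := by
      rw [← mul_pow]
      refine pow_le_pow_left' ?_ 2
      rw [← ofReal_norm, ← ofReal_norm, ← ENNReal.ofReal_mul (by positivity), norm_smul]
      refine ENNReal.ofReal_le_ofReal ?_
      calc _ ≤ (B * |v₁ x - v₂ x|) * C :=
            mul_le_mul (hb _ _ h1 h2) hDx (norm_nonneg _) (by positivity)
        _ = _ := by rw [Real.norm_eq_abs]; ring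
    have a2 : ‖(v₁ x - v₂ x) • c₁‖ₑ ^ 2
        ≤ 2 * ((μM * k₁) ^ 2 + N₁ * k₂) * ‖v₁ x - v₂ x‖ₑ ^ 2 := by
      rw [enorm_smul, mul_pow, mul_comm]
      gcongr
      refine (enorm_sq_convolution_le hK hv₁ hK₁ hK₂ x).trans ?_
      gcongr
      exact lintegral_mul_sub_left_le_of_bound hK₁ (eM hM₁) x
    have a3 : ‖v₂ x • (c₁ - c₂)‖ₑ ^ 2 ≤ 2 * (μM ^ 2 * Y x ^ 2) + 2 * (N * k₂) * ‖v₂ x‖ₑ ^ 2 := by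
      rw [enorm_smul, mul_pow, hc₁, hc₂, hconv]
      calc _ ≤ ‖v₂ x‖ₑ ^ 2 * (2 * (Y x ^ 2 + N * k₂)) := by
            gcongr
            exact enorm_sq_convolution_le hK hv hK₁ hK₂ x
        _ = 2 * (‖v₂ x‖ₑ ^ 2 * Y x ^ 2) + 2 * (N * k₂) * ‖v₂ x‖ₑ ^ 2 := by ring
        _ ≤ _ := by gcongr
    rw [e]
    calc _ ≤ (‖(b (v₁ x) * v₁ x - b (v₂ x) * v₂ x) • D x‖ₑ + ‖(v₁ x - v₂ x) • c₁‖ₑ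
          + ‖v₂ x • (c₁ - c₂)‖ₑ) ^ 2 := by
          gcongr
          exact (enorm_add_le _ _).trans (add_le_add_left (enorm_add_le _ _) _)
      _ ≤ _ := (enn_add_add_sq_le _ _ _).trans (by
          gcongr 3 * ?_
          refine (add_le_add (add_le_add a1 a2) a3).trans (le_of_eq ?_)
          ring)
  refine (lintegral_mono_ae point).trans ?_
  rw [lintegral_const_mul' _ _ (by norm_num)]
  have m1 : AEMeasurable (fun x => (ENNReal.ofReal (B * C) ^ 2 + 2 * ((μM * k₁) ^ 2 + N₁ * k₂))
      * ‖v₁ x - v₂ x‖ₑ ^ 2) volume := (hv.enorm.pow_const 2).const_mul _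
  have m2 : AEMeasurable (fun x => 2 * (μM ^ 2 * Y x ^ 2)) volume :=
    ((hYm.pow_const 2).const_mul _).const_mul _
  have m12 : AEMeasurable (fun x => (ENNReal.ofReal (B * C) ^ 2 + 2 * ((μM * k₁) ^ 2 + N₁ * k₂))
      * ‖v₁ x - v₂ x‖ₑ ^ 2 + 2 * (μM ^ 2 * Y x ^ 2)) volume := m1.add m2
  rw [lintegral_add_left' m12, lintegral_add_left' m1,
    lintegral_const_mul'' _ (hv.enorm.pow_const 2), lintegral_const_mul'' _ (hv₂.enorm.pow_const 2),
    lintegral_const_mul'' _ ((hYm.pow_const 2).const_mul _),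
    lintegral_const_mul'' _ (hYm.pow_const 2), ← hN, ← hN₂]
  calc _ ≤ 3 * ((ENNReal.ofReal (B * C) ^ 2 + 2 * ((μM * k₁) ^ 2 + N₁ * k₂)) * N
        + 2 * (μM ^ 2 * (k₁ ^ 2 * N)) + 2 * (N * k₂) * N₂) := by gcongr
    _ = _ := by ring

/-- The velocity `b(v)D + K * v` is essentially bounded, so the flux is dominated by a multiple of
`|v|`. The inequality `y ≤ 1 + y²` lets the squared convolution bound be reused. -/
theorem integrable_sliceFlux (hK : ∀ x, K x = K₁ x + K₂ x)
    (hK₁ : Integrable K₁) (hK₂ : MemLp K₂ 2) {M B C : ℝ}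
    (hD : ∀ᵐ x, ‖D x‖ ≤ C) (hb : ∀ r, |r| ≤ M → |b r| ≤ B)
    (hm : AEStronglyMeasurable (sliceFlux b D K v₁)) (hv₁ : Integrable v₁)
    (hM₁ : ∀ᵐ x, |v₁ x| ≤ M) (hn₁ : ∫⁻ y, ‖v₁ y‖ₑ ^ 2 < ⊤) :
    Integrable (sliceFlux b D K v₁) := by
  set S : ℝ≥0∞ := 2 * ((ENNReal.ofReal M * ∫⁻ y, ‖K₁ y‖ₑ) ^ 2
        + (∫⁻ y, ‖v₁ y‖ₑ ^ 2) * ∫⁻ y, ‖K₂ y‖ₑ ^ 2) with hS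
  have hk₂t : ∫⁻ y, ‖K₂ y‖ₑ ^ 2 < ⊤ := by
    rw [lintegral_enorm_sq_eq]; exact ENNReal.pow_lt_top hK₂.2
  have hSt : S < ⊤ :=
    ENNReal.mul_lt_top (by simp) (ENNReal.add_lt_top.2
      ⟨ENNReal.pow_lt_top (ENNReal.mul_lt_top ENNReal.ofReal_lt_top hK₁.2),
        ENNReal.mul_lt_top hn₁ hk₂t⟩)
  have eM : ∀ᵐ x, ‖v₁ x‖ₑ ≤ ENNReal.ofReal M := by
    filter_upwards [hM₁] with x hx
    rw [← ofReal_norm]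
    exact ENNReal.ofReal_le_ofReal hx
  refine ⟨hm, ?_⟩
  have point : ∀ᵐ x, ‖sliceFlux b D K v₁ x‖ₑ ≤ (ENNReal.ofReal (B * C) + (1 + S)) * ‖v₁ x‖ₑ := by
    filter_upwards [hD, hM₁] with x hDx h1
    have hC : 0 ≤ C := (norm_nonneg _).trans hDx
    have hB : 0 ≤ B := (abs_nonneg _).trans (hb _ h1)
    rw [sliceFlux, enorm_smul, mul_comm]
    gcongr
    refine (enorm_add_le _ _).trans (add_le_add ?_ ?_)
    · rw [← ofReal_norm, norm_smul]
      exact ENNReal.ofReal_le_ofReal (mul_le_mul (hb _ h1) hDx (norm_nonneg _) hB)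
    · set y := ‖convolution v₁ K (ContinuousLinearMap.lsmul ℝ ℝ) volume x‖ₑ with hy
      have hle : y ≤ 1 + y ^ 2 := by
        rcases le_total y 1 with ha | ha
        · exact ha.trans le_self_add
        · exact (le_self_pow₀ ha two_ne_zero).trans le_add_self
      refine hle.trans ?_
      gcongr
      refine (enorm_sq_convolution_le hK hv₁.1 hK₁ hK₂ x).trans ?_
      rw [hS]
      gcongr
      exact lintegral_mul_sub_left_le_of_bound hK₁ eM x
  refine (lintegral_mono_ae point).trans_lt ?_
  rw [lintegral_const_mul'' _ hv₁.1.enorm]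
  exact ENNReal.mul_lt_top (by simp [hSt]) hv₁.2

end SliceFlux

end NFPE
end

/-! ### Integrated form of the weak formulation -/

noncomputable section

namespace NFPE

open Laplacian

/-- A weak solution of `p' = q`, `p(0) = c` on an interval is a primitive of `q`. -/
theorem ae_eq_primitive_of_weak {T : ℝ} {p q : ℝ → ℝ} {c : ℝ} (hT : 0 < T)
    (hp : IntegrableOn p (Ioo 0 T)) (hq : IntegrableOn q (Ioo 0 T))
    (h : ∀ θ : ℝ → ℝ, ContDiff ℝ ∞ θ → HasCompactSupport θ → tsupport θ ⊆ Iio T →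
      (∫ t in Ioo 0 T, (p t * deriv θ t + q t * θ t)) + θ 0 * c = 0) :
    ∀ᵐ t ∂(volume.restrict (Ioo 0 T)), p t = c + ∫ s in 0..t, q s := by
  have hq' : IntervalIntegrable q volume 0 T := by
    rw [intervalIntegrable_iff_integrableOn_Ioo_of_le hT.le]
    exact hq
  set Q : ℝ → ℝ := fun t => ∫ s in 0..t, q s with hQ
  have hQac : AbsolutelyContinuousOnInterval Q 0 T :=
    hq'.absolutelyContinuousOnInterval_intervalIntegral (by simp)
  have hQc : ContinuousOn Q (Icc 0 T) := by
    have := hQac.continuousOn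
    rwa [uIcc_of_le hT.le] at this
  have hQi : IntegrableOn Q (Ioo 0 T) :=
    (hQc.integrableOn_compact isCompact_Icc).mono_set Ioo_subset_Icc_self
  have hloc : IntegrableOn (fun t => p t - (c + Q t)) (Ioo 0 T) :=
    hp.sub ((integrableOn_const (by simp)).add hQi)
  suffices hs : ∀ᵐ t, t ∈ Ioo 0 T → p t - (c + Q t) = 0 by
    rw [ae_restrict_iff' measurableSet_Ioo]
    filter_upwards [hs] with t ht hm
    exact sub_eq_zero.1 (ht hm)
  refine isOpen_Ioo.ae_eq_zero_of_integral_contDiff_smul_eq_zero hloc.locallyIntegrableOn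
    fun η hη hηc hηs => ?_
  have hηcont : Continuous η := hη.continuous
  obtain ⟨s, hsT, hs⟩ : ∃ s < T, ∀ t, s < t → η t = 0 := by
    rcases (tsupport η).eq_empty_or_nonempty with he | hne
    · exact ⟨0, hT, fun t _ => image_eq_zero_of_notMem_tsupport (by simp [he])⟩
    · obtain ⟨s, hs⟩ := hηc.isCompact.exists_isGreatest hne
      exact ⟨s, (hηs hs.1).2, fun t ht => image_eq_zero_of_notMem_tsupport fun hm =>
        absurd (hs.2 hm) (not_le.2 ht)⟩
  -- The primitive of `η` normalised to vanish at `T`, hence after the support of `η`.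
  set E : ℝ → ℝ := fun t => (∫ s in 0..t, η s) - ∫ s in 0..T, η s with hE
  have hEd : ∀ t, HasDerivAt E (η t) t := fun t =>
    (intervalIntegral.integral_hasDerivAt_right (hηcont.intervalIntegrable _ _)
      hηcont.aestronglyMeasurable.stronglyMeasurableAtFilter hηcont.continuousAt).sub_const _
  have hE' : deriv E = η := funext fun t => (hEd t).deriv
  have hEs : ContDiff ℝ ∞ E := by
    rw [contDiff_infty_iff_deriv, hE']
    exact ⟨fun t => (hEd t).differentiableAt, hη⟩
  have hE0 : ∀ t, s < t → E t = 0 := fun t ht => by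
    have : E t = -∫ r in t..T, η r := by
      have := intervalIntegral.integral_add_adjacent_intervals (μ := volume)
        (hηcont.intervalIntegrable 0 t) (hηcont.intervalIntegrable t T)
      simp only [hE]
      linarith
    rw [this, neg_eq_zero]
    refine intervalIntegral.integral_zero_ae (Eventually.of_forall fun r hr => hs r ?_)
    exact (le_min ht.le hsT.le).trans_lt hr.1
  -- `E` is constant, possibly nonzero, at large negative times. The transition switches it off
  -- below `-2` and leaves it intact above `-1`, so `θ = E` near `[0, T]` and `θ(0) = -∫ η`.
  set θ : ℝ → ℝ := fun t => Real.smoothTransition (t + 2) * E t with hθ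
  have hθs : ContDiff ℝ ∞ θ :=
    (Real.smoothTransition.contDiff.comp (contDiff_id.add contDiff_const)).mul hEs
  have hθt : tsupport θ ⊆ Icc (-2) s := by
    refine closure_minimal (fun t ht => ?_) isClosed_Icc
    by_contra hn
    rw [mem_Icc, not_and_or, not_le, not_le] at hn
    refine ht ?_
    rcases hn with hn | hn
    · simp [hθ, Real.smoothTransition.zero_of_nonpos (by linarith : t + 2 ≤ 0)]
    · simp [hθ, hE0 t hn]
  have hθE : ∀ t, -1 < t → θ =ᶠ[𝓝 t] E := fun t ht => by
    filter_upwards [lt_mem_nhds ht] with r hr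
    simp [hθ, Real.smoothTransition.one_of_one_le (by linarith : 1 ≤ r + 2)]
  have hw := h θ hθs (isCompact_Icc.of_isClosed_subset (isClosed_tsupport _) hθt)
    (hθt.trans fun t ht => ht.2.trans_lt hsT)
  have e1 : ∫ t in Ioo 0 T, (p t * deriv θ t + q t * θ t)
      = ∫ t in Ioo 0 T, (p t * η t + q t * E t) := by
    refine setIntegral_congr_fun measurableSet_Ioo fun t ht => ?_
    have := hθE t (by linarith [ht.1])
    simp only [this.deriv_eq, this.eq_of_nhds, hE']
  have hηb : ∃ C, ∀ t, ‖η t‖ ≤ C := hηc.exists_bound_of_continuous hηcont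
  obtain ⟨C, hC⟩ := hηb
  have ipη : IntegrableOn (fun t => p t * η t) (Ioo 0 T) :=
    hp.mul_bdd hηcont.aestronglyMeasurable (Eventually.of_forall hC)
  have iQη : IntegrableOn (fun t => Q t * η t) (Ioo 0 T) :=
    hQi.mul_bdd hηcont.aestronglyMeasurable (Eventually.of_forall hC)
  have iη : IntegrableOn η (Ioo 0 T) :=
    (hηcont.integrableOn_Icc).mono_set Ioo_subset_Icc_self
  have iqE' : IntervalIntegrable (fun t => q t * E t) volume 0 T :=
    hq'.mul_continuousOn hEs.continuous.continuousOn
  have iqE : IntegrableOn (fun t => q t * E t) (Ioo 0 T) := by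
    rwa [intervalIntegrable_iff_integrableOn_Ioo_of_le hT.le] at iqE'
  have hθ0 : θ 0 = - ∫ t in Ioo 0 T, η t := by
    rw [(hθE 0 (by norm_num)).eq_of_nhds, ← integral_Ioc_eq_integral_Ioo,
      ← intervalIntegral.integral_of_le hT.le]
    simp [hE]
  have hEac : AbsolutelyContinuousOnInterval E 0 T :=
    (hEs.of_le (mod_cast le_top)).contDiffOn.absolutelyContinuousOnInterval
  -- Integration by parts replaces `∫ qE` by `-∫ Qη`; the boundary terms vanish because `Q(0) = 0`
  -- and `E(T) = 0`.
  have hparts := hQac.integral_mul_deriv_eq_deriv_mul hEac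
  have hQ' : ∫ t in 0..T, deriv Q t * E t = ∫ t in 0..T, q t * E t := by
    refine intervalIntegral.integral_congr_ae ?_
    have := hq'.ae_hasDerivAt_integral
    rw [uIcc_of_le hT.le] at this
    filter_upwards [this] with t ht htm
    rw [uIoc_of_le hT.le] at htm
    rw [(ht ⟨htm.1.le, htm.2⟩ 0 (by simp [hT.le])).deriv]
  rw [hE', hQ', hE0 T hsT, mul_zero] at hparts
  have hQ0 : Q 0 = 0 := intervalIntegral.integral_same
  rw [hQ0, zero_mul, sub_zero, zero_sub] at hparts
  rw [intervalIntegral.integral_of_le hT.le, intervalIntegral.integral_of_le hT.le,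
    integral_Ioc_eq_integral_Ioo, integral_Ioc_eq_integral_Ioo] at hparts
  rw [e1, integral_add ipη iqE, hθ0] at hw
  have e2 : ∫ t, η t • (p t - (c + Q t)) = ∫ t in Ioo 0 T, η t • (p t - (c + Q t)) := by
    refine (setIntegral_eq_integral_of_forall_compl_eq_zero fun t ht => ?_).symm
    rw [image_eq_zero_of_notMem_tsupport fun hm => ht (hηs hm), zero_smul]
  have e3 : ∀ t, η t • (p t - (c + Q t)) = p t * η t - c * η t - Q t * η t := fun t => by
    rw [smul_eq_mul]; ring
  rw [e2]
  simp only [e3]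
  have ipc : IntegrableOn (fun t => p t * η t - c * η t) (Ioo 0 T) := ipη.sub (iη.const_mul c)
  rw [integral_sub ipc iQη, integral_sub ipη (iη.const_mul c),
    integral_const_mul]
  linarith

theorem isSpaceTimeTestFunction_mul {T : ℝ} {d : ℕ} {θ : ℝ → ℝ} {ψ : Space d → ℝ}
    (hθ : ContDiff ℝ ∞ θ) (hθc : HasCompactSupport θ) (hθs : tsupport θ ⊆ Iio T)
    (hψ : IsTestFunction ψ) :
    IsSpaceTimeTestFunction T (fun q : ℝ × Space d => θ q.1 * ψ q.2) := by
  have hsub : tsupport (fun q : ℝ × Space d => θ q.1 * ψ q.2) ⊆ tsupport θ ×ˢ tsupport ψ := by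
    refine closure_minimal (fun q hq => ?_)
      ((isClosed_tsupport _).prod (isClosed_tsupport _))
    exact ⟨subset_tsupport _ (left_ne_zero_of_mul hq), subset_tsupport _ (right_ne_zero_of_mul hq)⟩
  refine ⟨(hθ.comp contDiff_fst).mul (hψ.1.comp contDiff_snd), ?_,
    hsub.trans (prod_mono hθs (subset_univ _))⟩
  exact (hθc.isCompact.prod hψ.2.isCompact).of_isClosed_subset (isClosed_tsupport _) hsub

theorem inner_gradient_right {d : ℕ} (f : Space d → ℝ) (v x : Space d) :
    inner ℝ v (gradient f x) = fderiv ℝ f x v := by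
  rw [gradient, real_inner_comm, InnerProductSpace.toDual_symm_apply]

theorem restrict_cylinder (d : ℕ) (T : ℝ) :
    (volume.restrict (cylinder d T) : Measure (ℝ × Space d)) = slab d T := by
  rw [cylinder, slab, Measure.volume_eq_prod, ← Measure.prod_restrict, Measure.restrict_univ]

/-- Product test functions `θ(t)ψ(x)` turn the weak formulation into a scalar equation `p' = q` for
`p(t) = ∫ u(t)ψ`, whose initial value is the pairing of `u₀` with `ψ`. -/
theorem IsDistributionalSolution.ae_integral_eq {d : ℕ} {β b : ℝ → ℝ} {D K : Space d → Space d}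
    {T : ℝ} {u₀ : Space d → ℝ} {u : ℝ × Space d → ℝ}
    (h : IsDistributionalSolution β b D K T u₀ u) (hT : 0 < T) (hu : Integrable u (slab d T))
    (hβu : Integrable (fun q => β (u q)) (slab d T))
    (hF : AEStronglyMeasurable (flux b D K u) (slab d T))
    (hFL : ∫⁻ t in Ioo 0 T, (∫⁻ x, ‖flux b D K u (t, x)‖ₑ ^ 2) ^ (1 / 2 : ℝ) < ⊤)
    {ψ : Space d → ℝ} (hψ : IsTestFunction ψ) :
    Integrable (fun q => u q * ψ q.2) (slab d T) ∧
    Integrable (fun q => β (u q) * Δ ψ q.2 + fderiv ℝ ψ q.2 (flux b D K u q)) (slab d T) ∧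
    ∀ᵐ t ∂(volume.restrict (Ioo 0 T)), ∫ x, u (t, x) * ψ x = (∫ x, u₀ x * ψ x)
      + ∫ q, (β (u q) * Δ ψ q.2 + fderiv ℝ ψ q.2 (flux b D K u q)) ∂(slab d t) := by
  obtain ⟨C₀, hC₀⟩ := hψ.2.exists_bound_of_continuous hψ.1.continuous
  have i1 : Integrable (fun q => u q * ψ q.2) (slab d T) :=
    hu.mul_bdd (hψ.1.continuous.comp continuous_snd).aestronglyMeasurable
      (Eventually.of_forall fun q => hC₀ q.2)
  have hΔc : Continuous (Δ ψ) := IsLinearWeakSolution.continuous_laplacian hψ.1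
  obtain ⟨C₂, hC₂⟩ := (hψ.2.iteratedFDeriv 2).exists_bound_of_continuous
    (hψ.1.continuous_iteratedFDeriv (m := 2) two_le_infty)
  have i2 : Integrable (fun q => β (u q) * Δ ψ q.2) (slab d T) :=
    hβu.mul_bdd (c := d * C₂) (hΔc.comp continuous_snd).aestronglyMeasurable
      (Eventually.of_forall fun q => (norm_laplacian_le ψ q.2).trans (by gcongr; exact hC₂ _))
  have hfc : Continuous (fderiv ℝ ψ) := hψ.1.continuous_fderiv (by simp)
  have hΦ : MemLp (fun x => ‖fderiv ℝ ψ x‖) 2 :=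
    (hfc.memLp_of_hasCompactSupport (hψ.2.fderiv ℝ)).norm
  have i3 : Integrable (fun q => fderiv ℝ ψ q.2 (flux b D K u q)) (slab d T) := by
    refine (integrable_norm_mul_of_lintegral_sq hF hFL hΦ).mono' ?_
      (Eventually.of_forall fun q => ?_)
    · exact isBoundedBilinearMap_apply.continuous.comp_aestronglyMeasurable
        ((hfc.comp continuous_snd).aestronglyMeasurable.prodMk hF)
    · rw [mul_comm]
      exact ContinuousLinearMap.le_opNorm _ _
  have i4 := i2.add i3
  refine ⟨i1, i4, ?_⟩
  set I₂ : ℝ × Space d → ℝ := fun q => β (u q) * Δ ψ q.2 + fderiv ℝ ψ q.2 (flux b D K u q) with hI₂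
  have i4' : Integrable I₂ (slab d T) := i4
  have key := ae_eq_primitive_of_weak (c := ∫ x, u₀ x * ψ x) hT
    (p := fun t => ∫ x, u (t, x) * ψ x) (q := fun t => ∫ x, I₂ (t, x))
    i1.integral_prod_left i4'.integral_prod_left fun θ hθ hθc hθs => ?_
  · filter_upwards [key, ae_restrict_mem measurableSet_Ioo] with t ht htm
    rw [ht, integral_prod _ (i4'.mono_measure (slab_mono htm.2.le)),
      intervalIntegral.integral_of_le htm.1.le, integral_Ioc_eq_integral_Ioo]
  · have hw := h.weak_form _ (isSpaceTimeTestFunction_mul hθ hθc hθs hψ)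
    rw [restrict_cylinder] at hw
    have hpt : ∀ q : ℝ × Space d, (u q * deriv (fun s => θ s * ψ q.2) q.1
          + β (u q) * Δ (fun y => θ q.1 * ψ y) q.2
          + inner ℝ (flux b D K u q) (gradient (fun y => θ q.1 * ψ y) q.2))
        = deriv θ q.1 * (u q * ψ q.2) + θ q.1 * I₂ q := fun q => by
      have e1 : deriv (fun s => θ s * ψ q.2) q.1 = deriv θ q.1 * ψ q.2 :=
        deriv_mul_const ((hθ.differentiable (by simp)) q.1) _
      have e2 : Δ (fun y => θ q.1 * ψ y) q.2 = θ q.1 * Δ ψ q.2 :=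
        InnerProductSpace.laplacian_smul (θ q.1) ((hψ.1.of_le two_le_infty).contDiffAt)
      have e3 : fderiv ℝ (fun y => θ q.1 * ψ y) q.2 = θ q.1 • fderiv ℝ ψ q.2 :=
        fderiv_const_mul ((hψ.1.differentiable (by simp)) q.2) _
      rw [inner_gradient_right, e1, e2, e3, hI₂]
      simp only [_root_.smul_apply, smul_eq_mul]
      ring
    simp only [hpt] at hw
    obtain ⟨A₀, hA₀⟩ := hθc.exists_bound_of_continuous hθ.continuous
    obtain ⟨A₁, hA₁⟩ := hθc.deriv.exists_bound_of_continuous (hθ.continuous_deriv (by simp))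
    have j1 : Integrable (fun q : ℝ × Space d => deriv θ q.1 * (u q * ψ q.2)) (slab d T) :=
      i1.bdd_mul ((hθ.continuous_deriv (by simp)).comp continuous_fst).aestronglyMeasurable
        (Eventually.of_forall fun q => hA₁ q.1)
    have j2 : Integrable (fun q : ℝ × Space d => θ q.1 * I₂ q) (slab d T) :=
      i4'.bdd_mul (hθ.continuous.comp continuous_fst).aestronglyMeasurable
        (Eventually.of_forall fun q => hA₀ q.1)
    have j12 : Integrable (fun q : ℝ × Space d => deriv θ q.1 * (u q * ψ q.2) + θ q.1 * I₂ q)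
        (slab d T) := j1.add j2
    rw [integral_prod _ j12] at hw
    have e0 : ∫ x, u₀ x * (θ 0 * ψ x) = θ 0 * ∫ x, u₀ x * ψ x := by
      rw [← integral_const_mul]
      exact integral_congr_ae (Eventually.of_forall fun x => by simp only; ring)
    rw [← e0]
    refine Eq.trans ?_ hw
    refine congrArg₂ (· + ·) (integral_congr_ae ?_) rfl
    filter_upwards [i1.prod_right_ae, i4'.prod_right_ae] with t h1 h2
    rw [integral_add (h1.const_mul _) (h2.const_mul _), integral_const_mul, integral_const_mul]
    ring

/-- If `c > 0`, then `p > c/2` almost everywhere near zero, contradicting the limit. The essential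
supremum carries no absolute value, so only this sign is obtained directly. -/
theorem nonpos_of_tendsto_essSup {T : ℝ} {p R : ℝ → ℝ} {c : ℝ} (hT : 0 < T)
    (hp : ∀ᵐ t ∂(volume.restrict (Ioo 0 T)), p t = c + R t) (hR : Tendsto R (𝓝[>] 0) (𝓝 0))
    (hlim : Tendsto (fun δ : ℝ => essSup (fun t => (p t : EReal)) (volume.restrict (Ioo 0 δ)))
      (𝓝[>] 0) (𝓝 0)) : c ≤ 0 := by
  by_contra! hc
  have h1 : ∀ᶠ t in 𝓝[>] (0 : ℝ), -(c / 2) < R t := hR.eventually (lt_mem_nhds (by linarith))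
  obtain ⟨ε, hε, hε'⟩ := mem_nhdsGT_iff_exists_Ioo_subset.1 h1
  have h2 : ∀ᶠ δ in 𝓝[>] (0 : ℝ),
      ((c / 2 : ℝ) : EReal) ≤ essSup (fun t => (p t : EReal)) (volume.restrict (Ioo 0 δ)) := by
    filter_upwards [Ioo_mem_nhdsGT (lt_min hT hε)] with δ hδ
    have hne : volume.restrict (Ioo 0 δ) ≠ 0 := by
      rw [Ne, Measure.restrict_eq_zero, Real.volume_Ioo]
      simpa using hδ.1
    rw [← essSup_const (μ := volume.restrict (Ioo 0 δ)) ((c / 2 : ℝ) : EReal) hne]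
    refine essSup_mono_ae ?_
    have hδT : δ ≤ T := hδ.2.le.trans (min_le_left _ _)
    have hδε : δ ≤ ε := hδ.2.le.trans (min_le_right _ _)
    filter_upwards [ae_restrict_of_ae_restrict_of_subset (Ioo_subset_Ioo_right hδT) hp,
      ae_restrict_mem measurableSet_Ioo] with t ht htm
    have : -(c / 2) < R t := hε' ⟨htm.1, htm.2.trans_le hδε⟩
    rw [ht]
    exact EReal.coe_le_coe_iff.2 (by linarith)
  have h3 := ge_of_tendsto hlim h2
  have h4 : c / 2 ≤ 0 := by exact_mod_cast h3
  linarith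

end NFPE
end

/-! ### Estimates of the flux in space and time -/

noncomputable section

namespace NFPE

open Laplacian

variable {d : ℕ} {T : ℝ}

theorem lintegral_enorm_sq_le_of_bound {v : Space d → ℝ} {M : ℝ} (hM : ∀ᵐ x, |v x| ≤ M) :
    ∫⁻ x, ‖v x‖ₑ ^ 2 ≤ ENNReal.ofReal M * ∫⁻ x, ‖v x‖ₑ := by
  rw [← lintegral_const_mul' _ _ ENNReal.ofReal_ne_top]
  refine lintegral_mono_ae ?_
  filter_upwards [hM] with x hx
  rw [sq]
  gcongr
  rw [← ofReal_norm]
  exact ENNReal.ofReal_le_ofReal hx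

theorem lintegral_slice_enorm_lt_top {u : ℝ × Space d → ℝ} (hu : Integrable u (slab d T)) :
    AEMeasurable (fun t => ∫⁻ x, ‖u (t, x)‖ₑ) (volume.restrict (Ioo 0 T)) ∧
      ∫⁻ t in Ioo 0 T, ∫⁻ x, ‖u (t, x)‖ₑ < ⊤ := by
  refine ⟨hu.1.enorm.lintegral_prod_right', ?_⟩
  rw [← lintegral_prod (f := fun q : ℝ × Space d => ‖u q‖ₑ) hu.1.enorm]
  exact hu.2

/-- The fixed-time estimate with `‖uᵢ(t)‖₂² ≤ M‖uᵢ(t)‖₁` inserted. The resulting `G` is affine in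
the spatial `L¹` norms, hence integrable on `(0, T)`. -/
theorem exists_lintegral_sq_flux_sub_le {K K₁ K₂ D : Space d → Space d} {b : ℝ → ℝ}
    {u₁ u₂ : ℝ × Space d → ℝ} (hK : ∀ x, K x = K₁ x + K₂ x)
    (hK₁ : Integrable K₁) (hK₂ : MemLp K₂ 2) {M B C : ℝ} (hB : 0 ≤ B)
    (hD : ∀ᵐ x, ‖D x‖ ≤ C)
    (hb : ∀ r s, |r| ≤ M → |s| ≤ M → |b r * r - b s * s| ≤ B * |r - s|)
    (i₁ : Integrable u₁ (slab d T)) (i₂ : Integrable u₂ (slab d T))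
    (m₁ : ∀ᵐ q ∂(slab d T), |u₁ q| ≤ M) (m₂ : ∀ᵐ q ∂(slab d T), |u₂ q| ≤ M) :
    ∃ G : ℝ → ℝ≥0∞, AEMeasurable G (volume.restrict (Ioo 0 T)) ∧ ∫⁻ t in Ioo 0 T, G t < ⊤ ∧
      ∀ᵐ t ∂(volume.restrict (Ioo 0 T)),
        ∫⁻ x, ‖flux b D K u₁ (t, x) - flux b D K u₂ (t, x)‖ₑ ^ 2
          ≤ G t * ∫⁻ x, ‖u₁ (t, x) - u₂ (t, x)‖ₑ ^ 2 := by
  obtain ⟨g₁, f₁⟩ := lintegral_slice_enorm_lt_top i₁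
  obtain ⟨g₂, f₂⟩ := lintegral_slice_enorm_lt_top i₂
  have hk₂ : ∫⁻ y, ‖K₂ y‖ₑ ^ 2 < ⊤ := by
    rw [lintegral_enorm_sq_eq]; exact ENNReal.pow_lt_top hK₂.2
  set c := ENNReal.ofReal (B * C) ^ 2 + 4 * (ENNReal.ofReal M * ∫⁻ y, ‖K₁ y‖ₑ) ^ 2 with hc
  have hct : c < ⊤ := ENNReal.add_lt_top.2 ⟨ENNReal.pow_lt_top ENNReal.ofReal_lt_top,
    ENNReal.mul_lt_top (by simp)
      (ENNReal.pow_lt_top (ENNReal.mul_lt_top ENNReal.ofReal_lt_top hK₁.2))⟩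
  set c' := 2 * ENNReal.ofReal M * ∫⁻ y, ‖K₂ y‖ₑ ^ 2 with hc'
  have hct' : c' < ⊤ := ENNReal.mul_lt_top (by simp [ENNReal.mul_lt_top]) hk₂
  refine ⟨fun t => 3 * (c + c' * ((∫⁻ x, ‖u₁ (t, x)‖ₑ) + ∫⁻ x, ‖u₂ (t, x)‖ₑ)), ?_, ?_, ?_⟩
  · exact (aemeasurable_const.add ((g₁.add g₂).const_mul _)).const_mul _
  · rw [lintegral_const_mul' _ _ (by simp), lintegral_add_left measurable_const,
      lintegral_const_mul' _ _ hct'.ne, lintegral_add_left' g₁]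
    refine ENNReal.mul_lt_top (by simp) (ENNReal.add_lt_top.2 ⟨?_, ?_⟩)
    · simpa using ENNReal.mul_lt_top hct ENNReal.ofReal_lt_top
    · exact ENNReal.mul_lt_top hct' (ENNReal.add_lt_top.2 ⟨f₁, f₂⟩)
  · filter_upwards [i₁.prod_right_ae, i₂.prod_right_ae, Measure.ae_ae_of_ae_prod m₁,
      Measure.ae_ae_of_ae_prod m₂] with t h1 h2 h3 h4
    have n1 := lintegral_enorm_sq_le_of_bound h3
    have n2 := lintegral_enorm_sq_le_of_bound h4
    have := lintegral_sq_sliceFlux_sub_le (b := b) hK hK₁ hK₂ hB hD hb h1.1 h2.1 h3 h4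
      (n1.trans_lt (ENNReal.mul_lt_top ENNReal.ofReal_lt_top h1.2))
      (n2.trans_lt (ENNReal.mul_lt_top ENNReal.ofReal_lt_top h2.2))
    refine this.trans ?_
    gcongr 3 * ?_ * _
    rw [← hc]
    calc _ ≤ c + 2 * (ENNReal.ofReal M * (∫⁻ x, ‖u₁ (t, x)‖ₑ)
          + ENNReal.ofReal M * ∫⁻ x, ‖u₂ (t, x)‖ₑ) * ∫⁻ y, ‖K₂ y‖ₑ ^ 2 := by gcongr
      _ = _ := by rw [hc']; ring

/-- From `√(GN) ≤ G + N`. With `N = ‖z(t)‖₂²` this puts the flux in `L¹(0,T; L²)`. -/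
theorem lintegral_sqrt_lt_top_of_le {X : Type*} [MeasurableSpace X] {μ : Measure X}
    {f G N : X → ℝ≥0∞} (hG : AEMeasurable G μ) (hGi : ∫⁻ x, G x ∂μ < ⊤) (hNi : ∫⁻ x, N x ∂μ < ⊤)
    (h : ∀ᵐ x ∂μ, f x ≤ G x * N x) : ∫⁻ x, f x ^ (1 / 2 : ℝ) ∂μ < ⊤ := by
  refine (lintegral_mono_ae (g := fun x => G x + N x) ?_).trans_lt ?_
  · filter_upwards [h] with x hx
    calc f x ^ (1 / 2 : ℝ) ≤ ((G x + N x) ^ (2 : ℝ)) ^ (1 / 2 : ℝ) := by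
          gcongr
          refine hx.trans ?_
          rw [ENNReal.rpow_two, sq]
          exact mul_le_mul' le_self_add le_add_self
      _ = _ := by rw [← ENNReal.rpow_mul]; norm_num
  · rw [lintegral_add_left' hG]
    exact ENNReal.add_lt_top.2 ⟨hGi, hNi⟩

theorem lintegral_slice_sq_lt_top {z : ℝ × Space d → ℝ} (hz : MemLp z 2 (slab d T)) :
    ∫⁻ t in Ioo 0 T, ∫⁻ x, ‖z (t, x)‖ₑ ^ 2 < ⊤ := by
  rw [← lintegral_prod (f := fun q : ℝ × Space d => ‖z q‖ₑ ^ 2) (hz.1.enorm.pow_const 2),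
    lintegral_enorm_sq_eq]
  exact ENNReal.pow_lt_top hz.2

theorem tendsto_integral_slab {I : ℝ × Space d → ℝ} (hT : 0 < T) (hI : Integrable I (slab d T)) :
    Tendsto (fun t => ∫ q, I q ∂(slab d t)) (𝓝[>] 0) (𝓝 0) := by
  have hq : IntegrableOn (fun t => ∫ x, I (t, x)) (Icc 0 T) := by
    rw [integrableOn_Icc_iff_integrableOn_Ioo]
    exact hI.integral_prod_left
  have hc := intervalIntegral.continuousOn_primitive_interval (μ := volume)
    (by rwa [uIcc_of_le hT.le] : IntegrableOn (fun t => ∫ x, I (t, x)) (uIcc 0 T))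
  rw [uIcc_of_le hT.le] at hc
  have h0 := hc 0 ⟨le_rfl, hT.le⟩
  simp only [ContinuousWithinAt, intervalIntegral.integral_same] at h0
  have hm : Ioo (0 : ℝ) T ∈ 𝓝[>] (0 : ℝ) := Ioo_mem_nhdsGT hT
  refine (h0.mono_left (nhdsWithin_le_of_mem (mem_of_superset hm Ioo_subset_Icc_self))).congr' ?_
  filter_upwards [hm] with t ht
  rw [intervalIntegral.integral_of_le ht.1.le, integral_Ioc_eq_integral_Ioo,
    integral_prod _ (hI.mono_measure (slab_mono ht.2.le))]

/-- The function `β(r) - αr` is nondecreasing. -/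
theorem mul_sq_le_of_le_deriv {β : ℝ → ℝ} (hβ : Differentiable ℝ β) {α : ℝ}
    (hα : ∀ r, α ≤ deriv β r) (r s : ℝ) : α * (r - s) ^ 2 ≤ (r - s) * (β r - β s) := by
  have hm : Monotone fun r => β r - α * r := by
    refine monotone_of_deriv_nonneg (hβ.sub (differentiable_id.const_mul α)) fun x => ?_
    have : HasDerivAt (fun r => β r - α * r) (deriv β x - α * 1) x :=
      (hβ x).hasDerivAt.sub ((hasDerivAt_id x).const_mul α)
    rw [this.deriv]
    linarith [hα x]
  rcases le_total r s with h | h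
  · have := hm h
    simp only at this
    nlinarith
  · have := hm h
    simp only at this
    nlinarith

theorem flux_zero (b : ℝ → ℝ) (D K : Space d → Space d) (q : ℝ × Space d) :
    flux b D K (fun _ => 0) q = 0 := zero_smul _ _

end NFPE
end

/-! ### The difference of two solutions -/

noncomputable section

namespace NFPE

open Laplacian

variable {d : ℕ} {T : ℝ}

section Difference

variable {β b : ℝ → ℝ} {D K : Space d → Space d} {u₀₁ u₀₂ : Space d → ℝ}
  {u₁ u₂ : ℝ × Space d → ℝ}

/-- The weak formulation, in integrated form, for the difference of two solutions. -/
theorem ae_integral_sub_eq (hT : 0 < T)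
    (h₁ : IsDistributionalSolution β b D K T u₀₁ u₁)
    (h₂ : IsDistributionalSolution β b D K T u₀₂ u₂)
    (hu₁ : Integrable u₁ (slab d T)) (hu₂ : Integrable u₂ (slab d T))
    (hβ₁ : Integrable (fun q => β (u₁ q)) (slab d T))
    (hβ₂ : Integrable (fun q => β (u₂ q)) (slab d T))
    (hF₁ : AEStronglyMeasurable (flux b D K u₁) (slab d T))
    (hF₂ : AEStronglyMeasurable (flux b D K u₂) (slab d T))
    (hL₁ : ∫⁻ t in Ioo 0 T, (∫⁻ x, ‖flux b D K u₁ (t, x)‖ₑ ^ 2) ^ (1 / 2 : ℝ) < ⊤)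
    (hL₂ : ∫⁻ t in Ioo 0 T, (∫⁻ x, ‖flux b D K u₂ (t, x)‖ₑ ^ 2) ^ (1 / 2 : ℝ) < ⊤)
    (hlim : ∀ ψ : Space d → ℝ, IsTestFunction ψ →
      Tendsto (fun δ : ℝ =>
          essSup (fun t : ℝ => ((∫ x, (u₁ (t, x) - u₂ (t, x)) * ψ x : ℝ) : EReal))
            (volume.restrict (Ioo 0 δ)))
        (𝓝[>] 0) (𝓝 0)) {ψ : Space d → ℝ} (hψ : IsTestFunction ψ) :
    ∀ᵐ t ∂(volume.restrict (Ioo 0 T)), ∫ x, (u₁ (t, x) - u₂ (t, x)) * ψ x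
      = ∫ q, ((β (u₁ q) - β (u₂ q)) * Δ ψ q.2
        + fderiv ℝ ψ q.2 (flux b D K u₁ q - flux b D K u₂ q)) ∂(slab d t) := by
  have main : ∀ ψ : Space d → ℝ, IsTestFunction ψ →
      Integrable (fun q => (β (u₁ q) - β (u₂ q)) * Δ ψ q.2
        + fderiv ℝ ψ q.2 (flux b D K u₁ q - flux b D K u₂ q)) (slab d T) ∧
      ∀ᵐ t ∂(volume.restrict (Ioo 0 T)), ∫ x, (u₁ (t, x) - u₂ (t, x)) * ψ x
        = ((∫ x, u₀₁ x * ψ x) - ∫ x, u₀₂ x * ψ x)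
          + ∫ q, ((β (u₁ q) - β (u₂ q)) * Δ ψ q.2
            + fderiv ℝ ψ q.2 (flux b D K u₁ q - flux b D K u₂ q)) ∂(slab d t) := by
    intro ψ hψ
    obtain ⟨i₁, j₁, e₁⟩ := h₁.ae_integral_eq hT hu₁ hβ₁ hF₁ hL₁ hψ
    obtain ⟨i₂, j₂, e₂⟩ := h₂.ae_integral_eq hT hu₂ hβ₂ hF₂ hL₂ hψ
    have epoint : ∀ q : ℝ × Space d, (β (u₁ q) - β (u₂ q)) * Δ ψ q.2
        + fderiv ℝ ψ q.2 (flux b D K u₁ q - flux b D K u₂ q)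
        = (β (u₁ q) * Δ ψ q.2 + fderiv ℝ ψ q.2 (flux b D K u₁ q))
          - (β (u₂ q) * Δ ψ q.2 + fderiv ℝ ψ q.2 (flux b D K u₂ q)) := fun q => by
      rw [map_sub]; ring
    simp only [epoint]
    refine ⟨j₁.sub j₂, ?_⟩
    filter_upwards [e₁, e₂, i₁.prod_right_ae, i₂.prod_right_ae,
      ae_restrict_mem measurableSet_Ioo] with t h1 h2 k1 k2 ht
    have hle := slab_mono (d := d) ht.2.le
    simp only [sub_mul]
    rw [integral_sub k1 k2, h1, h2, integral_sub (j₁.mono_measure hle) (j₂.mono_measure hle)]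
    ring
  have hle : ∀ ψ : Space d → ℝ, IsTestFunction ψ →
      (∫ x, u₀₁ x * ψ x) - ∫ x, u₀₂ x * ψ x ≤ 0 := fun ψ hψ =>
    nonpos_of_tendsto_essSup hT (main ψ hψ).2 (tendsto_integral_slab hT (main ψ hψ).1) (hlim ψ hψ)
  -- The one-sided bound for `-ψ` gives the opposite inequality.
  have h0 : (∫ x, u₀₁ x * ψ x) - ∫ x, u₀₂ x * ψ x = 0 := by
    have hneg := hle (fun x => -ψ x) ⟨hψ.1.neg, hψ.2.neg⟩
    simp only [mul_neg, integral_neg] at hneg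
    linarith [hle ψ hψ]
  filter_upwards [(main ψ hψ).2] with t ht
  rw [ht, h0, zero_add]

/-- The linear theory asks for measurable functions, while the differences are only almost
everywhere measurable; measurable representatives are chosen and every condition is transferred
along Fubini. -/
theorem exists_isLinearWeakSolution (hT : 0 < T)
    (h₁ : IsDistributionalSolution β b D K T u₀₁ u₁)
    (h₂ : IsDistributionalSolution β b D K T u₀₂ u₂)
    (hu₁ : Integrable u₁ (slab d T)) (hu₂ : Integrable u₂ (slab d T))
    (hβ₁ : Integrable (fun q => β (u₁ q)) (slab d T))
    (hβ₂ : Integrable (fun q => β (u₂ q)) (slab d T))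
    (hu : MemLp (fun q => u₁ q - u₂ q) 2 (slab d T))
    (hβ : MemLp (fun q => β (u₁ q) - β (u₂ q)) 2 (slab d T))
    (hF₁ : AEStronglyMeasurable (flux b D K u₁) (slab d T))
    (hF₂ : AEStronglyMeasurable (flux b D K u₂) (slab d T))
    (hI₁ : ∀ᵐ t ∂(volume.restrict (Ioo 0 T)), Integrable fun x => flux b D K u₁ (t, x))
    (hI₂ : ∀ᵐ t ∂(volume.restrict (Ioo 0 T)), Integrable fun x => flux b D K u₂ (t, x))
    (hL₁ : ∫⁻ t in Ioo 0 T, (∫⁻ x, ‖flux b D K u₁ (t, x)‖ₑ ^ 2) ^ (1 / 2 : ℝ) < ⊤)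
    (hL₂ : ∫⁻ t in Ioo 0 T, (∫⁻ x, ‖flux b D K u₂ (t, x)‖ₑ ^ 2) ^ (1 / 2 : ℝ) < ⊤)
    (hL : ∫⁻ t in Ioo 0 T,
      (∫⁻ x, ‖flux b D K u₁ (t, x) - flux b D K u₂ (t, x)‖ₑ ^ 2) ^ (1 / 2 : ℝ) < ⊤)
    (hlim : ∀ ψ : Space d → ℝ, IsTestFunction ψ →
      Tendsto (fun δ : ℝ =>
          essSup (fun t : ℝ => ((∫ x, (u₁ (t, x) - u₂ (t, x)) * ψ x : ℝ) : EReal))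
            (volume.restrict (Ioo 0 δ)))
        (𝓝[>] 0) (𝓝 0)) :
    ∃ (z w : ℝ × Space d → ℝ) (F : ℝ × Space d → Space d), IsLinearWeakSolution T z w F ∧
      (fun q => u₁ q - u₂ q) =ᵐ[slab d T] z ∧
      (fun q => β (u₁ q) - β (u₂ q)) =ᵐ[slab d T] w ∧
      (fun q => flux b D K u₁ q - flux b D K u₂ q) =ᵐ[slab d T] F := by
  have hFm : AEStronglyMeasurable (fun q => flux b D K u₁ q - flux b D K u₂ q) (slab d T) :=
    hF₁.sub hF₂
  have ez := hu.1.ae_eq_mk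
  have ew := hβ.1.ae_eq_mk
  have eF := hFm.ae_eq_mk
  have eFs := Measure.ae_ae_of_ae_prod eF
  refine ⟨hu.1.mk, hβ.1.mk, hFm.mk, ?_, ez, ew, eF⟩
  refine
    { measurable_z := hu.1.stronglyMeasurable_mk.measurable
      measurable_w := hβ.1.stronglyMeasurable_mk.measurable
      measurable_F := hFm.stronglyMeasurable_mk.measurable
      integrable_z := (hu₁.sub hu₂).congr ez
      integrable_w := (hβ₁.sub hβ₂).congr ew
      memLp_z := hu.ae_eq ez
      memLp_w := hβ.ae_eq ew
      integrable_F := ?_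
      lintegral_F := ?_
      weak := fun ψ hψ => ?_ }
  · filter_upwards [hI₁, hI₂, eFs] with t h1 h2 h3
    exact (h1.sub h2).congr h3
  · refine lt_of_eq_of_lt (lintegral_congr_ae ?_) hL
    filter_upwards [eFs] with t h3
    refine congrArg (· ^ (1 / 2 : ℝ)) (lintegral_congr_ae ?_)
    filter_upwards [h3] with x hx
    rw [← hx]
  · filter_upwards [ae_integral_sub_eq hT h₁ h₂ hu₁ hu₂ hβ₁ hβ₂ hF₁ hF₂ hL₁ hL₂ hlim hψ,
      Measure.ae_ae_of_ae_prod ez, ae_restrict_mem measurableSet_Ioo] with t h1 h2 ht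
    have e1 : ∫ x, hu.1.mk (fun q => u₁ q - u₂ q) (t, x) * ψ x
        = ∫ x, (u₁ (t, x) - u₂ (t, x)) * ψ x := by
      refine integral_congr_ae ?_
      filter_upwards [h2] with x hx
      rw [← hx]
    rw [e1, h1]
    refine integral_congr_ae ?_
    have hac := (slab_mono (d := d) ht.2.le).absolutelyContinuous
    filter_upwards [hac.ae_le ew, hac.ae_le eF] with q h3 h4
    rw [← h3, ← h4]

end Difference

theorem exists_ae_norm_le {X V : Type*} [MeasurableSpace X] {μ : Measure X}
    [NormedAddCommGroup V] {f : X → V} (hf : MemLp f ⊤ μ) : ∃ C : ℝ, ∀ᵐ x ∂μ, ‖f x‖ ≤ C := by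
  refine ⟨(eLpNorm f ⊤ μ).toReal, ?_⟩
  rw [eLpNorm_exponent_top]
  have ht : eLpNormEssSup f μ ≠ ⊤ := by
    have := hf.2.ne
    rwa [eLpNorm_exponent_top] at this
  filter_upwards [ae_le_eLpNormEssSup (f := f) (μ := μ)] with x hx
  rw [← toReal_enorm]
  exact ENNReal.toReal_mono ht hx

end NFPE
end

/-! ### Reduction of the nonlinear problem to the linear uniqueness result. -/

theorem theorem4p1 (d : ℕ) (hd : 2 ≤ d) (T : ℝ) (hT : 0 < T)
    (β b : ℝ → ℝ) (D K : NFPE.Space d → NFPE.Space d)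
    -- (i)
    (hβ : ContDiff ℝ 1 β) (hβ0 : β 0 = 0)
    (α : ℝ) (hα : 0 < α) (hβα : ∀ r, α ≤ deriv β r)
    -- (ii)
    (hDinf : MemLp D ∞ volume) (hD2 : MemLp D 2 volume) (hdivD : NFPE.DivergenceNonneg D)
    -- (iii)
    (hb : ContDiff ℝ 1 b) (hb0 : ∀ r, 0 ≤ b r)
    -- (iv)
    (hK : ContDiffOn ℝ 1 K {0}ᶜ) (hK1 : IntegrableOn K (NFPE.unitBall d))
    (p : ℝ≥0∞) (hp1 : 1 ≤ p) (hp2 : p ≤ 2)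
    (hKp : MemLp K p (volume.restrict (NFPE.unitBall d)ᶜ))
    (hdivK : MemLp (fun x => (NFPE.divergence K x)⁻) ∞ volume)
    (hKx : MemLp (fun x => (inner ℝ (K x) x)⁻ * ‖x‖⁻¹) ∞ (volume.restrict (NFPE.unitBall d)))
    -- (v)
    (hKinf : MemLp K ∞ (volume.restrict (NFPE.unitBall d)ᶜ))
    -- two distributional solutions in `L¹ ∩ L^∞`
    (u₀₁ u₀₂ : NFPE.Space d → ℝ) (u₁ u₂ : ℝ × NFPE.Space d → ℝ)
    (hu₁1 : MemLp u₁ 1 (volume.restrict (NFPE.cylinder d T)))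
    (hu₁inf : MemLp u₁ ∞ (volume.restrict (NFPE.cylinder d T)))
    (hu₂1 : MemLp u₂ 1 (volume.restrict (NFPE.cylinder d T)))
    (hu₂inf : MemLp u₂ ∞ (volume.restrict (NFPE.cylinder d T)))
    (hu₁ : NFPE.IsDistributionalSolution β b D K T u₀₁ u₁)
    (hu₂ : NFPE.IsDistributionalSolution β b D K T u₀₂ u₂)
    -- the difference tends weakly to zero at the initial time
    (hlim : ∀ ψ : NFPE.Space d → ℝ, NFPE.IsTestFunction ψ →
      Tendsto (fun δ : ℝ =>
          essSup (fun t : ℝ => ((∫ x, (u₁ (t, x) - u₂ (t, x)) * ψ x : ℝ) : EReal))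
            (volume.restrict (Ioo 0 δ)))
        (𝓝[>] 0) (𝓝 0)) :
    u₁ =ᵐ[volume.restrict (NFPE.cylinder d T)] u₂ := by
  have m₁ := hu₁.locallyIntegrable_flux.aestronglyMeasurable
  have m₂ := hu₂.locallyIntegrable_flux.aestronglyMeasurable
  rw [NFPE.restrict_cylinder] at *
  have i₁ : Integrable u₁ (NFPE.slab d T) := memLp_one_iff_integrable.1 hu₁1
  have i₂ : Integrable u₂ (NFPE.slab d T) := memLp_one_iff_integrable.1 hu₂1
  have s₁ := NFPE.memLp_two_of_memLp_of_memLp_top le_rfl (by norm_num) hu₁1 hu₁inf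
  have s₂ := NFPE.memLp_two_of_memLp_of_memLp_top le_rfl (by norm_num) hu₂1 hu₂inf
  obtain ⟨M₁, hM₁⟩ := NFPE.exists_ae_norm_le hu₁inf
  obtain ⟨M₂, hM₂⟩ := NFPE.exists_ae_norm_le hu₂inf
  obtain ⟨C, hC⟩ := NFPE.exists_ae_norm_le hDinf
  set M : ℝ := |M₁| + |M₂| with hM
  have hM0 : 0 ≤ M := by positivity
  replace hM₁ : ∀ᵐ q ∂(NFPE.slab d T), |u₁ q| ≤ M := by
    filter_upwards [hM₁] with q hq
    rw [← Real.norm_eq_abs]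
    linarith [le_abs_self M₁, abs_nonneg M₂]
  replace hM₂ : ∀ᵐ q ∂(NFPE.slab d T), |u₂ q| ≤ M := by
    filter_upwards [hM₂] with q hq
    rw [← Real.norm_eq_abs]
    linarith [le_abs_self M₂, abs_nonneg M₁]
  obtain ⟨L, hL0, hL⟩ := NFPE.exists_lipschitz_of_contDiff hβ M
  -- The drift contains `b(r) r`, which is `C¹` and hence Lipschitz on `[-M, M]`.
  obtain ⟨B, hB0, hB⟩ := NFPE.exists_lipschitz_of_contDiff (hb.mul contDiff_id) M
  obtain ⟨B', hB'⟩ := (isCompact_Icc (a := -M) (b := M)).exists_bound_of_continuousOn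
    hb.continuous.continuousOn
  replace hB' : ∀ r, |r| ≤ M → |b r| ≤ B' := fun r hr => hB' r (abs_le.1 hr)
  -- the kernel as a sum of an integrable and a square integrable part
  have hmeas : MeasurableSet (NFPE.unitBall d) := Metric.isClosed_closedBall.measurableSet
  have k₁ : Integrable ((NFPE.unitBall d).indicator K) := hK1.integrable_indicator hmeas
  have k₂ : MemLp ((NFPE.unitBall d)ᶜ.indicator K) 2 := by
    rw [memLp_indicator_iff_restrict hmeas.compl]
    exact NFPE.memLp_two_of_memLp_of_memLp_top hp1 hp2 hKp hKinf
  have hKsum : ∀ x, K x = (NFPE.unitBall d).indicator K x + (NFPE.unitBall d)ᶜ.indicator K x :=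
    fun x => (congrFun (indicator_self_add_compl (NFPE.unitBall d) K) x).symm
  have β_le : ∀ r, |r| ≤ M → |β r| ≤ L * |r| := fun r hr => by
    have := hL r 0 hr (by simpa using hM0)
    simpa [hβ0] using this
  have β_int : ∀ u : ℝ × NFPE.Space d → ℝ, Integrable u (NFPE.slab d T) →
      (∀ᵐ q ∂(NFPE.slab d T), |u q| ≤ M) → Integrable (fun q => β (u q)) (NFPE.slab d T) := by
    intro u hu hm
    refine (hu.norm.const_mul L).mono' (hβ.continuous.comp_aestronglyMeasurable hu.1) ?_
    filter_upwards [hm] with q hq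
    exact β_le _ hq
  have hw : ∀ᵐ q ∂(NFPE.slab d T), |β (u₁ q) - β (u₂ q)| ≤ L * |u₁ q - u₂ q| := by
    filter_upwards [hM₁, hM₂] with q h1 h2
    exact hL _ _ h1 h2
  have sz : MemLp (fun q => u₁ q - u₂ q) 2 (NFPE.slab d T) := s₁.sub s₂
  have sw : MemLp (fun q => β (u₁ q) - β (u₂ q)) 2 (NFPE.slab d T) :=
    sz.of_le_mul ((hβ.continuous.comp_aestronglyMeasurable i₁.1).sub
      (hβ.continuous.comp_aestronglyMeasurable i₂.1)) hw
  have fluxL : ∀ u : ℝ × NFPE.Space d → ℝ, Integrable u (NFPE.slab d T) →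
      MemLp u 2 (NFPE.slab d T) → (∀ᵐ q ∂(NFPE.slab d T), |u q| ≤ M) →
      ∫⁻ t in Ioo 0 T, (∫⁻ x, ‖NFPE.flux b D K u (t, x)‖ₑ ^ 2) ^ (1 / 2 : ℝ) < ⊤ := by
    intro u hu hs hm
    -- The bound for a single flux is the difference estimate against the zero function, whose flux
    -- vanishes.
    obtain ⟨G, hG, hGi, hGb⟩ := NFPE.exists_lintegral_sq_flux_sub_le (u₂ := fun _ => 0) hKsum k₁ k₂
      hB0.le hC hB hu (integrable_zero _ _ _) hm (Eventually.of_forall fun _ => by simpa using hM0)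
    simp only [NFPE.flux_zero, sub_zero] at hGb
    exact NFPE.lintegral_sqrt_lt_top_of_le hG hGi (NFPE.lintegral_slice_sq_lt_top hs) hGb
  have fluxI : ∀ u : ℝ × NFPE.Space d → ℝ, Integrable u (NFPE.slab d T) →
      (∀ᵐ q ∂(NFPE.slab d T), |u q| ≤ M) →
      AEStronglyMeasurable (NFPE.flux b D K u) (NFPE.slab d T) →
      ∀ᵐ t ∂(volume.restrict (Ioo 0 T)), Integrable fun x => NFPE.flux b D K u (t, x) := by
    intro u hu hm hF
    filter_upwards [hF.prodMk_left, hu.prod_right_ae, Measure.ae_ae_of_ae_prod hm] with t h1 h2 h3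
    exact NFPE.integrable_sliceFlux hKsum k₁ k₂ hC hB' h1 h2 h3
      ((NFPE.lintegral_enorm_sq_le_of_bound h3).trans_lt
        (ENNReal.mul_lt_top ENNReal.ofReal_lt_top h2.2))
  obtain ⟨G, hG, hGi, hGb⟩ := NFPE.exists_lintegral_sq_flux_sub_le hKsum k₁ k₂
    hB0.le hC hB i₁ i₂ hM₁ hM₂
  have hN := NFPE.lintegral_slice_sq_lt_top sz
  obtain ⟨z, w, F, hsol, ez, ew, eF⟩ := NFPE.exists_isLinearWeakSolution hT hu₁ hu₂ i₁ i₂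
    (β_int u₁ i₁ hM₁) (β_int u₂ i₂ hM₂) sz sw m₁ m₂ (fluxI u₁ i₁ hM₁ m₁) (fluxI u₂ i₂ hM₂ m₂)
    (fluxL u₁ i₁ s₁ hM₁) (fluxL u₂ i₂ s₂ hM₂)
    (NFPE.lintegral_sqrt_lt_top_of_le hG hGi hN hGb) hlim
  -- Adding one to the coefficient keeps the weight `c₂ = a/α` positive where `G` vanishes.
  have hz0 := hsol.ae_eq_zero hT hα hL0 (a := fun t => 1 + (G t).toReal)
    (fun t => by simp) ?_ ?_ ?_ ?_
  · filter_upwards [hz0, ez] with q h1 h2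
    rw [← sub_eq_zero, h2, h1]
  · exact (integrableOn_const (by simp)).add (integrable_toReal_of_lintegral_ne_top hG hGi.ne)
  · filter_upwards [ez, ew] with q h1 h2
    rw [← h1, ← h2]
    exact NFPE.mul_sq_le_of_le_deriv (hβ.differentiable (by simp)) hβα _ _
  · filter_upwards [ez, ew, hw] with q h1 h2 h3
    rw [← h1, ← h2]
    exact h3
  · have hNm : AEMeasurable (fun t => ∫⁻ x, ‖u₁ (t, x) - u₂ (t, x)‖ₑ ^ 2)
        (volume.restrict (Ioo 0 T)) := (sz.1.enorm.pow_const 2).lintegral_prod_right'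
    filter_upwards [hGb, ae_lt_top' hG hGi.ne, ae_lt_top' hNm hN.ne,
      Measure.ae_ae_of_ae_prod ez, Measure.ae_ae_of_ae_prod eF] with t h1 h2 h3 h4 h5
    have eN : ∫⁻ x, ‖u₁ (t, x) - u₂ (t, x)‖ₑ ^ 2 = ∫⁻ x, ‖z (t, x)‖ₑ ^ 2 := by
      refine lintegral_congr_ae ?_
      filter_upwards [h4] with x hx
      rw [hx]
    have eL : ∫⁻ x, ‖NFPE.flux b D K u₁ (t, x) - NFPE.flux b D K u₂ (t, x)‖ₑ ^ 2
        = ∫⁻ x, ‖F (t, x)‖ₑ ^ 2 := by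
      refine lintegral_congr_ae ?_
      filter_upwards [h5] with x hx
      rw [hx]
    rw [eN, eL] at h1
    rw [eN] at h3
    have mF : Measurable fun x => F (t, x) := hsol.measurable_F.comp (by fun_prop)
    have mz : Measurable fun x => z (t, x) := hsol.measurable_z.comp (by fun_prop)
    have hFi : ∫ x, ‖F (t, x)‖ ^ 2 = (∫⁻ x, ‖F (t, x)‖ₑ ^ 2).toReal := by
      rw [integral_eq_lintegral_of_nonneg_ae (Eventually.of_forall fun x => sq_nonneg _)
        (mF.norm.pow_const 2).aestronglyMeasurable]
      simp only [ENNReal.ofReal_pow (norm_nonneg _), ofReal_norm]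
    have hzi : ∫ x, z (t, x) ^ 2 = (∫⁻ x, ‖z (t, x)‖ₑ ^ 2).toReal := by
      rw [integral_eq_lintegral_of_nonneg_ae (Eventually.of_forall fun x => sq_nonneg _)
        (mz.pow_const 2).aestronglyMeasurable]
      refine congrArg ENNReal.toReal (lintegral_congr fun x => ?_)
      rw [← sq_abs, ENNReal.ofReal_pow (abs_nonneg _), ← Real.norm_eq_abs, ofReal_norm]
    rw [hFi, hzi]
    have := ENNReal.toReal_mono (ENNReal.mul_lt_top h2 h3).ne h1
    rw [ENNReal.toReal_mul] at this
    refine this.trans (mul_le_mul_of_nonneg_right ?_ ENNReal.toReal_nonneg)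
    linarith
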